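/- **Setting.** Near its conformal boundary at infinity $S^1=\mathbb R/2\pi\mathbb Z$, a two-dimensional asymptotically locally hyperbolic metric of constant scalar curvature $-2$ with mass-aspect function $\mu:S^1\to\mathbb R$ is $g_\mu=\frac{dr^2}{r^2}+\big(r+\frac{\mu(\varphi)}{4r}\big)^2d\varphi^2$; the constant $\mu\equiv m$ gives the Birmingham–Kottler (BK) metric $\frac{d\rho^2}{\rho^2-m}+\rho^2d\varphi^2$ with $\rho=r+\frac{m}{4r}$. In general, the mass aspect of a metric $\frac{dr^2}{r^2}+r^2d\varphi^2+r^{-2}\mu_{ij}\theta^i\theta^j+O(r^{-3})$, where $\theta^1=r\,d\varphi$, $\theta^2=dr/r$, is $\mu=\mu_{22}+2\mu_{11}$. The asymptotic symmetry given by an orientation-preserving smooth diffeomorphism $f$ of $S^1$ replaces $\mu$ by $\mu_f=(f')^2\,\mu\circ f-2S(f)$, with $S(f)=\frac{f'''}{f'}-\frac32\big(\frac{f''}{f'}\big)^2$. We say that $\mu$ *has mass parameter* $m_c$ if some $\mu_f$ is the constant $m_c$ and $m_c$ is the only constant obtainable in this way (so that the metric can be brought to the BK form of mass $m_c$ near the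 conformal boundary). A *monodromy matrix* of $\mu$ is the matrix $M$ with $\Psi(x+2\pi)=M\Psi(x)$ for a pair $\Psi=(\psi_1,\psi_2)^T$ of solutions of Hill's equation $\psi''=\frac\mu4\psi$ with $\psi_1'\psi_2-\psi_2'\psi_1=1$. A real $2\times2$ matrix $M$ of determinant one is *hyperbolic* if $|\operatorname{tr}M|>2$, *elliptic* if $|\operatorname{tr}M|<2$ or $M=\pm\mathbb I$, and *parabolic* if $|\operatorname{tr}M|=2$ and $M\ne\pm\mathbb I$. For $t\in[-1,1]$, a number $m_c<0$ is *the root of $\cos(\sqrt{|m_c|}\pi)=t$ chosen by zero counting* if it is the unique negative solution with $\sqrt{|m_c|}\in(N-1,N]$, where $N$ is the number of zeros in $[a,a+2\pi)$ of any nontrivial solution of Hill's equation (for $\mu$) vanishing at $a$, this number being independent of the solution and of $a$. **Gluing.** Given BK ends of masses $\check m,\hat m$, let $\check f,\hat f$ be orientation-preserving smooth diffeomorphisms of $S^1$ (lifted to $\mathbb R$) which are prescribed on $[-\frac\pi2,\frac\pi2]$, respectively on $[\frac\pi2,\frac{3\pi}2]$, as below and are arbitrary elsewhere; the prescribed functions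 make the transformed mass aspects $\check\mu=\check m_{\check f}$ and $\hat\mu=\hat m_{\hat f}$ equal to $-1$ there, so that the metrics $g_{\check\mu}$, $g_{\hat\mu}$ are exactly those of the hyperbolic plane over these half-circles. The Maskit-glued metric $g$ is obtained by cutting off these two hyperbolic halves along the geodesics $\varphi=\pm\frac\pi2$ and identifying the remaining halves along them: $g=g_{\hat\mu}$ over $[-\frac\pi2,\frac\pi2]$ and $g=g_{\check\mu}$ over $[\frac\pi2,\frac{3\pi}2]$. With boost parameters $\check\beta,\hat\beta\in[0,1)$ and $\check\kappa=\sqrt{\frac{1+\check\beta}{1-\check\beta}}$, $\hat\kappa=\sqrt{\frac{1+\hat\beta}{1-\hat\beta}}$, put $$\check a(\varphi)=\arcsin\frac{\sqrt{1-\check\beta^2}\sin\varphi}{1+\check\beta\cos\varphi},\qquad \hat a(\varphi)=-\arcsin\frac{\sqrt{1-\hat\beta^2}\sin\varphi}{1-\hat\beta\cos\varphi}.$$ The prescribed functions are: for negative masses $\check f=\check a/\sqrt{|\check m|}$, $\hat f=\hat a/\sqrt{|\hat m|}$; for cusps (mass zero) $\check f=\tan(\check a/2)$, $\hat f=\tan(\hat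 a/2)$; for positive $\hat m$, with a parameter $\hat\omega>1$, $\hat f=-\frac1{\sqrt{\hat m}}\log\big(\cot\frac\varphi2+\hat\omega\coth(\sqrt{\hat m}\pi)\big)$. (Since these have to extend to diffeomorphisms of $S^1$, their images have length less than $2\pi$; for a negative mass $m\ge-\frac14$ this forces $\beta>\cos(\sqrt{|m|}\pi)$.) **Theorem.** Let $\mu$ be the mass-aspect function of the glued metric, and write $\check c=\cos(\sqrt{|\check m|}\pi)$, $\check s=\sin(\sqrt{|\check m|}\pi)$, $\hat c=\cos(\sqrt{|\hat m|}\pi)$, $\hat s=\sin(\sqrt{|\hat m|}\pi)$. 1. *Negative–negative* ($\check m,\hat m<0$). A monodromy matrix of $\mu$ is $$M=\begin{pmatrix}\check\kappa\hat\kappa\,\check s\hat s-\check c\hat c&-\hat\kappa^{-1}(\check\kappa\hat\kappa\,\check s\hat c+\check c\hat s)\\ \check\kappa^{-1}\check s\hat c+\hat\kappa\,\check c\hat s&(\check\kappa\hat\kappa)^{-1}\check s\hat s-\check c\hat c\end{pmatrix},\qquad t:=\tfrac12\operatorname{tr}M=\sqrt{\tfrac{(1+\check\beta\hat\beta)^2}{(1-\check\beta^2)(1-\hat\beta^2)}}\;\check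 s\hat s-\check c\hat c .$$ If $M$ is elliptic, then $\mu$ has a mass parameter $m_c<0$, the root of $\cos(\sqrt{|m_c|}\pi)=t$ chosen by zero counting. If $M$ is parabolic, then (with $t=\pm1$) $M$ is conjugate in $SL(2,\mathbb R)$ to $t\begin{pmatrix}1&q\\0&1\end{pmatrix}$ with $q=-t\,\mathrm{sgn}(M_{21})$ if $M_{21}\neq0$, and $q=t\,\mathrm{sgn}(M_{12})$ if $M_{21}=0$. 2. *Negative–negative without boosts* ($\check m,\hat m<-\frac14$, $\check\beta=\hat\beta=0$). Then, with $s=\sqrt{|\check m|}+\sqrt{|\hat m|}$, the matrix $M=\begin{pmatrix}-\cos s\pi&-\sin s\pi\\ \sin s\pi&-\cos s\pi\end{pmatrix}$ is an elliptic monodromy matrix of $\mu$, and $\mu$ has a mass parameter $m_c<0$ with $$\cos(\sqrt{|m_c|}\,\pi)=\tfrac12\operatorname{tr}M=\cos\big((\sqrt{|\check m|}+\sqrt{|\hat m|}+1)\pi\big),$$ the root being the one chosen by zero counting; explicitly $\sqrt{|m_c|}=\sqrt{|\check m|}+\sqrt{|\hat m|}-1$. 3. *Cusp–cusp* ($\check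 m=\hat m=0$). A monodromy matrix of $\mu$ is the hyperbolic matrix $M=\begin{pmatrix}(2\pi)^2\check\kappa\hat\kappa-1&-2\pi\check\kappa\\2\pi\hat\kappa&-1\end{pmatrix}$, and $\mu$ has a mass parameter $m_c>0$ with $\cosh(\sqrt{m_c}\,\pi)=\tfrac12\operatorname{tr}M=2\pi^2\check\kappa\hat\kappa-1$. 4. *Cusp–positive* ($\check m=0$, $\hat m>0$, $\hat\omega>1$). A monodromy matrix of $\mu$ is the hyperbolic matrix $$M=\begin{pmatrix}4\pi\check\kappa\hat\omega\cosh(\sqrt{\hat m}\pi)-e^{\sqrt{\hat m}\pi}&-2\pi\check\kappa e^{-\sqrt{\hat m}\pi}\\2\hat\omega\cosh(\sqrt{\hat m}\pi)&-e^{-\sqrt{\hat m}\pi}\end{pmatrix},$$ and $\mu$ has a mass parameter $m_c>0$ with $\cosh(\sqrt{m_c}\,\pi)=\tfrac12\operatorname{tr}M=\cosh(\sqrt{\hat m}\,\pi)\,(2\pi\check\kappa\hat\omega-1)$. 5. *Cusp–negative* ($\check m=0$, $\hat m<0$). A monodromy matrix of $\mu$ is $$M=\begin{pmatrix}2\pi\check\kappa\hat\kappa\,\hat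 s-\hat c&-\hat\kappa^{-1}(2\pi\check\kappa\hat\kappa\,\hat c+\hat s)\\ \hat\kappa\,\hat s&-\hat c\end{pmatrix},\qquad t:=\tfrac12\operatorname{tr}M=\pi\check\kappa\hat\kappa\,\hat s-\hat c .$$ If $|\operatorname{tr}M|<2$, then $\mu$ has a mass parameter $m_c<0$, the root of $\cos(\sqrt{|m_c|}\pi)=\pi\check\kappa\hat\kappa\sin(\sqrt{|\hat m|}\pi)-\cos(\sqrt{|\hat m|}\pi)$ chosen by zero counting. $M$ is parabolic if and only if $t=\pm1$. If $\hat s=0$, then $M$ is parabolic and conjugate in $SL(2,\mathbb R)$ to $t\begin{pmatrix}1&1\\0&1\end{pmatrix}$; if $\hat s\ne0$ and $M$ is parabolic, then $M$ is conjugate in $SL(2,\mathbb R)$ to $t\begin{pmatrix}1&-1\\0&1\end{pmatrix}$. -/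

import Mathlib

open scoped Real ContDiff Matrix

noncomputable section

/-! ### Metrics near the conformal boundary at infinity

A metric near a conformal boundary `S¹` is written in coordinates `(r, φ)`, `r` large and `φ`
defined modulo `2π`, as the symmetric matrix of its components: index `0` is `dr`, index `1` is
`dφ`.  So `g r φ 0 0`, `g r φ 0 1`, `g r φ 1 1` are the coefficients of `dr²`, `dr dφ`, `dφ²`. -/

/-- A metric on a collar of the conformal boundary, in coordinates `(r, φ)`. -/
abbrev CollarMetric := ℝ → ℝ → Matrix (Fin 2) (Fin 2) ℝ

/-- The Birmingham–Kottler metric `dr² / (r² - m) + r² dφ²` with mass parameter `m`. -/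
def bkMetric (m : ℝ) : CollarMetric := fun r _ =>
  !![1 / (r ^ 2 - m), 0; 0, r ^ 2]

/-- The metric of constant scalar curvature `-2` near the conformal boundary with mass-aspect
function `μ`, in its (terminating) Fefferman–Graham form
`dr² / r² + (r + μ(φ) / (4 r))² dφ²`. -/
def fgMetric (μ : ℝ → ℝ) : CollarMetric := fun r φ =>
  !![1 / r ^ 2, 0; 0, (r + μ φ / (4 * r)) ^ 2]

/-- The hyperbolic plane near (a piece of) its conformal boundary: with `sinh ρ = r - 1 / (4 r)`
this is `dρ² + sinh² ρ dφ²`, i.e. the Birmingham–Kottler metric of mass `-1`. -/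
def hyperbolicMetric : CollarMetric := fgMetric (fun _ => -1)

/-- The change of the radial coordinate `r ↦ r + m / (4 r)` brings the Birmingham–Kottler metric
of mass `m` to the Fefferman–Graham form with constant mass-aspect function `m`. -/
theorem fgMetric_const_eq_pullback_bkMetric (m r φ : ℝ) (hr : 0 < r) (hm : m < 4 * r ^ 2) :
    HasDerivAt (fun s : ℝ => s + m / (4 * s)) (1 - m / (4 * r ^ 2)) r ∧
    fgMetric (fun _ => m) r φ =
      (!![1 - m / (4 * r ^ 2), 0; 0, 1] : Matrix (Fin 2) (Fin 2) ℝ)ᵀ *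
        bkMetric m (r + m / (4 * r)) φ * !![1 - m / (4 * r ^ 2), 0; 0, 1] := by
  constructor
  · have h1 : HasDerivAt (fun s : ℝ => 4 * s) 4 r := by
      simpa using (hasDerivAt_id r).const_mul 4
    have h2 := (hasDerivAt_id r).add ((hasDerivAt_const r m).div h1 (by positivity))
    refine h2.congr_deriv ?_
    field_simp
    ring
  · have h4 : 4 * r ^ 2 - m ≠ 0 := by linarith
    have h5 : (r + m / (4 * r)) ^ 2 - m = ((4 * r ^ 2 - m) / (4 * r)) ^ 2 := by
      field_simp
      ring
    ext i j
    fin_cases i <;> fin_cases j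
    · simp [fgMetric, bkMetric, Matrix.mul_apply, Fin.sum_univ_two, h5]
      field_simp
      exact (div_self (by rwa [mul_comm (r ^ 2) 4])).symm
    all_goals simp [fgMetric, bkMetric, Matrix.mul_apply, Fin.sum_univ_two]

/-- `g` has mass-aspect function `μ`: in the coframe `θ² = dr / r`, `θ¹ = r dφ` one has
`g = θ¹θ¹ + θ²θ² + r⁻² μᵢⱼ θⁱθʲ + O(r⁻³)` and `μ = μ₂₂ + 2 μ₁₁`. -/
def HasMassAspect (g : CollarMetric) (μ : ℝ → ℝ) : Prop :=
  ∃ μ₁₁ μ₁₂ μ₂₂ : ℝ → ℝ, ∀ φ : ℝ,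
    μ φ = μ₂₂ φ + 2 * μ₁₁ φ ∧
    (fun r : ℝ => r ^ 2 * g r φ 0 0 - 1 - μ₂₂ φ / r ^ 2) =O[Filter.atTop] (fun r => 1 / r ^ 3) ∧
    (fun r : ℝ => g r φ 0 1 - μ₁₂ φ / r ^ 2) =O[Filter.atTop] (fun r => 1 / r ^ 3) ∧
    (fun r : ℝ => g r φ 1 1 / r ^ 2 - 1 - μ₁₁ φ / r ^ 2) =O[Filter.atTop] (fun r => 1 / r ^ 3)

/-! ### Asymptotic symmetries -/

/-- `f` is the lift to `ℝ` of an orientation-preserving smooth diffeomorphism of the circle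
`ℝ / 2πℤ`. -/
structure IsCircleDiffeoLift (f : ℝ → ℝ) : Prop where
  smooth : ContDiff ℝ ∞ f
  deriv_pos : ∀ x, 0 < deriv f x
  map_add_two_pi : ∀ x, f (x + 2 * π) = f x + 2 * π

/-- The Schwarzian derivative `f''' / f' - (3/2) (f'' / f')²`. -/
def schwarzian (f : ℝ → ℝ) (x : ℝ) : ℝ :=
  iteratedDeriv 3 f x / deriv f x - 3 / 2 * (iteratedDeriv 2 f x / deriv f x) ^ 2

/-- The mass-aspect function `μ_f = (f')² μ ∘ f - 2 S(f)`, obtained from `μ` by applying the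
asymptotic symmetry determined by the circle diffeomorphism `f`. -/
def transformMassAspect (f μ : ℝ → ℝ) (x : ℝ) : ℝ :=
  (deriv f x) ^ 2 * μ (f x) - 2 * schwarzian f x

/-- The mass-aspect function `μ` can be transformed to the constant `m` by an asymptotic symmetry;
equivalently the metric can be brought to the Birmingham–Kottler form of mass parameter `m` near
the conformal boundary. -/
def CanBeTransformedToConst (μ : ℝ → ℝ) (m : ℝ) : Prop :=
  ∃ f : ℝ → ℝ, IsCircleDiffeoLift f ∧ ∀ x, transformMassAspect f μ x = m

/-- `m` is the mass parameter of `μ`: the one and only constant to which `μ` can be transformed. -/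
def HasMassParameter (μ : ℝ → ℝ) (m : ℝ) : Prop :=
  CanBeTransformedToConst μ m ∧ ∀ m' : ℝ, CanBeTransformedToConst μ m' → m' = m

/-! ### Hill's equation, monodromy, zeros -/

/-- `ψ` solves Hill's equation `ψ'' = (μ / 4) ψ`. -/
def IsHillSolution (μ ψ : ℝ → ℝ) : Prop :=
  ContDiff ℝ 2 ψ ∧ ∀ x, deriv (deriv ψ) x = μ x / 4 * ψ x

/-- `M` is the monodromy matrix of `μ` in some Wronskian-normalised basis of solutions of Hill's
equation. -/
def IsMonodromy (μ : ℝ → ℝ) (M : Matrix (Fin 2) (Fin 2) ℝ) : Prop :=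
  ∃ ψ : Fin 2 → ℝ → ℝ,
    (∀ i, IsHillSolution μ (ψ i)) ∧
    (∀ x, deriv (ψ 0) x * ψ 1 x - deriv (ψ 1) x * ψ 0 x = 1) ∧
    ∀ x, (fun i => ψ i (x + 2 * π)) = M *ᵥ (fun i => ψ i x)

/-- Elliptic: `M = ± 1`, or `|tr M| < 2`. -/
def IsEllipticMatrix (M : Matrix (Fin 2) (Fin 2) ℝ) : Prop :=
  M = 1 ∨ M = -1 ∨ |M.trace| < 2

/-- Parabolic: `|tr M| = 2` and `M ≠ ± 1`. -/
def IsParabolicMatrix (M : Matrix (Fin 2) (Fin 2) ℝ) : Prop :=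
  |M.trace| = 2 ∧ M ≠ 1 ∧ M ≠ -1

/-- Hyperbolic: `|tr M| > 2`. -/
def IsHyperbolicMatrix (M : Matrix (Fin 2) (Fin 2) ℝ) : Prop :=
  2 < |M.trace|

/-- `M` and `N` are conjugate by a matrix of determinant one: `N = A⁻¹ M A`. -/
def IsSLConjugate (M N : Matrix (Fin 2) (Fin 2) ℝ) : Prop :=
  ∃ A : Matrix (Fin 2) (Fin 2) ℝ, A.det = 1 ∧ A⁻¹ * M * A = N

/-- `N` is the number of zeros, on the half-closed interval `[a, a + 2π)`, of every nontrivial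
solution of Hill's equation that vanishes at `a`, for every `a`. -/
def HasZeroNumber (μ : ℝ → ℝ) (N : ℕ) : Prop :=
  ∀ (ψ : ℝ → ℝ) (a : ℝ), IsHillSolution μ ψ → (∃ x, ψ x ≠ 0) → ψ a = 0 →
    {x ∈ Set.Ico a (a + 2 * π) | ψ x = 0}.encard = N

/-- `m < 0` is the solution of `cos (√|m| π) = t` selected by counting zeros: it is the unique one
with `√|m|` in `(N - 1, N]`, where `N` is the number of zeros of the Hill functions of `μ`. -/
def IsRootByZeroCounting (μ : ℝ → ℝ) (t m : ℝ) : Prop :=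
  m < 0 ∧ Real.cos (√|m| * π) = t ∧
  ∃ N : ℕ, HasZeroNumber μ N ∧ √|m| ∈ Set.Ioc ((N : ℝ) - 1) N ∧
    ∀ m' : ℝ, m' < 0 → Real.cos (√|m'| * π) = t → √|m'| ∈ Set.Ioc ((N : ℝ) - 1) N → m' = m

/-! ### Maskit gluing -/

/-- Maskit gluing near the conformal boundary: `gc` is exactly hyperbolic over the half-circle
`[-π/2, π/2]`, `gh` is exactly hyperbolic over the half-circle `[π/2, 3π/2]`; these hyperbolic
halves are cut off along the geodesics `φ = ± π/2` and the remaining halves are identified along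
these geodesics, giving `g`. -/
def IsMaskitGluing (gc gh g : CollarMetric) : Prop :=
  ∃ R : ℝ, 0 < R ∧ ∀ r : ℝ, R < r →
    (∀ φ, g r (φ + 2 * π) = g r φ) ∧
    (∀ φ ∈ Set.Icc (-(π / 2)) (π / 2), gc r φ = hyperbolicMetric r φ) ∧
    (∀ φ ∈ Set.Icc (π / 2) (3 * π / 2), gh r φ = hyperbolicMetric r φ) ∧
    (∀ φ ∈ Set.Icc (-(π / 2)) (π / 2), g r φ = gh r φ) ∧
    (∀ φ ∈ Set.Icc (π / 2) (3 * π / 2), g r φ = gc r φ)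

/-- `g` is obtained by Maskit gluing of two Birmingham–Kottler ends of masses `mc` and `mh`, after
asymptotic symmetries `fc`, `fh` which agree with the prescribed functions `fc₀` on `[-π/2, π/2]`
and `fh₀` on `[π/2, 3π/2]` respectively and which are otherwise arbitrary.  (That the prescribed functions extend to circle diffeomorphisms
restricts the parameters: their images have to be shorter than `2π`.) -/
def IsMaskitGluingOfBK (mc : ℝ) (fc₀ : ℝ → ℝ) (mh : ℝ) (fh₀ : ℝ → ℝ) (g : CollarMetric) : Prop :=
  ∃ fc fh : ℝ → ℝ,
    IsCircleDiffeoLift fc ∧ Set.EqOn fc fc₀ (Set.Icc (-(π / 2)) (π / 2)) ∧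
    IsCircleDiffeoLift fh ∧ Set.EqOn fh fh₀ (Set.Icc (π / 2) (3 * π / 2)) ∧
    IsMaskitGluing (fgMetric (transformMassAspect fc fun _ => mc))
      (fgMetric (transformMassAspect fh fun _ => mh)) g

/-- The boost factor `√((1 + β) / (1 - β))`. -/
def boostFactor (β : ℝ) : ℝ := √((1 + β) / (1 - β))

/-- Boost with parameter `β` bringing a negative mass `m` to `-1` over `[-π/2, π/2]`; for `β = 0`
it is `φ ↦ φ / √|m|`. -/
def negCheckMap (m β φ : ℝ) : ℝ :=
  1 / √|m| * Real.arcsin (√(1 - β ^ 2) * Real.sin φ / (1 + β * Real.cos φ))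

/-- Boost with parameter `β` bringing a negative mass `m` to `-1` over `[π/2, 3π/2]`. -/
def negHatMap (m β φ : ℝ) : ℝ :=
  -(1 / √|m| * Real.arcsin (√(1 - β ^ 2) * Real.sin φ / (1 - β * Real.cos φ)))

/-- Boost with parameter `β` bringing the mass `0` to `-1` over `[-π/2, π/2]`. -/
def cuspCheckMap (β φ : ℝ) : ℝ :=
  Real.tan (1 / 2 * Real.arcsin (√(1 - β ^ 2) * Real.sin φ / (1 + β * Real.cos φ)))

/-- Boost with parameter `β` bringing the mass `0` to `-1` over `[π/2, 3π/2]`. -/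
def cuspHatMap (β φ : ℝ) : ℝ :=
  -Real.tan (1 / 2 * Real.arcsin (√(1 - β ^ 2) * Real.sin φ / (1 - β * Real.cos φ)))

/-- The map with parameter `w` bringing a positive mass `m` to `-1` over `[π/2, 3π/2]`:
`-(1/√m) log (cot (φ/2) + w coth (√m π))`. -/
def posHatMap (m w φ : ℝ) : ℝ :=
  -(1 / √m * Real.log (Real.cot (φ / 2) + w * (Real.cosh (√m * π) / Real.sinh (√m * π))))

/-! ### The monodromy matrices of the glued ends -/

/-- Negative mass `mc` with negative mass `mh`, boost factors `kc`, `kh`. -/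
def negNegMatrix (mc mh kc kh : ℝ) : Matrix (Fin 2) (Fin 2) ℝ :=
  !![kc * kh * (Real.sin (√|mc| * π) * Real.sin (√|mh| * π))
        - Real.cos (√|mc| * π) * Real.cos (√|mh| * π),
      -((kc * kh * (Real.sin (√|mc| * π) * Real.cos (√|mh| * π))
        + Real.cos (√|mc| * π) * Real.sin (√|mh| * π)) / kh);
      Real.sin (√|mc| * π) * Real.cos (√|mh| * π) / kc
        + kh * (Real.cos (√|mc| * π) * Real.sin (√|mh| * π)),
      Real.sin (√|mc| * π) * Real.sin (√|mh| * π) / (kc * kh)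
        - Real.cos (√|mc| * π) * Real.cos (√|mh| * π)]

/-- Cusp with cusp, boost factors `kc`, `kh`. -/
def cuspCuspMatrix (kc kh : ℝ) : Matrix (Fin 2) (Fin 2) ℝ :=
  !![(2 * π) ^ 2 * kc * kh - 1, -(2 * π * kc); 2 * π * kh, -1]

/-- Cusp with positive mass `mh`, boost factor `kc` and parameter `w`. -/
def cuspPosMatrix (mh kc w : ℝ) : Matrix (Fin 2) (Fin 2) ℝ :=
  !![4 * π * kc * w * Real.cosh (√mh * π) - Real.exp (√mh * π),
      -(2 * π * kc * Real.exp (-(√mh * π)));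
      2 * w * Real.cosh (√mh * π),
      -Real.exp (-(√mh * π))]

/-- Cusp with negative mass `mh`, boost factors `kc`, `kh`. -/
def cuspNegMatrix (mh kc kh : ℝ) : Matrix (Fin 2) (Fin 2) ℝ :=
  !![2 * π * kc * kh * Real.sin (√|mh| * π) - Real.cos (√|mh| * π),
      -((2 * π * kc * kh * Real.cos (√|mh| * π) + Real.sin (√|mh| * π)) / kh);
      kh * Real.sin (√|mh| * π),
      -Real.cos (√|mh| * π)]

end

/-! Everything is read off from Hill's equation `ψ'' = (μ/4) ψ`. Its solutions transform as
densities of weight `-1/2`: if `E'' = (m/4) E`, then `E ∘ f / √f'` solves the equation of the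
transformed constant `m` and has the same monodromy. Each end thus has explicit solutions: sines and
cosines for `m < 0`, affine functions for `m = 0`, exponentials for `m > 0`.

Monodromy of the glued metric (`exists_glued_basis`). The prescribed maps are such that, over the
half-circle which is cut off, a suitable basis of each end is `√2 sin (x/2)`, `√2 cos (x/2)`. Both
ends have this basis, so following solutions around the circle composes the two monodromies. The
standard pair changes sign under `x ↦ x + 2π`, which inserts one sign: the result is minus the
product of the check and hat matrices. All displayed matrices are instances of this product.

From monodromy to a constant (`canBeTransformedToConst_of_stabilizer`,
`IsHillBasis.canBeTransformedToConst_of_form`). A quadratic form in a normalised basis gives a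
function `ρ` with `2ρρ'' - ρ'² = μρ² - D`, where `D` is the discriminant. If `ρ` is periodic and
positive, the rescaled primitive of `1/ρ` is a circle diffeomorphism bringing `μ` to a constant with
the sign of `D`. Periodicity means that the form is invariant under the monodromy. For `M` with
entries `a b c d` the form `c u² + (d - a) u v - b v²` is invariant, with discriminant `(tr M)² -
4`. For `|tr M| < 2` the form is definite, so positivity is free; for `M = ±1` the form `u² + v²`
serves instead. For hyperbolic `M` the form is indefinite and its sign along the solutions has to be
established. With a cusp on one side, the form times a positive weight is, on each half-circle, a
convex quadratic in a monotone function, so negativity at the endpoints suffices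
(`HasMonodromyEntries.massParameter_of_cusp`).

Uniqueness. The trace of the monodromy depends only on `μ`; it fixes `cos (√|m| π)` or `cosh (√m
π)`. For `m < 0` the remaining ambiguity is removed by zeros: they are the points where the phase
`√|m| F / 2` has advanced by multiples of `π`, hence `⌈√|m|⌉` of them per period
(`CanBeTransformedToConst.hasZeroNumber`). The parabolic normal forms are pure linear algebra. -/

noncomputable section

/-! ### Solutions of Hill's equation -/

theorem IsHillSolution.hasDerivAt {μ ψ : ℝ → ℝ} (h : IsHillSolution μ ψ) (x : ℝ) :
    HasDerivAt ψ (deriv ψ x) x :=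
  (h.1.differentiable (by norm_num)).differentiableAt.hasDerivAt

theorem IsHillSolution.differentiable_deriv {μ ψ : ℝ → ℝ} (h : IsHillSolution μ ψ) :
    Differentiable ℝ (deriv ψ) := by
  have h1 : ContDiff ℝ (1 + 1) ψ := by
    have := h.1
    norm_num at this ⊢
    exact this
  exact (contDiff_succ_iff_deriv.1 h1).2.2.differentiable (by norm_num)

theorem IsHillSolution.hasDerivAt_deriv {μ ψ : ℝ → ℝ} (h : IsHillSolution μ ψ) (x : ℝ) :
    HasDerivAt (deriv ψ) (μ x / 4 * ψ x) x := by
  rw [← h.2 x]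
  exact h.differentiable_deriv.differentiableAt.hasDerivAt

theorem isHillSolution_of_hasDerivAt {μ ψ ψ' : ℝ → ℝ} (hμ : Continuous μ)
    (h : ∀ x, HasDerivAt ψ (ψ' x) x) (h' : ∀ x, HasDerivAt ψ' (μ x / 4 * ψ x) x) :
    IsHillSolution μ ψ := by
  have e : deriv ψ = ψ' := funext fun x => (h x).deriv
  have e' : deriv ψ' = fun x => μ x / 4 * ψ x := funext fun x => (h' x).deriv
  have hc : Continuous ψ := continuous_iff_continuousAt.2 fun x => (h x).continuousAt
  refine ⟨?_, fun x => by rw [e, e']⟩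
  rw [show (2 : WithTop ℕ∞) = 1 + 1 by norm_num, contDiff_succ_iff_deriv]
  refine ⟨fun x => (h x).differentiableAt, by simp, ?_⟩
  rw [e, contDiff_one_iff_deriv, e']
  exact ⟨fun x => (h' x).differentiableAt, by fun_prop⟩

/-- Bootstrap: the equation gives `ψ''` the regularity of `μ ψ`. Carrying `ψ` and `ψ'` together
makes the induction gain one derivative at a time. -/
theorem IsHillSolution.contDiff_top {μ ψ : ℝ → ℝ} (hμ : ContDiff ℝ ∞ μ)
    (h : IsHillSolution μ ψ) : ContDiff ℝ ∞ ψ := by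
  have key : ∀ n : ℕ, ContDiff ℝ n ψ ∧ ContDiff ℝ n (deriv ψ) := by
    intro n
    induction n with
    | zero =>
      exact ⟨contDiff_zero.2 h.1.continuous, contDiff_zero.2 h.differentiable_deriv.continuous⟩
    | succ n ih =>
      have hn : ContDiff ℝ n μ := hμ.of_le (by exact_mod_cast le_top)
      push_cast
      rw [contDiff_succ_iff_deriv, contDiff_succ_iff_deriv]
      refine ⟨⟨fun x => (h.hasDerivAt x).differentiableAt, by simp, ih.2⟩,
        h.differentiable_deriv, by simp, ?_⟩
      rw [show deriv (deriv ψ) = fun x => μ x / 4 * ψ x from funext h.2]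
      exact (hn.div_const 4).mul ih.1
  exact contDiff_infty.2 fun n => (key n).1

theorem IsHillSolution.linear_comb {μ u v : ℝ → ℝ} (hu : IsHillSolution μ u)
    (hv : IsHillSolution μ v) (a b : ℝ) : IsHillSolution μ (fun x => a * u x + b * v x) := by
  have h1 : deriv (fun x => a * u x + b * v x) = fun x => a * deriv u x + b * deriv v x :=
    funext fun x => (((hu.hasDerivAt x).const_mul a).add ((hv.hasDerivAt x).const_mul b)).deriv
  refine ⟨(contDiff_const.mul hu.1).add (contDiff_const.mul hv.1), fun x => ?_⟩
  rw [h1]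
  refine (((hu.hasDerivAt_deriv x).const_mul a).add
    ((hv.hasDerivAt_deriv x).const_mul b)).deriv.trans ?_
  ring

/-- A basis of solutions of Hill's equation, with the Wronskian normalised to one. -/
structure IsHillBasis (μ u v : ℝ → ℝ) : Prop where
  left : IsHillSolution μ u
  right : IsHillSolution μ v
  wronskian : ∀ x, deriv u x * v x - deriv v x * u x = 1

theorem IsHillSolution.wronskian_const {μ u v : ℝ → ℝ} (hu : IsHillSolution μ u)
    (hv : IsHillSolution μ v) (x y : ℝ) :
    deriv u x * v x - deriv v x * u x = deriv u y * v y - deriv v y * u y := by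
  have hd : ∀ x, HasDerivAt (fun x => deriv u x * v x - deriv v x * u x) 0 x := fun x =>
    (((hu.hasDerivAt_deriv x).mul (hv.hasDerivAt x)).sub
      ((hv.hasDerivAt_deriv x).mul (hu.hasDerivAt x))).congr_deriv (by ring)
  exact is_const_of_deriv_eq_zero (fun x => (hd x).differentiableAt) (fun x => (hd x).deriv) x y

/-- Cramer's rule: the coefficients are the Wronskians of `φ` with `v` and `u`, which are constant,
so evaluating them at `0` or at `x` is the same. -/
theorem IsHillBasis.exists_eq_comb {μ u v φ : ℝ → ℝ} (h : IsHillBasis μ u v)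
    (hφ : IsHillSolution μ φ) : ∃ a b : ℝ, ∀ x, φ x = a * u x + b * v x := by
  refine ⟨deriv φ 0 * v 0 - deriv v 0 * φ 0, -(deriv φ 0 * u 0 - deriv u 0 * φ 0), fun x => ?_⟩
  rw [hφ.wronskian_const h.right 0 x, hφ.wronskian_const h.left 0 x]
  linear_combination -φ x * h.wronskian x

theorem IsHillBasis.eq_zero_of_comb {μ u v : ℝ → ℝ} (h : IsHillBasis μ u v) {a b : ℝ}
    (h0 : ∀ x, a * u x + b * v x = 0) : a = 0 ∧ b = 0 := by
  have hd : ∀ x, a * deriv u x + b * deriv v x = 0 := fun x => by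
    have h1 := ((h.left.hasDerivAt x).const_mul a).add ((h.right.hasDerivAt x).const_mul b)
    have h2 : HasDerivAt (fun x => a * u x + b * v x) 0 x := by
      rw [show (fun x => a * u x + b * v x) = fun _ => 0 from funext h0]
      exact hasDerivAt_const x 0
    exact h1.unique h2
  constructor
  · linear_combination -a * h.wronskian 0 - deriv v 0 * h0 0 + v 0 * hd 0
  · linear_combination -b * h.wronskian 0 + deriv u 0 * h0 0 - u 0 * hd 0

/-- The monodromy of the basis `u, v` is given by the entries `a b c d`. -/
def HasMonodromyEntries (u v : ℝ → ℝ) (a b c d : ℝ) : Prop :=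
  ∀ x, u (x + 2 * π) = a * u x + b * v x ∧ v (x + 2 * π) = c * u x + d * v x

theorem IsMonodromy.exists_basis {μ : ℝ → ℝ} {M : Matrix (Fin 2) (Fin 2) ℝ}
    (h : IsMonodromy μ M) : ∃ u v, IsHillBasis μ u v ∧
      HasMonodromyEntries u v (M 0 0) (M 0 1) (M 1 0) (M 1 1) := by
  obtain ⟨ψ, hψ, hW, hM⟩ := h
  refine ⟨ψ 0, ψ 1, ⟨hψ 0, hψ 1, hW⟩, fun x => ?_⟩
  have h0 := congrFun (hM x) 0
  have h1 := congrFun (hM x) 1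
  simp only [Matrix.mulVec, dotProduct, Fin.sum_univ_two] at h0 h1
  exact ⟨h0, h1⟩

theorem IsHillBasis.isMonodromy {μ u v : ℝ → ℝ} (h : IsHillBasis μ u v) {a b c d : ℝ}
    (hM : HasMonodromyEntries u v a b c d) : IsMonodromy μ !![a, b; c, d] := by
  refine ⟨![u, v], ?_, h.wronskian, fun x => ?_⟩
  · intro i
    fin_cases i
    · exact h.left
    · exact h.right
  · ext i
    fin_cases i <;> simp [Matrix.mulVec, dotProduct, Fin.sum_univ_two, (hM x).1, (hM x).2]

theorem HasMonodromyEntries.derivs {μ u v : ℝ → ℝ} {a b c d : ℝ} (h : IsHillBasis μ u v)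
    (hM : HasMonodromyEntries u v a b c d) :
    HasMonodromyEntries (deriv u) (deriv v) a b c d := by
  intro x
  have key : ∀ (w : ℝ → ℝ) (p q : ℝ), (∀ y, w (y + 2 * π) = p * u y + q * v y) →
      deriv w (x + 2 * π) = p * deriv u x + q * deriv v x := by
    intro w p q hw
    have h1 : deriv (fun y => w (y + 2 * π)) x = deriv w (x + 2 * π) :=
      deriv_comp_add_const _ _ _
    rw [← h1, funext hw]
    exact (((h.left.hasDerivAt x).const_mul p).add ((h.right.hasDerivAt x).const_mul q)).deriv
  exact ⟨key u a b fun y => (hM y).1, key v c d fun y => (hM y).2⟩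

theorem HasMonodromyEntries.det_eq_one {μ u v : ℝ → ℝ} {a b c d : ℝ} (h : IsHillBasis μ u v)
    (hM : HasMonodromyEntries u v a b c d) : a * d - b * c = 1 := by
  have h1 := h.wronskian (0 + 2 * π)
  rw [(hM 0).1, (hM 0).2, (hM.derivs h 0).1, (hM.derivs h 0).2] at h1
  linear_combination h1 - (a * d - b * c) * h.wronskian 0

/-- Two normalised bases differ by a matrix `S` of determinant one. The relations `k1`, `k2` are the
entries of `S M = M' S`, so the monodromies are conjugate. -/
theorem HasMonodromyEntries.trace_eq {μ u v u' v' : ℝ → ℝ} {a b c d a' b' c' d' : ℝ}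
    (h : IsHillBasis μ u v) (h' : IsHillBasis μ u' v')
    (hM : HasMonodromyEntries u v a b c d) (hM' : HasMonodromyEntries u' v' a' b' c' d') :
    a + d = a' + d' := by
  obtain ⟨p, q, hu⟩ := h.exists_eq_comb h'.left
  obtain ⟨r, s, hv⟩ := h.exists_eq_comb h'.right
  have hdet : p * s - q * r = 1 := by
    have e1 : deriv u' 0 = p * deriv u 0 + q * deriv v 0 := by
      rw [funext hu]
      exact (((h.left.hasDerivAt 0).const_mul p).add ((h.right.hasDerivAt 0).const_mul q)).deriv
    have e2 : deriv v' 0 = r * deriv u 0 + s * deriv v 0 := by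
      rw [funext hv]
      exact (((h.left.hasDerivAt 0).const_mul r).add ((h.right.hasDerivAt 0).const_mul s)).deriv
    have h1 := h'.wronskian 0
    rw [hu, hv, e1, e2] at h1
    linear_combination h1 - (p * s - q * r) * h.wronskian 0
  have k1 := h.eq_zero_of_comb (a := p * a + q * c - (a' * p + b' * r))
    (b := p * b + q * d - (a' * q + b' * s)) fun x => by
      have := (hM' x).1
      rw [hu, hu, hv, (hM x).1, (hM x).2] at this
      linear_combination this
  have k2 := h.eq_zero_of_comb (a := r * a + s * c - (c' * p + d' * r))
    (b := r * b + s * d - (c' * q + d' * s)) fun x => by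
      have := (hM' x).2
      rw [hu, hv, hv, (hM x).1, (hM x).2] at this
      linear_combination this
  linear_combination (-(a + d) + a' + d') * hdet + s * k1.1 - r * k1.2 - q * k2.1 + p * k2.2

/-! ### Circle diffeomorphisms acting on mass-aspect functions -/

theorem IsCircleDiffeoLift.hasDerivAt {f : ℝ → ℝ} (hf : IsCircleDiffeoLift f) (x : ℝ) :
    HasDerivAt f (deriv f x) x :=
  (hf.smooth.differentiable (by simp)).differentiableAt.hasDerivAt

theorem IsCircleDiffeoLift.strictMono {f : ℝ → ℝ} (hf : IsCircleDiffeoLift f) : StrictMono f :=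
  strictMono_of_deriv_pos hf.deriv_pos

theorem IsCircleDiffeoLift.contDiff_deriv {f : ℝ → ℝ} (hf : IsCircleDiffeoLift f) :
    ContDiff ℝ ∞ (deriv f) :=
  (contDiff_infty_iff_deriv.1 hf.smooth).2

theorem IsCircleDiffeoLift.deriv_add_two_pi {f : ℝ → ℝ} (hf : IsCircleDiffeoLift f) (x : ℝ) :
    deriv f (x + 2 * π) = deriv f x := by
  rw [← deriv_comp_add_const, funext hf.map_add_two_pi, deriv_add_const]

theorem IsCircleDiffeoLift.transform_add_two_pi {f μ : ℝ → ℝ} (hf : IsCircleDiffeoLift f)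
    (hμ : ∀ x, μ (x + 2 * π) = μ x) (x : ℝ) :
    transformMassAspect f μ (x + 2 * π) = transformMassAspect f μ x := by
  have h1 : ∀ n : ℕ, iteratedDeriv (n + 1) f (x + 2 * π) = iteratedDeriv (n + 1) f x := by
    intro n
    rw [iteratedDeriv_succ', ← congrFun (iteratedDeriv_comp_add_const n (deriv f) (2 * π)) x,
      funext hf.deriv_add_two_pi]
  simp only [transformMassAspect, schwarzian, hf.deriv_add_two_pi, hf.map_add_two_pi, hμ, h1]

theorem IsCircleDiffeoLift.contDiff_schwarzian {f : ℝ → ℝ} (hf : IsCircleDiffeoLift f) :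
    ContDiff ℝ ∞ (schwarzian f) := by
  have h0 : ∀ x, deriv f x ≠ 0 := fun x => (hf.deriv_pos x).ne'
  have h1 := hf.contDiff_deriv
  have h2 := (contDiff_infty_iff_deriv.1 h1).2
  have h3 := (contDiff_infty_iff_deriv.1 h2).2
  have e2 : iteratedDeriv 2 f = deriv (deriv f) := by simp [iteratedDeriv_succ]
  have e3 : iteratedDeriv 3 f = deriv (deriv (deriv f)) := by simp [iteratedDeriv_succ]
  unfold schwarzian
  rw [e2, e3]
  exact (h3.div h1 h0).sub (contDiff_const.mul ((h2.div h1 h0).pow 2))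

theorem IsCircleDiffeoLift.contDiff_transform {f : ℝ → ℝ} (hf : IsCircleDiffeoLift f) (m : ℝ) :
    ContDiff ℝ ∞ (transformMassAspect f fun _ => m) := by
  unfold transformMassAspect
  exact ((hf.contDiff_deriv.pow 2).mul contDiff_const).sub
    (contDiff_const.mul hf.contDiff_schwarzian)

theorem schwarzian_eq_of_hasDerivAt {f f₁ f₂ f₃ : ℝ → ℝ} (h1 : ∀ x, HasDerivAt f (f₁ x) x)
    (h2 : ∀ x, HasDerivAt f₁ (f₂ x) x) (h3 : ∀ x, HasDerivAt f₂ (f₃ x) x) (x : ℝ) :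
    schwarzian f x = f₃ x / f₁ x - 3 / 2 * (f₂ x / f₁ x) ^ 2 := by
  have e1 : deriv f = f₁ := funext fun x => (h1 x).deriv
  have e2 : deriv f₁ = f₂ := funext fun x => (h2 x).deriv
  have e3 : deriv f₂ = f₃ := funext fun x => (h3 x).deriv
  simp [schwarzian, iteratedDeriv_succ, e1, e2, e3]

theorem IsCircleDiffeoLift.exists_derivs {f : ℝ → ℝ} (hf : IsCircleDiffeoLift f) :
    ∃ f₂ f₃ : ℝ → ℝ, (∀ x, HasDerivAt (deriv f) (f₂ x) x) ∧ (∀ x, HasDerivAt f₂ (f₃ x) x) := by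
  have h1 := hf.contDiff_deriv
  have h2 := (contDiff_infty_iff_deriv.1 h1).2
  exact ⟨deriv (deriv f), deriv (deriv (deriv f)),
    fun x => (h1.differentiable (by simp)).differentiableAt.hasDerivAt,
    fun x => (h2.differentiable (by simp)).differentiableAt.hasDerivAt⟩

/-- An asymptotic symmetry transports the solutions of Hill's equation as densities of weight
`-1/2`. -/
theorem IsCircleDiffeoLift.isHillSolution_transform {f E E' : ℝ → ℝ} {m : ℝ}
    (hf : IsCircleDiffeoLift f) (hE : ∀ x, HasDerivAt E (E' x) x)
    (hE' : ∀ x, HasDerivAt E' (m / 4 * E x) x) :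
    IsHillSolution (transformMassAspect f fun _ => m) (fun x => E (f x) / √(deriv f x)) ∧
    ∀ x, deriv (fun x => E (f x) / √(deriv f x)) x =
      E' (f x) * √(deriv f x) - E (f x) * deriv (fun x => √(deriv f x)) x / deriv f x := by
  -- Working with `q = √f'` and `f' = q²` makes the Schwarzian and both derivatives rational in `q,
  -- q', q''`.
  set q : ℝ → ℝ := fun x => √(deriv f x) with hq
  have hqpos : ∀ x, 0 < q x := fun x => Real.sqrt_pos.2 (hf.deriv_pos x)
  have hqq : ∀ x, deriv f x = q x ^ 2 := fun x => (Real.sq_sqrt (hf.deriv_pos x).le).symm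
  have hqs : ContDiff ℝ ∞ q := hf.contDiff_deriv.sqrt fun x => (hf.deriv_pos x).ne'
  have hqs' := (contDiff_infty_iff_deriv.1 hqs).2
  have d0 : ∀ x, HasDerivAt f (q x ^ 2) x := fun x => by rw [← hqq]; exact hf.hasDerivAt x
  have d1 : ∀ x, HasDerivAt q (deriv q x) x := fun x =>
    (hqs.differentiable (by simp)).differentiableAt.hasDerivAt
  have d2 : ∀ x, HasDerivAt (deriv q) (deriv (deriv q) x) x := fun x =>
    (hqs'.differentiable (by simp)).differentiableAt.hasDerivAt
  have s1 : ∀ x, HasDerivAt (fun x => q x ^ 2) (2 * q x * deriv q x) x := fun x =>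
    ((d1 x).pow 2).congr_deriv (by norm_num)
  have s2 : ∀ x, HasDerivAt (fun x => 2 * q x * deriv q x)
      (2 * deriv q x * deriv q x + 2 * q x * deriv (deriv q) x) x := fun x =>
    ((d1 x).const_mul 2).mul (d2 x)
  have hS := schwarzian_eq_of_hasDerivAt d0 s1 s2
  have g1 : ∀ x, HasDerivAt (fun x => E (f x) / q x)
      (E' (f x) * q x - E (f x) * deriv q x / q x ^ 2) x := fun x => by
    refine (((hE (f x)).comp x (d0 x)).div (d1 x) (hqpos x).ne').congr_deriv ?_
    have := (hqpos x).ne'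
    simp only [Function.comp]
    field_simp
  have g2 : ∀ x, HasDerivAt (fun x => E' (f x) * q x - E (f x) * deriv q x / q x ^ 2)
      (transformMassAspect f (fun _ => m) x / 4 * (E (f x) / q x)) x := fun x => by
    have hne := (hqpos x).ne'
    have := ((((hE' (f x)).comp x (d0 x)).mul (d1 x)).sub
      ((((hE (f x)).comp x (d0 x)).mul (d2 x)).div ((d1 x).pow 2) (pow_ne_zero 2 hne)))
    refine this.congr_deriv ?_
    simp only [transformMassAspect, hS, hqq, Function.comp, Pi.mul_apply, Pi.pow_apply]
    field_simp
    ring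
  refine ⟨isHillSolution_of_hasDerivAt (hf.contDiff_transform m).continuous g1 g2, fun x => ?_⟩
  rw [(g1 x).deriv, ← hqq x]

theorem IsCircleDiffeoLift.isHillBasis_transform {f E₀ E₀' E₁ E₁' : ℝ → ℝ} {m : ℝ}
    (hf : IsCircleDiffeoLift f) (h0 : ∀ x, HasDerivAt E₀ (E₀' x) x)
    (h0' : ∀ x, HasDerivAt E₀' (m / 4 * E₀ x) x) (h1 : ∀ x, HasDerivAt E₁ (E₁' x) x)
    (h1' : ∀ x, HasDerivAt E₁' (m / 4 * E₁ x) x) (hW : ∀ x, E₀' x * E₁ x - E₁' x * E₀ x = 1) :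
    IsHillBasis (transformMassAspect f fun _ => m) (fun x => E₀ (f x) / √(deriv f x))
      (fun x => E₁ (f x) / √(deriv f x)) := by
  obtain ⟨a, a'⟩ := hf.isHillSolution_transform h0 h0'
  obtain ⟨b, b'⟩ := hf.isHillSolution_transform h1 h1'
  refine ⟨a, b, fun x => ?_⟩
  have hne : √(deriv f x) ≠ 0 := (Real.sqrt_pos.2 (hf.deriv_pos x)).ne'
  rw [a', b']
  field_simp
  linear_combination √(deriv f x) * hW (f x)

theorem IsCircleDiffeoLift.hasMonodromyEntries_transform {f E₀ E₁ : ℝ → ℝ} {a b c d : ℝ}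
    (hf : IsCircleDiffeoLift f) (hE : HasMonodromyEntries E₀ E₁ a b c d) :
    HasMonodromyEntries (fun x => E₀ (f x) / √(deriv f x))
      (fun x => E₁ (f x) / √(deriv f x)) a b c d := by
  intro x
  simp only [hf.map_add_two_pi, hf.deriv_add_two_pi, (hE (f x)).1, (hE (f x)).2]
  constructor <;> ring

/-- The inverse of a circle diffeomorphism. -/
theorem IsCircleDiffeoLift.exists_inverse {f : ℝ → ℝ} (hf : IsCircleDiffeoLift f) :
    ∃ F : ℝ → ℝ, IsCircleDiffeoLift F ∧ (∀ x, F (f x) = x) ∧ ∀ x, f (F x) = x := by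
  -- The values at `± 2πn` go to `± ∞` by quasi-periodicity; intermediate values do the rest.
  have hsurj : Function.Surjective f := by
    have hn : ∀ n : ℕ, f (n * (2 * π)) = f 0 + n * (2 * π) ∧
        f (-(n * (2 * π))) = f 0 - n * (2 * π) := by
      intro n
      induction n with
      | zero => simp
      | succ n ih =>
        have h1 := hf.map_add_two_pi (n * (2 * π))
        have h2 := hf.map_add_two_pi (-((n + 1) * (2 * π)))
        rw [show -(((n : ℝ) + 1) * (2 * π)) + 2 * π = -(n * (2 * π)) by ring, ih.2] at h2
        rw [ih.1] at h1
        push_cast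
        refine ⟨?_, by linarith⟩
        rw [show ((n : ℝ) + 1) * (2 * π) = n * (2 * π) + 2 * π by ring, h1]
        ring
    intro y
    obtain ⟨n, hny⟩ := exists_nat_ge (|y - f 0| / (2 * π))
    rw [div_le_iff₀ Real.two_pi_pos, abs_le] at hny
    have hmem : y ∈ Set.Icc (f (-(n * (2 * π)))) (f (n * (2 * π))) := by
      rw [(hn n).1, (hn n).2]
      constructor <;> linarith [hny.1, hny.2]
    have hle : -(n * (2 * π)) ≤ n * (2 * π) := by
      have : 0 ≤ (n : ℝ) * (2 * π) := by positivity
      linarith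
    obtain ⟨x, -, hx⟩ := intermediate_value_Icc hle hf.smooth.continuous.continuousOn hmem
    exact ⟨x, hx⟩
  set e := (hf.strictMono.orderIsoOfSurjective f hsurj).toHomeomorph with he
  have hfe : ∀ x, e x = f x := fun x => rfl
  have h1 : ∀ x, e.symm (f x) = x := fun x => e.symm_apply_apply x
  have h2 : ∀ x, f (e.symm x) = x := fun x => e.apply_symm_apply x
  have hsm : ContDiff ℝ ∞ e.symm :=
    e.contDiff_symm_deriv (fun x => (hf.deriv_pos x).ne') hf.hasDerivAt hf.smooth
  refine ⟨e.symm, ⟨hsm, fun x => ?_, fun x => ?_⟩, h1, h2⟩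
  · have hd : HasDerivAt e.symm (deriv e.symm x) x :=
      (hsm.differentiable (by simp)).differentiableAt.hasDerivAt
    have h3 := (hf.hasDerivAt (e.symm x)).comp x hd
    rw [show f ∘ e.symm = id from funext h2] at h3
    have h4 := h3.unique (hasDerivAt_id x)
    have h5 := hf.deriv_pos (e.symm x)
    by_contra! hle
    nlinarith
  · apply hf.strictMono.injective
    rw [h2, hf.map_add_two_pi, h2]

/-- Differentiating `f ∘ F = id` three times expresses the first three derivatives of `f` at `F x`
through those of `F`; the cocycle rule of the Schwarzian then becomes a rational identity. -/
theorem transform_inverse {f F μ : ℝ → ℝ} (hf : IsCircleDiffeoLift f)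
    (hF : IsCircleDiffeoLift F) (h : ∀ x, f (F x) = x) (x : ℝ) :
    transformMassAspect F (transformMassAspect f μ) x = μ x := by
  obtain ⟨f₂, f₃, a1, a2⟩ := hf.exists_derivs
  obtain ⟨F₂, F₃, b1, b2⟩ := hF.exists_derivs
  have c1 : ∀ x, deriv f (F x) * deriv F x = 1 := fun x => by
    have h3 := (hf.hasDerivAt (F x)).comp x (hF.hasDerivAt x)
    rw [show f ∘ F = id from funext h] at h3
    exact h3.unique (hasDerivAt_id x)
  have c2 : ∀ x, f₂ (F x) * deriv F x * deriv F x + deriv f (F x) * F₂ x = 0 := fun x => by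
    have h3 := ((a1 (F x)).comp x (hF.hasDerivAt x)).mul (b1 x)
    rw [show (deriv f ∘ F) * deriv F = fun _ => 1 from funext c1] at h3
    exact h3.unique (hasDerivAt_const x 1)
  have c3 : ∀ x, ((f₃ (F x) * deriv F x * deriv F x + f₂ (F x) * F₂ x) * deriv F x +
      f₂ (F x) * deriv F x * F₂ x) + (f₂ (F x) * deriv F x * F₂ x + deriv f (F x) * F₃ x) = 0 := by
    intro x
    have h3 := ((((a2 (F x)).comp x (hF.hasDerivAt x)).mul (b1 x)).mul (b1 x)).add
      (((a1 (F x)).comp x (hF.hasDerivAt x)).mul (b2 x))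
    rw [show ((f₂ ∘ F) * deriv F * deriv F + (deriv f ∘ F) * F₂) = fun _ => 0 from funext c2] at h3
    exact h3.unique (hasDerivAt_const x 0)
  have hp := (hF.deriv_pos x).ne'
  have e1 := c1 x
  have e2 := c2 x
  have e3 := c3 x
  simp only [transformMassAspect, schwarzian_eq_of_hasDerivAt hf.hasDerivAt a1 a2,
    schwarzian_eq_of_hasDerivAt hF.hasDerivAt b1 b2, h]
  set p := deriv F x with hp'
  set p₂ := F₂ x
  set p₃ := F₃ x
  have w1 : deriv f (F x) = 1 / p := by field_simp; linarith
  rw [w1] at e2 e3 ⊢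
  have w2 : f₂ (F x) = -p₂ / p ^ 3 := by
    field_simp at e2 ⊢
    linarith
  rw [w2] at e3 ⊢
  have w3 : f₃ (F x) = 3 * p₂ ^ 2 / p ^ 5 - p₃ / p ^ 4 := by
    field_simp at e3 ⊢
    linarith
  rw [w3]
  field_simp
  ring

theorem canBeTransformedToConst_iff {μ : ℝ → ℝ} {m : ℝ} :
    CanBeTransformedToConst μ m ↔
      ∃ F : ℝ → ℝ, IsCircleDiffeoLift F ∧ ∀ x, transformMassAspect F (fun _ => m) x = μ x := by
  constructor
  · rintro ⟨f, hf, hm⟩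
    obtain ⟨F, hF, -, h⟩ := hf.exists_inverse
    refine ⟨F, hF, fun x => ?_⟩
    rw [← funext hm]
    exact transform_inverse hf hF h x
  · rintro ⟨F, hF, hm⟩
    obtain ⟨f, hf, -, h⟩ := hF.exists_inverse
    refine ⟨f, hf, fun x => ?_⟩
    rw [← funext hm]
    exact transform_inverse hF hf h x

/-! ### Constant representatives from invariant quadratic forms -/

/-- A positive periodic `ρ` with `2 ρ ρ'' - ρ'² = μ ρ² - D` (that is, a nonvanishing periodic vector
field stabilising `μ`) brings `μ` to a constant. -/
theorem canBeTransformedToConst_of_stabilizer {μ ρ ρ₁ ρ₂ : ℝ → ℝ} {D : ℝ}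
    (hs : ContDiff ℝ ∞ ρ) (hpos : ∀ x, 0 < ρ x) (hper : ∀ x, ρ (x + 2 * π) = ρ x)
    (h1 : ∀ x, HasDerivAt ρ (ρ₁ x) x) (h2 : ∀ x, HasDerivAt ρ₁ (ρ₂ x) x)
    (hD : ∀ x, 2 * ρ x * ρ₂ x - ρ₁ x ^ 2 = μ x * ρ x ^ 2 - D) (y : ℝ) :
    0 < (∫ x in y..(y + 2 * π), 1 / ρ x) ∧
    CanBeTransformedToConst μ (D * ((∫ x in y..(y + 2 * π), 1 / ρ x) / (2 * π)) ^ 2) := by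
  have hne : ∀ x, ρ x ≠ 0 := fun x => (hpos x).ne'
  have hc : Continuous fun x => 1 / ρ x := continuous_const.div hs.continuous hne
  set I := ∫ x in y..(y + 2 * π), 1 / ρ x with hI
  have hIpos : 0 < I := intervalIntegral.intervalIntegral_pos_of_pos
    (hc.intervalIntegrable _ _) (fun x => by have := hpos x; positivity)
    (by linarith [Real.two_pi_pos])
  have hpi := Real.pi_pos
  -- This factor makes the primitive of `1/ρ` grow by exactly `2π` over a period.
  set c := 2 * π / I with hcdef
  have hcpos : 0 < c := by positivity
  set F : ℝ → ℝ := fun x => c * ∫ t in y..x, 1 / ρ t with hF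
  have d1 : ∀ x, HasDerivAt F (c / ρ x) x := fun x =>
    ((intervalIntegral.integral_hasDerivAt_right (hc.intervalIntegrable _ _)
      hc.stronglyMeasurable.stronglyMeasurableAtFilter hc.continuousAt).const_mul c).congr_deriv
      (by ring)
  have d2 : ∀ x, HasDerivAt (fun x => c / ρ x) (-c * ρ₁ x / ρ x ^ 2) x := fun x =>
    ((hasDerivAt_const x c).div (h1 x) (hne x)).congr_deriv (by ring)
  have d3 : ∀ x, HasDerivAt (fun x => -c * ρ₁ x / ρ x ^ 2)
      (-c * ρ₂ x / ρ x ^ 2 + 2 * c * ρ₁ x ^ 2 / ρ x ^ 3) x := fun x => by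
    refine (((h2 x).const_mul (-c)).div ((h1 x).pow 2) (pow_ne_zero 2 (hne x))).congr_deriv ?_
    have := hne x
    simp only [Pi.pow_apply]
    field_simp
    push_cast
    ring
  have hderiv : deriv F = fun x => c / ρ x := funext fun x => (d1 x).deriv
  have hlift : IsCircleDiffeoLift F := by
    refine ⟨?_, fun x => ?_, fun x => ?_⟩
    · rw [contDiff_infty_iff_deriv, hderiv]
      exact ⟨fun x => (d1 x).differentiableAt, contDiff_const.div hs hne⟩
    · rw [hderiv]
      exact div_pos hcpos (hpos x)
    · have hp : Function.Periodic (fun x => 1 / ρ x) (2 * π) := fun x => by simp [hper]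
      have h3 := hp.intervalIntegral_add_eq x y
      have h4 := intervalIntegral.integral_add_adjacent_intervals
        (hc.intervalIntegrable (μ := MeasureTheory.volume) y x)
        (hc.intervalIntegrable x (x + 2 * π))
      simp only [hF]
      rw [← h4, h3, mul_add, ← hI, hcdef, div_mul_cancel₀ _ hIpos.ne']
  refine ⟨hIpos, canBeTransformedToConst_iff.2 ⟨F, hlift, fun x => ?_⟩⟩
  have hx := hne x
  simp only [transformMassAspect, schwarzian_eq_of_hasDerivAt d1 d2 d3, hderiv]
  rw [show I / (2 * π) = 1 / c by rw [hcdef]; field_simp]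
  have e : ρ₂ x = (μ x * ρ x ^ 2 - D + ρ₁ x ^ 2) / (2 * ρ x) := by
    field_simp
    linarith [hD x]
  rw [e]
  field_simp
  ring

/-- Products of two Hill solutions span the solutions of the stabiliser equation. For the form with
coefficients `p q r`, the constant `D` is its discriminant times the squared Wronskian, which is
one. -/
theorem IsHillBasis.canBeTransformedToConst_of_form {μ u v : ℝ → ℝ} (hμ : ContDiff ℝ ∞ μ)
    (h : IsHillBasis μ u v) {p q r : ℝ}
    (hpos : ∀ x, 0 < p * u x ^ 2 + q * (u x * v x) + r * v x ^ 2)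
    (hper : ∀ x, p * u (x + 2 * π) ^ 2 + q * (u (x + 2 * π) * v (x + 2 * π)) +
      r * v (x + 2 * π) ^ 2 = p * u x ^ 2 + q * (u x * v x) + r * v x ^ 2) (y : ℝ) :
    0 < (∫ x in y..(y + 2 * π), 1 / (p * u x ^ 2 + q * (u x * v x) + r * v x ^ 2)) ∧
    CanBeTransformedToConst μ ((q ^ 2 - 4 * p * r) *
      ((∫ x in y..(y + 2 * π), 1 / (p * u x ^ 2 + q * (u x * v x) + r * v x ^ 2)) /
        (2 * π)) ^ 2) := by
  have hus := h.left.contDiff_top hμ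
  have hvs := h.right.contDiff_top hμ
  have u1 := h.left.hasDerivAt
  have v1 := h.right.hasDerivAt
  have u2 := h.left.hasDerivAt_deriv
  have v2 := h.right.hasDerivAt_deriv
  refine canBeTransformedToConst_of_stabilizer
    (ρ₁ := fun x => 2 * p * (u x * deriv u x) + q * (deriv u x * v x + u x * deriv v x) +
      2 * r * (v x * deriv v x))
    (ρ₂ := fun x => 2 * p * (deriv u x * deriv u x + u x * (μ x / 4 * u x)) +
      q * (μ x / 4 * u x * v x + deriv u x * deriv v x +
        (deriv u x * deriv v x + u x * (μ x / 4 * v x))) +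
      2 * r * (deriv v x * deriv v x + v x * (μ x / 4 * v x)))
    ?_ hpos hper (fun x => ?_) (fun x => ?_) (fun x => ?_) y
  · exact ((contDiff_const.mul (hus.pow 2)).add (contDiff_const.mul (hus.mul hvs))).add
      (contDiff_const.mul (hvs.pow 2))
  · refine (((((u1 x).pow 2).const_mul p).add (((u1 x).mul (v1 x)).const_mul q)).add
      (((v1 x).pow 2).const_mul r)).congr_deriv ?_
    norm_num
    ring
  · exact (((((u1 x).mul (u2 x)).const_mul (2 * p)).add
      ((((u2 x).mul (v1 x)).add ((u1 x).mul (v2 x))).const_mul q)).add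
      (((v1 x).mul (v2 x)).const_mul (2 * r)))
  -- The defect is the discriminant times `W² - 1 = (W + 1)(W - 1)`, with `W` the Wronskian.
  · linear_combination (-(q ^ 2 - 4 * p * r)) *
      (deriv u x * v x - deriv v x * u x + 1) * h.wronskian x

/-! ### Hill's equation for the transforms of constants -/

theorem hasDerivAt_const_mul_sin (α k x : ℝ) :
    HasDerivAt (fun y => α * Real.sin (k * y)) (α * (Real.cos (k * x) * k)) x := by
  have := (((hasDerivAt_id x).const_mul k).sin).const_mul α
  simpa using this

theorem hasDerivAt_const_mul_cos (α k x : ℝ) :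
    HasDerivAt (fun y => α * Real.cos (k * y)) (-(α * (Real.sin (k * x) * k))) x := by
  have := (((hasDerivAt_id x).const_mul k).cos).const_mul α
  simpa using this

theorem hasDerivAt_const_mul_exp (α k x : ℝ) :
    HasDerivAt (fun y => α * Real.exp (k * y)) (α * (Real.exp (k * x) * k)) x := by
  have := (((hasDerivAt_id x).const_mul k).exp).const_mul α
  simpa using this

theorem IsHillBasis.congr_aspect {μ ν u v : ℝ → ℝ} (h : IsHillBasis μ u v) (e : ∀ x, μ x = ν x) :
    IsHillBasis ν u v := by
  rwa [show ν = μ from (funext e).symm]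

/-- Only the product `α β` is fixed by the Wronskian; the free ratio `α / β` later absorbs the boost
factor. The same freedom is kept in the zero and positive cases. -/
theorem IsCircleDiffeoLift.neg_basis {F : ℝ → ℝ} (hF : IsCircleDiffeoLift F) {m k α β : ℝ}
    (hm : m = -k ^ 2) (h : α * β * k = 2) :
    IsHillBasis (transformMassAspect F fun _ => m)
      (fun x => α * Real.sin (k / 2 * F x) / √(deriv F x))
      (fun x => β * Real.cos (k / 2 * F x) / √(deriv F x)) ∧
    HasMonodromyEntries (fun x => α * Real.sin (k / 2 * F x) / √(deriv F x))
      (fun x => β * Real.cos (k / 2 * F x) / √(deriv F x))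
      (Real.cos (k * π)) (α / β * Real.sin (k * π)) (-(β / α * Real.sin (k * π)))
      (Real.cos (k * π)) := by
  have hα : α ≠ 0 := by rintro rfl; norm_num at h
  have hβ : β ≠ 0 := by rintro rfl; norm_num at h
  refine ⟨hF.isHillBasis_transform (E₀ := fun y => α * Real.sin (k / 2 * y))
    (E₁ := fun y => β * Real.cos (k / 2 * y))
    (hasDerivAt_const_mul_sin α (k / 2)) (fun x => ?_) (hasDerivAt_const_mul_cos β (k / 2))
    (fun x => ?_) (fun x => ?_),
    hF.hasMonodromyEntries_transform (E₀ := fun y => α * Real.sin (k / 2 * y))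
    (E₁ := fun y => β * Real.cos (k / 2 * y)) fun x => ?_⟩
  · have := (hasDerivAt_const_mul_cos α (k / 2) x).mul_const (k / 2)
    simp only [mul_assoc] at this
    exact this.congr_deriv (by rw [hm]; ring)
  · have := ((hasDerivAt_const_mul_sin β (k / 2) x).mul_const (k / 2)).neg
    simp only [mul_assoc] at this
    exact this.congr_deriv (by rw [hm]; ring)
  · linear_combination (1 / 2 * (Real.sin (k / 2 * x) ^ 2 + Real.cos (k / 2 * x) ^ 2)) * h +
      Real.sin_sq_add_cos_sq (k / 2 * x)
  · simp only [show k / 2 * (x + 2 * π) = k / 2 * x + k * π by ring, Real.sin_add, Real.cos_add]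
    constructor
    · field_simp
    · field_simp
      ring

theorem IsCircleDiffeoLift.zero_basis {F : ℝ → ℝ} (hF : IsCircleDiffeoLift F) {α β : ℝ}
    (h : α * β = 1) :
    IsHillBasis (transformMassAspect F fun _ => 0)
      (fun x => α * F x / √(deriv F x)) (fun x => β / √(deriv F x)) ∧
    HasMonodromyEntries (fun x => α * F x / √(deriv F x)) (fun x => β / √(deriv F x))
      1 (2 * π * α ^ 2) 0 1 := by
  refine ⟨hF.isHillBasis_transform (E₀ := fun y => α * y) (E₀' := fun _ => α) (E₁' := fun _ => 0)
    (E₁ := fun y => β) (fun x => by simpa using (hasDerivAt_id x).const_mul α)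
    (fun x => by simpa using hasDerivAt_const x α) (fun x => hasDerivAt_const x β)
    (fun x => by simpa using hasDerivAt_const x (0 : ℝ)) (fun x => by linarith),
    hF.hasMonodromyEntries_transform (E₀ := fun y => α * y) (E₁ := fun y => β) fun x => ?_⟩
  exact ⟨by linear_combination (-2 * π * α) * h, by ring⟩

theorem IsCircleDiffeoLift.pos_basis {F : ℝ → ℝ} (hF : IsCircleDiffeoLift F) {m k α β : ℝ}
    (hm : m = k ^ 2) (h : α * β * k = 1) :
    IsHillBasis (transformMassAspect F fun _ => m)
      (fun x => α * Real.exp (k / 2 * F x) / √(deriv F x))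
      (fun x => β * Real.exp (-k / 2 * F x) / √(deriv F x)) ∧
    HasMonodromyEntries (fun x => α * Real.exp (k / 2 * F x) / √(deriv F x))
      (fun x => β * Real.exp (-k / 2 * F x) / √(deriv F x))
      (Real.exp (k * π)) 0 0 (Real.exp (-(k * π))) := by
  refine ⟨hF.isHillBasis_transform (E₀ := fun y => α * Real.exp (k / 2 * y))
    (E₁ := fun y => β * Real.exp (-k / 2 * y))
    (hasDerivAt_const_mul_exp α (k / 2)) (fun x => ?_) (hasDerivAt_const_mul_exp β (-k / 2))
    (fun x => ?_) (fun x => ?_),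
    hF.hasMonodromyEntries_transform (E₀ := fun y => α * Real.exp (k / 2 * y))
    (E₁ := fun y => β * Real.exp (-k / 2 * y)) fun x => ?_⟩
  · have := (hasDerivAt_const_mul_exp α (k / 2) x).mul_const (k / 2)
    simp only [mul_assoc] at this
    exact this.congr_deriv (by rw [hm]; ring)
  · have := (hasDerivAt_const_mul_exp β (-k / 2) x).mul_const (-k / 2)
    simp only [mul_assoc] at this
    exact this.congr_deriv (by rw [hm]; ring)
  · have e : Real.exp (k / 2 * x) * Real.exp (-k / 2 * x) = 1 := by
      rw [← Real.exp_add]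
      ring_nf
      simp
    linear_combination (Real.exp (k / 2 * x) * Real.exp (-k / 2 * x)) * h + e
  · simp only [show k / 2 * (x + 2 * π) = k / 2 * x + k * π by ring,
      show -k / 2 * (x + 2 * π) = -k / 2 * x + -(k * π) by ring, Real.exp_add]
    constructor <;> ring

/-! ### Zeros and mass parameters -/

theorem CanBeTransformedToConst.exists_neg_basis {μ : ℝ → ℝ} {m : ℝ} (hm : m < 0)
    (h : CanBeTransformedToConst μ m) : ∃ F : ℝ → ℝ, IsCircleDiffeoLift F ∧
      IsHillBasis μ (fun x => 2 / √|m| * Real.sin (√|m| / 2 * F x) / √(deriv F x))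
        (fun x => 1 * Real.cos (√|m| / 2 * F x) / √(deriv F x)) ∧
      ∃ b c, HasMonodromyEntries (fun x => 2 / √|m| * Real.sin (√|m| / 2 * F x) / √(deriv F x))
        (fun x => 1 * Real.cos (√|m| / 2 * F x) / √(deriv F x))
        (Real.cos (√|m| * π)) b c (Real.cos (√|m| * π)) := by
  obtain ⟨F, hF, e⟩ := canBeTransformedToConst_iff.1 h
  have hk : 0 < √|m| := Real.sqrt_pos.2 (abs_pos.2 hm.ne)
  have hk2 : m = -√|m| ^ 2 := by rw [Real.sq_sqrt (abs_nonneg m), abs_of_neg hm]; ring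
  obtain ⟨h1, h2⟩ := hF.neg_basis hk2 (α := 2 / √|m|) (β := 1) (by field_simp)
  exact ⟨F, hF, h1.congr_aspect e, _, _, h2⟩

theorem HasMonodromyEntries.trace_of_neg {μ u v : ℝ → ℝ} {a b c d m : ℝ} (h : IsHillBasis μ u v)
    (hM : HasMonodromyEntries u v a b c d) (hm : m < 0) (hc : CanBeTransformedToConst μ m) :
    Real.cos (√|m| * π) = (a + d) / 2 := by
  obtain ⟨F, -, h1, b', c', h2⟩ := hc.exists_neg_basis hm
  linarith [hM.trace_eq h h1 h2]

theorem HasMonodromyEntries.trace_of_zero {μ u v : ℝ → ℝ} {a b c d : ℝ} (h : IsHillBasis μ u v)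
    (hM : HasMonodromyEntries u v a b c d) (hc : CanBeTransformedToConst μ 0) :
    1 = (a + d) / 2 := by
  obtain ⟨F, hF, e⟩ := canBeTransformedToConst_iff.1 hc
  obtain ⟨h1, h2⟩ := hF.zero_basis (α := 1) (β := 1) (by norm_num)
  linarith [hM.trace_eq h (h1.congr_aspect e) h2]

theorem HasMonodromyEntries.trace_of_pos {μ u v : ℝ → ℝ} {a b c d m : ℝ} (h : IsHillBasis μ u v)
    (hM : HasMonodromyEntries u v a b c d) (hm : 0 < m) (hc : CanBeTransformedToConst μ m) :
    Real.cosh (√m * π) = (a + d) / 2 := by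
  obtain ⟨F, hF, e⟩ := canBeTransformedToConst_iff.1 hc
  have hk : 0 < √m := Real.sqrt_pos.2 hm
  obtain ⟨h1, h2⟩ := hF.pos_basis (Real.sq_sqrt hm.le).symm (α := 1 / √m) (β := 1) (by field_simp)
  rw [Real.cosh_eq]
  linarith [hM.trace_eq h (h1.congr_aspect e) h2]

/-! ### Existence and number of zeros of Hill solutions -/

theorem CanBeTransformedToConst.exists_nonvanishing {μ : ℝ → ℝ} {m : ℝ} (hm : 0 ≤ m)
    (h : CanBeTransformedToConst μ m) : ∃ ψ, IsHillSolution μ ψ ∧ ∀ x, ψ x ≠ 0 := by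
  obtain ⟨F, hF, e⟩ := canBeTransformedToConst_iff.1 h
  have hq : ∀ x, √(deriv F x) ≠ 0 := fun x => (Real.sqrt_pos.2 (hF.deriv_pos x)).ne'
  rcases hm.eq_or_lt with rfl | hm
  · obtain ⟨h1, -⟩ := hF.zero_basis (α := 1) (β := 1) (by norm_num)
    exact ⟨_, (h1.congr_aspect e).right, fun x => div_ne_zero one_ne_zero (hq x)⟩
  · have hk : 0 < √m := Real.sqrt_pos.2 hm
    obtain ⟨h1, -⟩ := hF.pos_basis (Real.sq_sqrt hm.le).symm (α := 1 / √m) (β := 1)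
      (by field_simp)
    exact ⟨_, (h1.congr_aspect e).right, fun x =>
      div_ne_zero (mul_ne_zero one_ne_zero (Real.exp_pos _).ne') (hq x)⟩

theorem exists_sin_cos_comb_eq_zero (a b : ℝ) :
    ∃ θ : ℝ, a * Real.sin θ + b * Real.cos θ = 0 := by
  by_cases ha : a = 0
  · exact ⟨π / 2, by simp [ha]⟩
  · refine ⟨-Real.arctan (b / a), ?_⟩
    rw [Real.sin_neg, Real.cos_neg, Real.sin_arctan, Real.cos_arctan]
    field_simp
    ring

/-- Together with `exists_nonvanishing` this shows that negative and nonnegative constants cannot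
represent the same `μ`, which the trace alone does not exclude when it equals `2`. -/
theorem CanBeTransformedToConst.exists_zero {μ ψ : ℝ → ℝ} {m : ℝ} (hm : m < 0)
    (h : CanBeTransformedToConst μ m) (hψ : IsHillSolution μ ψ) : ∃ x, ψ x = 0 := by
  obtain ⟨F, hF, h1, -⟩ := h.exists_neg_basis hm
  obtain ⟨G, -, -, hG⟩ := hF.exists_inverse
  have hk : 0 < √|m| := Real.sqrt_pos.2 (abs_pos.2 hm.ne)
  obtain ⟨a, b, hab⟩ := h1.exists_eq_comb hψ
  obtain ⟨θ, hθ⟩ := exists_sin_cos_comb_eq_zero (a * (2 / √|m|)) b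
  refine ⟨G (2 / √|m| * θ), ?_⟩
  rw [hab, hG, show √|m| / 2 * (2 / √|m| * θ) = θ by field_simp]
  linear_combination (√(deriv F (G (2 / √|m| * θ))))⁻¹ * hθ

/-- Up to a nonvanishing factor, a solution vanishing at `y` is `sin (k/2 (F x - F y))` with `k =
√|m|`. Its zeros are at `F x = F y + 2πn/k`, and one period `0 ≤ F x - F y < 2π` allows the integers
`0 ≤ n < k`. -/
theorem CanBeTransformedToConst.hasZeroNumber {μ : ℝ → ℝ} {m : ℝ} (hm : m < 0)
    (h : CanBeTransformedToConst μ m) : HasZeroNumber μ ⌈√|m|⌉₊ := by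
  obtain ⟨F, hF, h1, -⟩ := h.exists_neg_basis hm
  obtain ⟨G, hG', hGF, hG⟩ := hF.exists_inverse
  have hk : 0 < √|m| := Real.sqrt_pos.2 (abs_pos.2 hm.ne)
  set k := √|m| with hkdef
  intro ψ y hψ ⟨z, hz⟩ hy
  obtain ⟨a, b, hab⟩ := h1.exists_eq_comb hψ
  have hq : ∀ x, √(deriv F x) ≠ 0 := fun x => (Real.sqrt_pos.2 (hF.deriv_pos x)).ne'
  set A := a * (2 / k)
  have hψx : ∀ x, ψ x * √(deriv F x) =
      A * Real.sin (k / 2 * F x) + b * Real.cos (k / 2 * F x) := fun x => by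
    have := hq x
    rw [hab]
    field_simp
    simp only [A]
    field_simp
  have hy0 := hψx y
  rw [hy, zero_mul] at hy0
  set C := A * Real.cos (k / 2 * F y) - b * Real.sin (k / 2 * F y)
  have hψC : ∀ x, ψ x * √(deriv F x) = C * Real.sin (k / 2 * (F x - F y)) := fun x => by
    rw [hψx, mul_sub, Real.sin_sub]
    have e := Real.sin_sq_add_cos_sq (k / 2 * F y)
    linear_combination (-(A * Real.sin (k / 2 * F x)) - b * Real.cos (k / 2 * F x)) * e -
      (Real.sin (k / 2 * F x) * Real.sin (k / 2 * F y) +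
        Real.cos (k / 2 * F x) * Real.cos (k / 2 * F y)) * hy0
  have hC : C ≠ 0 := by
    intro h0
    have := hψC z
    rw [h0, zero_mul] at this
    exact hz ((mul_eq_zero.1 this).resolve_right (hq z))
  have hzero : ∀ x, ψ x = 0 ↔ ∃ n : ℤ, (n : ℝ) * π = k / 2 * (F x - F y) := fun x => by
    rw [← Real.sin_eq_zero_iff]
    have := hψC x
    constructor
    · intro h0
      rw [h0, zero_mul] at this
      exact (mul_eq_zero.1 this.symm).resolve_left hC
    · intro h0
      rw [h0, mul_zero] at this
      exact (mul_eq_zero.1 this).resolve_right (hq x)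
  have hpi := Real.pi_pos
  have hset : {x ∈ Set.Ico y (y + 2 * π) | ψ x = 0} =
      (fun n : ℕ => G (F y + 2 * π * n / k)) '' (Finset.range ⌈k⌉₊ : Set ℕ) := by
    ext x
    simp only [Set.mem_ofPred_eq, Set.mem_image, Finset.coe_range, Set.mem_Iio, Set.mem_Ico,
      Nat.lt_ceil, hzero]
    constructor
    · rintro ⟨⟨hx1, hx2⟩, n, hn⟩
      have h3 := hF.strictMono.monotone hx1
      have h4 := hF.strictMono hx2
      rw [hF.map_add_two_pi] at h4
      have hn0 : 0 ≤ n := by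
        by_contra! hneg
        have h5 : (n : ℝ) ≤ -1 := by exact_mod_cast Int.le_sub_one_of_lt hneg
        have h6 : 0 ≤ k / 2 * (F x - F y) := by
          have : 0 ≤ F x - F y := by linarith
          positivity
        nlinarith
      lift n to ℕ using hn0
      rw [Int.cast_natCast] at hn
      refine ⟨n, ?_, ?_⟩
      · by_contra! hle
        have h5 : k / 2 * (F x - F y) < k / 2 * (2 * π) :=
          mul_lt_mul_of_pos_left (by linarith) (by positivity)
        nlinarith
      · rw [show F y + 2 * π * n / k = F x by field_simp; linarith, hGF]
    · rintro ⟨n, hn, rfl⟩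
      refine ⟨⟨?_, ?_⟩, n, ?_⟩
      · rw [← hF.strictMono.le_iff_le, hG]
        have : 0 ≤ 2 * π * n / k := by positivity
        linarith
      · rw [← hF.strictMono.lt_iff_lt, hG, hF.map_add_two_pi]
        have : 2 * π * n / k < 2 * π := by
          rw [div_lt_iff₀ hk]
          exact mul_lt_mul_of_pos_left hn (by positivity)
        linarith
      · rw [hG]
        push_cast
        field_simp
        ring
  rw [hset, Set.InjOn.encard_image, Set.encard_coe_eq_coe_finsetCard, Finset.card_range]
  intro i _ j _ hij
  have h3 : F y + 2 * π * i / k = F y + 2 * π * j / k := hG'.strictMono.injective hij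
  field_simp at h3
  have h4 : (i : ℝ) = j := mul_left_cancel₀ Real.two_pi_pos.ne' (by linarith)
  exact_mod_cast h4

theorem HasZeroNumber.unique {μ ψ : ℝ → ℝ} {N N' : ℕ} (h : HasZeroNumber μ N)
    (h' : HasZeroNumber μ N') (hψ : IsHillSolution μ ψ) (h0 : ∃ x, ψ x = 0)
    (hne : ∃ x, ψ x ≠ 0) : N = N' := by
  obtain ⟨y, hy⟩ := h0
  have := (h ψ y hψ hne hy).symm.trans (h' ψ y hψ hne hy)
  exact_mod_cast this

/-- The map `s ↦ cos (s π)` is monotone between consecutive integers. In the reflected case `s + s'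
= 2j` lies in `(2N - 2, 2N]`, so `j = N` and both numbers are the endpoint `N`. -/
theorem eq_of_cos_eq_of_mem_Ioc {s s' N : ℝ} (hN : ∃ n : ℤ, (n : ℝ) = N)
    (hs : s ∈ Set.Ioc (N - 1) N) (hs' : s' ∈ Set.Ioc (N - 1) N)
    (h : Real.cos (s * π) = Real.cos (s' * π)) : s = s' := by
  obtain ⟨n, rfl⟩ := hN
  obtain ⟨j, hj | hj⟩ := Real.cos_eq_cos_iff.1 h
  · have h1 : s' = 2 * j + s := by
      apply mul_right_cancel₀ Real.pi_ne_zero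
      linarith
    have h2 : (2 * j : ℝ) < 1 := by linarith [hs.1, hs'.2]
    have h3 : (-1 : ℝ) < 2 * j := by linarith [hs.2, hs'.1]
    have h2' : 2 * j < 1 := by exact_mod_cast h2
    have h3' : -1 < 2 * j := by exact_mod_cast h3
    have : j = 0 := by omega
    rw [h1, this]
    simp
  · have h1 : s' = 2 * j - s := by
      apply mul_right_cancel₀ Real.pi_ne_zero
      linarith
    have h2 : (2 * j : ℝ) ≤ 2 * n := by linarith [hs.2, hs'.2]
    have h3 : (2 * n - 2 : ℝ) < 2 * j := by linarith [hs.1, hs'.1]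
    have h2' : 2 * j ≤ 2 * n := by exact_mod_cast h2
    have h3' : 2 * n - 2 < 2 * j := by exact_mod_cast h3
    have : j = n := by omega
    rw [this] at h1
    linarith [hs.2, hs'.2]

theorem mem_Ioc_ceil {k : ℝ} (hk : 0 < k) : k ∈ Set.Ioc ((⌈k⌉₊ : ℝ) - 1) ⌈k⌉₊ :=
  ⟨by linarith [Nat.ceil_lt_add_one hk.le], Nat.le_ceil k⟩

theorem eq_of_sqrt_abs_eq {m m' : ℝ} (hm : m < 0) (hm' : m' < 0) (h : √|m| = √|m'|) : m = m' := by
  rw [Real.sqrt_inj (abs_nonneg _) (abs_nonneg _), abs_of_neg hm, abs_of_neg hm'] at h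
  linarith

/-- A negative constant representative is the mass parameter, and is selected by zero counting. -/
theorem CanBeTransformedToConst.hasMassParameter_of_neg {μ : ℝ → ℝ} {m : ℝ} (hm : m < 0)
    (h : CanBeTransformedToConst μ m) :
    HasMassParameter μ m ∧ IsRootByZeroCounting μ (Real.cos (√|m| * π)) m := by
  have hk : 0 < √|m| := Real.sqrt_pos.2 (abs_pos.2 hm.ne)
  have hZ := h.hasZeroNumber hm
  refine ⟨⟨h, fun m' h' => ?_⟩, hm, rfl, _, hZ, mem_Ioc_ceil hk, fun m' hm' hcos hmem => ?_⟩
  -- A nonnegative `m'` is excluded by a nowhere vanishing solution; a negative one has the same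
  -- zero count and the same cosine.
  · rcases le_or_gt 0 m' with hm' | hm'
    · obtain ⟨ψ, hψ, hne⟩ := h'.exists_nonvanishing hm'
      obtain ⟨x, hx⟩ := h.exists_zero hm hψ
      exact absurd hx (hne x)
    · have hk' : 0 < √|m'| := Real.sqrt_pos.2 (abs_pos.2 hm'.ne)
      obtain ⟨F, hF, h1, b, c, h2⟩ := h.exists_neg_basis hm
      have hcos := h2.trace_of_neg h1 hm' h'
      have hne : ∃ x, 2 / √|m| * Real.sin (√|m| / 2 * F x) / √(deriv F x) ≠ 0 := by
        by_contra! h0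
        have := h1.eq_zero_of_comb (a := 1) (b := 0) (fun x => by rw [h0 x]; ring)
        exact one_ne_zero this.1
      have hN : ⌈√|m'|⌉₊ = ⌈√|m|⌉₊ :=
        (h'.hasZeroNumber hm').unique hZ h1.left (h.exists_zero hm h1.left) hne
      have hmem := mem_Ioc_ceil hk'
      rw [hN] at hmem
      exact eq_of_sqrt_abs_eq hm' hm (eq_of_cos_eq_of_mem_Ioc ⟨(⌈√|m|⌉₊ : ℤ), by simp⟩ hmem
        (mem_Ioc_ceil hk) (by linarith))
  · exact eq_of_sqrt_abs_eq hm' hm (eq_of_cos_eq_of_mem_Ioc ⟨(⌈√|m|⌉₊ : ℤ), by simp⟩ hmem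
      (mem_Ioc_ceil hk) hcos)

/-- A positive constant representative is the mass parameter. -/
theorem CanBeTransformedToConst.hasMassParameter_of_pos {μ : ℝ → ℝ} {m : ℝ} (hm : 0 < m)
    (h : CanBeTransformedToConst μ m) : HasMassParameter μ m := by
  refine ⟨h, fun m' h' => ?_⟩
  obtain ⟨F, hF, e⟩ := canBeTransformedToConst_iff.1 h
  have hk : 0 < √m := Real.sqrt_pos.2 hm
  obtain ⟨h1, h2⟩ := hF.pos_basis (Real.sq_sqrt hm.le).symm (α := 1 / √m) (β := 1) (by field_simp)
  replace h1 := h1.congr_aspect e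
  have t := h2.trace_of_pos h1 hm h
  have hpos : 0 < √m * π := mul_pos hk Real.pi_pos
  have hgt : 1 < Real.cosh (√m * π) := Real.one_lt_cosh.2 hpos.ne'
  -- Here the half-trace exceeds `1`, which excludes the value `cos ≤ 1` of a negative constant and
  -- the value `1` of the zero constant.
  rcases lt_trichotomy m' 0 with hm' | rfl | hm'
  · have t' := h2.trace_of_neg h1 hm' h'
    linarith [Real.cos_le_one (√|m'| * π)]
  · have t' := h2.trace_of_zero h1 h'
    linarith
  · have t' := h2.trace_of_pos h1 hm' h'
    have hpos' : 0 < √m' * π := mul_pos (Real.sqrt_pos.2 hm') Real.pi_pos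
    have h3 : √m' * π = √m * π := Real.cosh_strictMonoOn.injOn (Set.mem_Ici.2 hpos'.le)
      (Set.mem_Ici.2 hpos.le) (by linarith)
    have h4 := mul_right_cancel₀ Real.pi_ne_zero h3
    rwa [Real.sqrt_inj hm'.le hm.le] at h4

/-! ### Mass parameters from the monodromy -/

theorem quadratic_form_pos {p q r x y : ℝ} (hp : 0 < p) (hD : q ^ 2 - 4 * p * r < 0)
    (hxy : x ≠ 0 ∨ y ≠ 0) : 0 < p * x ^ 2 + q * (x * y) + r * y ^ 2 := by
  have e : 4 * p * (p * x ^ 2 + q * (x * y) + r * y ^ 2) =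
      (2 * p * x + q * y) ^ 2 + -(q ^ 2 - 4 * p * r) * y ^ 2 := by ring
  have h : 0 < (2 * p * x + q * y) ^ 2 + -(q ^ 2 - 4 * p * r) * y ^ 2 := by
    by_cases hy : y = 0
    · have hx : x ≠ 0 := hxy.resolve_right (not_not.2 hy)
      rw [hy]
      have : 0 < (2 * p * x) ^ 2 := by positivity
      simpa using this
    · have h1 : 0 < -(q ^ 2 - 4 * p * r) * y ^ 2 := mul_pos (by linarith) (by positivity)
      have h2 := sq_nonneg (2 * p * x + q * y)
      linarith
  rw [← e] at h
  exact pos_of_mul_pos_right h (by positivity)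

theorem IsHillBasis.ne_zero {μ u v : ℝ → ℝ} (h : IsHillBasis μ u v) (x : ℝ) :
    u x ≠ 0 ∨ v x ≠ 0 := by
  by_contra! h0
  have := h.wronskian x
  rw [h0.1, h0.2] at this
  norm_num at this

/-- Up to `ε` the form is the determinant of the pair `Ψ, M Ψ` with `Ψ = (u, v)`. Replacing `Ψ` by
`M Ψ` multiplies it by `det M = 1`. The factor `ε` is used to choose the sign. -/
theorem HasMonodromyEntries.form_periodic {u v : ℝ → ℝ} {a b c d : ℝ}
    (hM : HasMonodromyEntries u v a b c d) (hdet : a * d - b * c = 1) (ε x : ℝ) :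
    ε * c * u (x + 2 * π) ^ 2 + ε * (d - a) * (u (x + 2 * π) * v (x + 2 * π)) +
      ε * (-b) * v (x + 2 * π) ^ 2 =
    ε * c * u x ^ 2 + ε * (d - a) * (u x * v x) + ε * (-b) * v x ^ 2 := by
  rw [(hM x).1, (hM x).2]
  linear_combination ε * (c * u x ^ 2 + (d - a) * (u x * v x) + (-b) * v x ^ 2) * hdet

/-- The discriminant of the invariant form is `(a + d)² - 4 < 0`, so the form is definite, `c ≠ 0`,
and `ε` is the sign of `c`. -/
theorem HasMonodromyEntries.massParameter_of_elliptic {μ u v : ℝ → ℝ} {a b c d : ℝ}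
    (hμ : ContDiff ℝ ∞ μ) (h : IsHillBasis μ u v) (hM : HasMonodromyEntries u v a b c d)
    (htr : |a + d| < 2) :
    ∃ m : ℝ, HasMassParameter μ m ∧ IsRootByZeroCounting μ ((a + d) / 2) m := by
  have hdet := hM.det_eq_one h
  rw [abs_lt] at htr
  have hD : (d - a) ^ 2 - 4 * c * (-b) < 0 := by nlinarith
  have hc : c ≠ 0 := by
    rintro rfl
    nlinarith [sq_nonneg (d - a)]
  obtain ⟨ε, hε, hεc⟩ : ∃ ε : ℝ, ε ^ 2 = 1 ∧ 0 < ε * c := by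
    rcases lt_or_gt_of_ne hc with hc | hc
    · exact ⟨-1, by norm_num, by linarith⟩
    · exact ⟨1, by norm_num, by linarith⟩
  have hD' : (ε * (d - a)) ^ 2 - 4 * (ε * c) * (ε * (-b)) < 0 := by
    have : (ε * (d - a)) ^ 2 - 4 * (ε * c) * (ε * (-b)) =
      ε ^ 2 * ((d - a) ^ 2 - 4 * c * (-b)) := by ring
    rw [this, hε, one_mul]
    exact hD
  obtain ⟨hI, hcan⟩ := h.canBeTransformedToConst_of_form hμ
    (fun x => quadratic_form_pos hεc hD' (h.ne_zero x)) (hM.form_periodic hdet ε) 0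
  have hneg := mul_neg_of_neg_of_pos hD' (pow_pos (div_pos hI Real.two_pi_pos) 2)
  rw [← hM.trace_of_neg h hneg hcan]
  exact ⟨_, hcan.hasMassParameter_of_neg hneg⟩

/-- For a rotation the form `u² + v²` is invariant. This includes `M = ±1`, where the form built
from the entries of `M` vanishes identically, and it gives the constant explicitly through an
integral. -/
theorem HasMonodromyEntries.canBeTransformedToConst_of_rotation {μ u v : ℝ → ℝ} {a b : ℝ}
    (hμ : ContDiff ℝ ∞ μ) (h : IsHillBasis μ u v) (hM : HasMonodromyEntries u v a b (-b) a)
    (y : ℝ) : 0 < (∫ x in y..(y + 2 * π), 1 / (u x ^ 2 + v x ^ 2)) ∧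
    CanBeTransformedToConst μ
      (-((∫ x in y..(y + 2 * π), 1 / (u x ^ 2 + v x ^ 2)) / π) ^ 2) := by
  have hdet := hM.det_eq_one h
  have := h.canBeTransformedToConst_of_form hμ (p := 1) (q := 0) (r := 1)
    (fun x => quadratic_form_pos (by norm_num) (by norm_num) (h.ne_zero x))
    (fun x => by
      rw [(hM x).1, (hM x).2]
      linear_combination (u x ^ 2 + v x ^ 2) * hdet) y
  simp only [one_mul, zero_mul, add_zero] at this
  refine ⟨this.1, ?_⟩
  convert this.2 using 1
  have := Real.pi_ne_zero
  field_simp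
  ring

theorem HasMonodromyEntries.massParameter_of_rotation {μ u v : ℝ → ℝ} {a b : ℝ}
    (hμ : ContDiff ℝ ∞ μ) (h : IsHillBasis μ u v) (hM : HasMonodromyEntries u v a b (-b) a) :
    ∃ m : ℝ, HasMassParameter μ m ∧ IsRootByZeroCounting μ ((a + a) / 2) m := by
  obtain ⟨hI, hcan⟩ := hM.canBeTransformedToConst_of_rotation hμ h 0
  have hneg := neg_lt_zero.2 (pow_pos (div_pos hI Real.pi_pos) 2)
  rw [← hM.trace_of_neg h hneg hcan]
  exact ⟨_, hcan.hasMassParameter_of_neg hneg⟩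

/-- The invariant form is indefinite on the plane, so its sign along the curve `(u, v)` is genuine
extra information and enters as a hypothesis; minus the form is then the positive `ρ`. -/
theorem HasMonodromyEntries.massParameter_of_hyperbolic {μ u v : ℝ → ℝ} {a b c d : ℝ}
    (hμ : ContDiff ℝ ∞ μ) (h : IsHillBasis μ u v) (hM : HasMonodromyEntries u v a b c d)
    (htr : 2 < a + d) (hneg : ∀ x, c * u x ^ 2 + (d - a) * (u x * v x) + (-b) * v x ^ 2 < 0) :
    ∃ m : ℝ, 0 < m ∧ HasMassParameter μ m ∧ Real.cosh (√m * π) = (a + d) / 2 := by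
  have hdet := hM.det_eq_one h
  obtain ⟨hI, hcan⟩ := h.canBeTransformedToConst_of_form hμ
    (fun x => by linarith [hneg x]) (hM.form_periodic hdet (-1)) 0
  have hD : 0 < (-1 * (d - a)) ^ 2 - 4 * (-1 * c) * (-1 * (-b)) := by nlinarith
  have hpos := mul_pos hD (pow_pos (div_pos hI Real.two_pi_pos) 2)
  exact ⟨_, hpos, hcan.hasMassParameter_of_pos hpos, hM.trace_of_pos h hpos hcan⟩

/-! ### Gluing functions on consecutive intervals -/

/-- The function equal to `u j` on the `j`-th interval of length `T` counted from `a`. -/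
def glue (a T : ℝ) (u : ℤ → ℝ → ℝ) (x : ℝ) : ℝ := u ⌊(x - a) / T⌋ x

theorem glue_eq {a T : ℝ} (hT : 0 < T) {u : ℤ → ℝ → ℝ}
    (hu : ∀ j : ℤ, u j (a + (j + 1) * T) = u (j + 1) (a + (j + 1) * T)) {j : ℤ} {x : ℝ}
    (hx : x ∈ Set.Icc (a + j * T) (a + (j + 1) * T)) : glue a T u x = u j x := by
  rcases hx.2.eq_or_lt with h | h
  · have : ⌊(x - a) / T⌋ = j + 1 := by
      rw [h, add_sub_cancel_left, mul_div_cancel_right₀ _ hT.ne']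
      exact_mod_cast Int.floor_intCast (j + 1)
    rw [glue, this, h, ← hu]
  · have : ⌊(x - a) / T⌋ = j := by
      rw [Int.floor_eq_iff, le_div_iff₀ hT, div_lt_iff₀ hT]
      constructor <;> linarith [hx.1]
    rw [glue, this]

/-- One-sided derivatives suffice: both neighbouring pieces have derivative `D x` at a common
endpoint. Only the left side at such an endpoint needs the piece of index `j - 1`. -/
theorem hasDerivAt_glue {a T : ℝ} (hT : 0 < T) {u : ℤ → ℝ → ℝ} {D : ℝ → ℝ}
    (hu : ∀ j : ℤ, u j (a + (j + 1) * T) = u (j + 1) (a + (j + 1) * T))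
    (hd : ∀ (j : ℤ), ∀ x ∈ Set.Icc (a + j * T) (a + (j + 1) * T), HasDerivAt (u j) (D x) x)
    (x : ℝ) : HasDerivAt (glue a T u) (D x) x := by
  have key : ∀ j : ℤ, ∀ x ∈ Set.Icc (a + j * T) (a + (j + 1) * T),
      HasDerivWithinAt (glue a T u) (D x) (Set.Icc (a + j * T) (a + (j + 1) * T)) x :=
    fun j x hx => (hd j x hx).hasDerivWithinAt.congr (fun y hy => glue_eq hT hu hy)
      (glue_eq hT hu hx)
  have hfl : ((⌊(x - a) / T⌋ : ℤ) : ℝ) * T ≤ x - a := by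
    rw [← le_div_iff₀ hT]
    exact Int.floor_le _
  have hfl' : x - a < ((⌊(x - a) / T⌋ : ℤ) + 1 : ℝ) * T := by
    rw [← div_lt_iff₀ hT]
    exact Int.lt_floor_add_one _
  set j := ⌊(x - a) / T⌋
  have hr : HasDerivWithinAt (glue a T u) (D x) (Set.Ici x) x :=
    (key j x ⟨by linarith, by linarith⟩).mono_of_mem_nhdsWithin
      (Filter.mem_of_superset (Icc_mem_nhdsGE (show x < a + (j + 1) * T by linarith))
        (Set.Icc_subset_Icc_left (show a + j * T ≤ x by linarith)))
  have hl : HasDerivWithinAt (glue a T u) (D x) (Set.Iic x) x := by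
    rcases (show a + j * T ≤ x by linarith).eq_or_lt with h | h
    · have h1 : a + ((j - 1 : ℤ) + 1) * T = x := by push_cast; linarith
      have h2 : a + (j - 1 : ℤ) * T < x := by push_cast; linarith
      exact (key (j - 1) x ⟨h2.le, h1.ge⟩).mono_of_mem_nhdsWithin
        (Filter.mem_of_superset (Icc_mem_nhdsLE h2) (Set.Icc_subset_Icc_right h1.ge))
    · exact (key j x ⟨by linarith, by linarith⟩).mono_of_mem_nhdsWithin
        (Filter.mem_of_superset (Icc_mem_nhdsLE h) (Set.Icc_subset_Icc_right (by linarith)))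
  have := hl.union hr
  rwa [Set.Iic_union_Ici, hasDerivWithinAt_univ] at this

/-- The pieces, on the intervals of length `π` starting at `-π/2 + jπ`, of the quasi-periodic
function which is `Uh, Vh` on `[-π/2, π/2]` and `Uc, Vc` on `[π/2, 3π/2]`. -/
def gluePiece (P : ℤ → Matrix (Fin 2) (Fin 2) ℝ) (Uh Vh Uc Vc : ℝ → ℝ) (i : Fin 2) (j : ℤ)
    (x : ℝ) : ℝ :=
  P (j / 2) i 0 * (if j % 2 = 0 then Uh else Uc) (x - (j / 2 : ℤ) * (2 * π)) +
    P (j / 2) i 1 * (if j % 2 = 0 then Vh else Vc) (x - (j / 2 : ℤ) * (2 * π))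

theorem gluePiece_even (P : ℤ → Matrix (Fin 2) (Fin 2) ℝ) (Uh Vh Uc Vc : ℝ → ℝ) (i : Fin 2)
    (n : ℤ) (x : ℝ) : gluePiece P Uh Vh Uc Vc i (2 * n) x =
      P n i 0 * Uh (x - n * (2 * π)) + P n i 1 * Vh (x - n * (2 * π)) := by
  simp [gluePiece]

theorem gluePiece_odd (P : ℤ → Matrix (Fin 2) (Fin 2) ℝ) (Uh Vh Uc Vc : ℝ → ℝ) (i : Fin 2)
    (n : ℤ) (x : ℝ) : gluePiece P Uh Vh Uc Vc i (2 * n + 1) x =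
      P n i 0 * Uc (x - n * (2 * π)) + P n i 1 * Vc (x - n * (2 * π)) := by
  have h1 : (2 * n + 1) / 2 = n := by omega
  have h2 : (2 * n + 1) % 2 = 1 := by omega
  simp [gluePiece, h1, h2]

/-- With `P n = Mⁿ`, the hat and check pieces meet at `π/2` inside a period, while at `3π/2` the
check piece is `M` times the next hat piece. Applied twice, to the solutions and to their
derivatives, this gives a differentiable glued function with differentiable derivative. -/
theorem gluePiece_match {P : ℤ → Matrix (Fin 2) (Fin 2) ℝ} {M : Matrix (Fin 2) (Fin 2) ℝ}
    (hP : ∀ n, P (n + 1) = P n * M) {Uh Vh Uc Vc : ℝ → ℝ}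
    (hU : Uh (π / 2) = Uc (π / 2)) (hV : Vh (π / 2) = Vc (π / 2))
    (hU' : Uc (3 * π / 2) = M 0 0 * Uh (-(π / 2)) + M 0 1 * Vh (-(π / 2)))
    (hV' : Vc (3 * π / 2) = M 1 0 * Uh (-(π / 2)) + M 1 1 * Vh (-(π / 2))) (i : Fin 2) (j : ℤ) :
    gluePiece P Uh Vh Uc Vc i j (-(π / 2) + (j + 1) * π) =
      gluePiece P Uh Vh Uc Vc i (j + 1) (-(π / 2) + (j + 1) * π) := by
  obtain ⟨n, rfl | rfl⟩ := Int.even_or_odd' j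
  · rw [gluePiece_even, gluePiece_odd]
    push_cast
    rw [show -(π / 2) + (2 * (n : ℝ) + 1) * π - n * (2 * π) = π / 2 by ring, hU, hV]
  · rw [gluePiece_odd, show 2 * n + 1 + 1 = 2 * (n + 1) by ring, gluePiece_even]
    push_cast
    rw [show -(π / 2) + (2 * (n : ℝ) + 1 + 1) * π - n * (2 * π) = 3 * π / 2 by ring,
      show -(π / 2) + (2 * (n : ℝ) + 1 + 1) * π - (n + 1) * (2 * π) = -(π / 2) by ring, hU', hV', hP]
    simp only [Matrix.mul_apply, Fin.sum_univ_two]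
    ring

theorem gluePiece_hasDerivAt {P : ℤ → Matrix (Fin 2) (Fin 2) ℝ}
    {Uh Vh Uc Vc Uh' Vh' Uc' Vc' : ℝ → ℝ} (h1 : ∀ x, HasDerivAt Uh (Uh' x) x)
    (h2 : ∀ x, HasDerivAt Vh (Vh' x) x) (h3 : ∀ x, HasDerivAt Uc (Uc' x) x)
    (h4 : ∀ x, HasDerivAt Vc (Vc' x) x) (i : Fin 2) (j : ℤ) (x : ℝ) :
    HasDerivAt (gluePiece P Uh Vh Uc Vc i j) (gluePiece P Uh' Vh' Uc' Vc' i j x) x := by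
  obtain ⟨n, rfl | rfl⟩ := Int.even_or_odd' j
  · rw [gluePiece_even, funext (gluePiece_even P Uh Vh Uc Vc i n)]
    exact (((h1 _).comp_sub_const x _).const_mul _).add (((h2 _).comp_sub_const x _).const_mul _)
  · rw [gluePiece_odd, funext (gluePiece_odd P Uh Vh Uc Vc i n)]
    exact (((h3 _).comp_sub_const x _).const_mul _).add (((h4 _).comp_sub_const x _).const_mul _)

theorem deriv_eq_of_eqOn_Icc {f g : ℝ → ℝ} {p q x d : ℝ} (hpq : p < q)
    (hf : DifferentiableAt ℝ f x) (h : Set.EqOn f g (Set.Icc p q)) (hx : x ∈ Set.Icc p q)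
    (hg : HasDerivAt g d x) : deriv f x = d :=
  (uniqueDiffOn_Icc hpq x hx).eq_deriv _ hf.hasDerivAt.hasDerivWithinAt
    (hg.hasDerivWithinAt.congr h (h hx))

/-- Gluing of bases of solutions of Hill's equation which agree with `√2 sin (x/2)`,
`√2 cos (x/2)` over the half-circles which are cut off. -/
theorem exists_glued_basis {μ μc μh uc vc uh vh : ℝ → ℝ} {ac bc cc dc ah bh ch dh : ℝ}
    (hμ : Continuous μ) (hper : ∀ x, μ (x + 2 * π) = μ x)
    (hμh : ∀ x ∈ Set.Icc (-(π / 2)) (π / 2), μ x = μh x)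
    (hμc : ∀ x ∈ Set.Icc (π / 2) (3 * π / 2), μ x = μc x)
    (Bc : IsHillBasis μc uc vc) (Mc : HasMonodromyEntries uc vc ac bc cc dc)
    (Bh : IsHillBasis μh uh vh) (Mh : HasMonodromyEntries uh vh ah bh ch dh)
    (huc : Set.EqOn uc (fun x => √2 * Real.sin (1 / 2 * x)) (Set.Icc (-(π / 2)) (π / 2)))
    (hvc : Set.EqOn vc (fun x => √2 * Real.cos (1 / 2 * x)) (Set.Icc (-(π / 2)) (π / 2)))
    (huh : Set.EqOn uh (fun x => √2 * Real.sin (1 / 2 * x)) (Set.Icc (π / 2) (3 * π / 2)))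
    (hvh : Set.EqOn vh (fun x => √2 * Real.cos (1 / 2 * x)) (Set.Icc (π / 2) (3 * π / 2))) :
    ∃ u v, IsHillBasis μ u v ∧
      HasMonodromyEntries u v (-(ac * ah + bc * ch)) (-(ac * bh + bc * dh))
        (-(cc * ah + dc * ch)) (-(cc * bh + dc * dh)) ∧
      (∀ x ∈ Set.Icc (-(π / 2)) (π / 2), u x = uh x ∧ v x = vh x) ∧
      (∀ x ∈ Set.Icc (π / 2) (3 * π / 2), u x = uc x ∧ v x = vc x) := by
  have hpi := Real.pi_pos
  -- Minus the product of the check matrix and the hat matrix.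
  set M : Matrix (Fin 2) (Fin 2) ℝ := !![-(ac * ah + bc * ch), -(ac * bh + bc * dh);
    -(cc * ah + dc * ch), -(cc * bh + dc * dh)] with hM
  have hdetc := Mc.det_eq_one Bc
  have hdeth := Mh.det_eq_one Bh
  have hdet : M.det = 1 := by
    rw [hM, Matrix.det_fin_two_of]
    linear_combination hdeth + (ah * dh - bh * ch) * hdetc
  obtain ⟨Mu, hMu⟩ : IsUnit M := by
    rw [Matrix.isUnit_iff_isUnit_det, hdet]
    exact isUnit_one
  set P : ℤ → Matrix (Fin 2) (Fin 2) ℝ := fun n => ((Mu ^ n : (Matrix (Fin 2) (Fin 2) ℝ)ˣ) :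
    Matrix (Fin 2) (Fin 2) ℝ) with hPdef
  -- Both orders are needed: `P n * M` to match the pieces across periods, `M * P n` to read off the
  -- monodromy.
  have hP : ∀ n, P (n + 1) = P n * M := fun n => by
    simp only [hPdef, zpow_add_one, Units.val_mul, hMu]
  have hP' : ∀ n, P (n + 1) = M * P n := fun n => by
    simp only [hPdef, add_comm n 1, zpow_one_add, Units.val_mul, hMu]
  have hP0 : P 0 = 1 := by simp [hPdef]
  -- the derivatives on the half-circles which are cut off
  have pc1 : π / 2 ∈ Set.Icc (-(π / 2)) (π / 2) := ⟨by linarith, by linarith⟩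
  have pc2 : -(π / 2) ∈ Set.Icc (-(π / 2)) (π / 2) := ⟨by linarith, by linarith⟩
  have ph1 : π / 2 ∈ Set.Icc (π / 2) (3 * π / 2) := ⟨by linarith, by linarith⟩
  have ph2 : 3 * π / 2 ∈ Set.Icc (π / 2) (3 * π / 2) := ⟨by linarith, by linarith⟩
  have duc : ∀ x ∈ Set.Icc (-(π / 2)) (π / 2), deriv uc x = √2 * (Real.cos (1 / 2 * x) * (1 / 2)) :=
    fun x hx => deriv_eq_of_eqOn_Icc (by linarith) (Bc.left.hasDerivAt x).differentiableAt huc hx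
      (hasDerivAt_const_mul_sin _ _ _)
  have dvc : ∀ x ∈ Set.Icc (-(π / 2)) (π / 2),
      deriv vc x = -(√2 * (Real.sin (1 / 2 * x) * (1 / 2))) :=
    fun x hx => deriv_eq_of_eqOn_Icc (by linarith) (Bc.right.hasDerivAt x).differentiableAt hvc hx
      (hasDerivAt_const_mul_cos _ _ _)
  have duh : ∀ x ∈ Set.Icc (π / 2) (3 * π / 2),
      deriv uh x = √2 * (Real.cos (1 / 2 * x) * (1 / 2)) :=
    fun x hx => deriv_eq_of_eqOn_Icc (by linarith) (Bh.left.hasDerivAt x).differentiableAt huh hx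
      (hasDerivAt_const_mul_sin _ _ _)
  have dvh : ∀ x ∈ Set.Icc (π / 2) (3 * π / 2),
      deriv vh x = -(√2 * (Real.sin (1 / 2 * x) * (1 / 2))) :=
    fun x hx => deriv_eq_of_eqOn_Icc (by linarith) (Bh.right.hasDerivAt x).differentiableAt hvh hx
      (hasDerivAt_const_mul_cos _ _ _)
  have eM : M 0 0 = -(ac * ah + bc * ch) ∧ M 0 1 = -(ac * bh + bc * dh) ∧
      M 1 0 = -(cc * ah + dc * ch) ∧ M 1 1 = -(cc * bh + dc * dh) := by simp [hM]
  obtain ⟨e00, e01, e10, e11⟩ := eM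
  have hshift : -(π / 2) + 2 * π = 3 * π / 2 := by ring
  -- The antiperiodicity of `sin (x/2)` and `cos (x/2)` is the source of the sign in `M`.
  have sin_shift : Real.sin (1 / 2 * (3 * π / 2)) = -Real.sin (1 / 2 * -(π / 2)) := by
    rw [← Real.sin_add_pi]; ring_nf
  have cos_shift : Real.cos (1 / 2 * (3 * π / 2)) = -Real.cos (1 / 2 * -(π / 2)) := by
    rw [← Real.cos_add_pi]; ring_nf
  have hend : ∀ {Uc Vc Uh Vh : ℝ → ℝ}, HasMonodromyEntries Uc Vc ac bc cc dc →
      HasMonodromyEntries Uh Vh ah bh ch dh → Uc (-(π / 2)) = -Uh (3 * π / 2) →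
      Vc (-(π / 2)) = -Vh (3 * π / 2) →
      Uc (3 * π / 2) = M 0 0 * Uh (-(π / 2)) + M 0 1 * Vh (-(π / 2)) ∧
      Vc (3 * π / 2) = M 1 0 * Uh (-(π / 2)) + M 1 1 * Vh (-(π / 2)) := by
    intro Uc Vc Uh Vh hc hh e1 e2
    have h1 := hc (-(π / 2))
    have h2 := hh (-(π / 2))
    rw [hshift] at h1 h2
    rw [h1.1, h1.2, e1, e2, h2.1, h2.2, e00, e01, e10, e11]
    constructor <;> ring
  obtain ⟨m1, m2⟩ := hend Mc Mh (by rw [huc pc2, huh ph2]; simp only [sin_shift]; ring)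
    (by rw [hvc pc2, hvh ph2]; simp only [cos_shift]; ring)
  obtain ⟨m1', m2'⟩ := hend (Mc.derivs Bc) (Mh.derivs Bh)
    (by rw [duc _ pc2, duh _ ph2, cos_shift]; ring)
    (by rw [dvc _ pc2, dvh _ ph2, sin_shift]; ring)
  have hmatch := gluePiece_match (P := P) hP (Uh := uh) (Vh := vh) (Uc := uc) (Vc := vc)
    (by rw [huh ph1, huc pc1]) (by rw [hvh ph1, hvc pc1]) m1 m2
  have hmatch' := gluePiece_match (P := P) hP (Uh := deriv uh) (Vh := deriv vh) (Uc := deriv uc)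
    (Vc := deriv vc) (by rw [duh _ ph1, duc _ pc1]) (by rw [dvh _ ph1, dvc _ pc1]) m1' m2'
  set w : Fin 2 → ℝ → ℝ := fun i => glue (-(π / 2)) π (gluePiece P uh vh uc vc i) with hw
  set w' : Fin 2 → ℝ → ℝ := fun i =>
    glue (-(π / 2)) π (gluePiece P (deriv uh) (deriv vh) (deriv uc) (deriv vc) i) with hw'
  have d1 : ∀ i x, HasDerivAt (w i) (w' i x) x := fun i x => by
    refine hasDerivAt_glue hpi (hmatch i) (fun j y hy => ?_) x
    rw [hw']
    simp only [glue_eq hpi (hmatch' i) hy]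
    exact gluePiece_hasDerivAt Bh.left.hasDerivAt Bh.right.hasDerivAt Bc.left.hasDerivAt
      Bc.right.hasDerivAt i j y
  have hperiodic : Function.Periodic μ (2 * π) := hper
  have d2 : ∀ i x, HasDerivAt (w' i) (μ x / 4 * w i x) x := fun i x => by
    refine hasDerivAt_glue hpi (D := fun x => μ x / 4 * w i x) (hmatch' i) (fun j y hy => ?_) x
    refine (gluePiece_hasDerivAt Bh.left.hasDerivAt_deriv Bh.right.hasDerivAt_deriv
      Bc.left.hasDerivAt_deriv Bc.right.hasDerivAt_deriv i j y).congr_deriv ?_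
    rw [hw]
    simp only [glue_eq hpi (hmatch i) hy]
    obtain ⟨n, rfl | rfl⟩ := Int.even_or_odd' j
    · push_cast at hy
      rw [gluePiece_even, gluePiece_even, ← hμh (y - n * (2 * π))
        ⟨by linarith [hy.1], by linarith [hy.2]⟩, hperiodic.sub_int_mul_eq n]
      ring
    · push_cast at hy
      rw [gluePiece_odd, gluePiece_odd, ← hμc (y - n * (2 * π))
        ⟨by linarith [hy.1], by linarith [hy.2]⟩, hperiodic.sub_int_mul_eq n]
      ring
  have hh : ∀ x ∈ Set.Icc (-(π / 2)) (π / 2), w 0 x = uh x ∧ w 1 x = vh x := by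
    intro x hx
    have hx' : x ∈ Set.Icc (-(π / 2) + ((0 : ℤ) : ℝ) * π) (-(π / 2) + (((0 : ℤ) : ℝ) + 1) * π) :=
      ⟨by push_cast; linarith [hx.1], by push_cast; linarith [hx.2]⟩
    have e : ∀ i, gluePiece P uh vh uc vc i 0 x = (1 : Matrix (Fin 2) (Fin 2) ℝ) i 0 * uh x +
        (1 : Matrix (Fin 2) (Fin 2) ℝ) i 1 * vh x := fun i => by
      have := gluePiece_even P uh vh uc vc i 0 x
      simpa [hP0] using this
    simp only [hw, glue_eq hpi (hmatch _) hx', e]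
    simp
  have hc : ∀ x ∈ Set.Icc (π / 2) (3 * π / 2), w 0 x = uc x ∧ w 1 x = vc x := by
    intro x hx
    have hx' : x ∈ Set.Icc (-(π / 2) + ((1 : ℤ) : ℝ) * π) (-(π / 2) + (((1 : ℤ) : ℝ) + 1) * π) :=
      ⟨by push_cast; linarith [hx.1], by push_cast; linarith [hx.2]⟩
    have e : ∀ i, gluePiece P uh vh uc vc i 1 x = (1 : Matrix (Fin 2) (Fin 2) ℝ) i 0 * uc x +
        (1 : Matrix (Fin 2) (Fin 2) ℝ) i 1 * vc x := fun i => by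
      have := gluePiece_odd P uh vh uc vc i 0 x
      simpa [hP0] using this
    simp only [hw, glue_eq hpi (hmatch _) hx', e]
    simp
  have hsol : ∀ i, IsHillSolution μ (w i) := fun i => isHillSolution_of_hasDerivAt hμ (d1 i) (d2 i)
  refine ⟨w 0, w 1, ⟨hsol 0, hsol 1, fun x => ?_⟩, fun x => ?_, hh, hc⟩
  · rw [(hsol 0).wronskian_const (hsol 1) x (π / 2), (hh _ pc1).1, (hh _ pc1).2,
      (d1 0 _).deriv, (d1 1 _).deriv]
    have hx' : π / 2 ∈ Set.Icc (-(π / 2) + ((0 : ℤ) : ℝ) * π) (-(π / 2) + (((0 : ℤ) : ℝ) + 1) * π) :=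
      ⟨by push_cast; linarith, by push_cast; linarith⟩
    have e : ∀ i, gluePiece P (deriv uh) (deriv vh) (deriv uc) (deriv vc) i 0 (π / 2) =
        (1 : Matrix (Fin 2) (Fin 2) ℝ) i 0 * deriv uh (π / 2) +
        (1 : Matrix (Fin 2) (Fin 2) ℝ) i 1 * deriv vh (π / 2) := fun i => by
      have := gluePiece_even P (deriv uh) (deriv vh) (deriv uc) (deriv vc) i 0 (π / 2)
      simpa [hP0] using this
    simp only [hw', glue_eq hpi (hmatch' _) hx', e]
    simpa using Bh.wronskian (π / 2)
  -- A full period consists of two pieces of length `π`.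
  · have hfl : ⌊(x + 2 * π - -(π / 2)) / π⌋ = ⌊(x - -(π / 2)) / π⌋ + 2 := by
      rw [← Int.floor_add_ofNat]
      congr 1
      field_simp
      ring
    have e : ∀ i, w i (x + 2 * π) = M i 0 * w 0 x + M i 1 * w 1 x := fun i => by
      simp only [hw, glue, hfl]
      obtain ⟨n, hn | hn⟩ := Int.even_or_odd' ⌊(x - -(π / 2)) / π⌋
      · rw [hn, show 2 * n + 2 = 2 * (n + 1) by ring]
        simp only [gluePiece_even, hP']
        push_cast
        rw [show x + 2 * π - (n + 1) * (2 * π) = x - n * (2 * π) by ring]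
        simp only [Matrix.mul_apply, Fin.sum_univ_two]
        ring
      · rw [hn, show 2 * n + 1 + 2 = 2 * (n + 1) + 1 by ring]
        simp only [gluePiece_odd, hP']
        push_cast
        rw [show x + 2 * π - (n + 1) * (2 * π) = x - n * (2 * π) by ring]
        simp only [Matrix.mul_apply, Fin.sum_univ_two]
        ring
    rw [e, e, e00, e01, e10, e11]
    exact ⟨rfl, rfl⟩

/-! ### The mass-aspect function of the glued metric -/

theorem eq_zero_of_isBigO {f : ℝ → ℝ} {A B R : ℝ} (hR : 0 < R)
    (hf : ∀ r, R < r → f r = A / r ^ 2 + B / r ^ 4)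
    (h : f =O[Filter.atTop] fun r : ℝ => 1 / r ^ 3) : A = 0 := by
  have h1 := (Asymptotics.isBigO_refl (fun r : ℝ => r ^ 2) Filter.atTop).mul h
  have h2 : Filter.Tendsto (fun r : ℝ => r ^ 2 * (1 / r ^ 3)) Filter.atTop (nhds 0) := by
    refine tendsto_inv_atTop_zero.congr' ?_
    filter_upwards [Filter.eventually_gt_atTop R] with r hr
    have : r ≠ 0 := (hR.trans hr).ne'
    field_simp
  have h3 := h1.trans_tendsto h2
  have h4 : Filter.Tendsto (fun r : ℝ => A + B * (r⁻¹) ^ 2) Filter.atTop (nhds (A + B * 0 ^ 2)) :=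
    ((tendsto_inv_atTop_zero.pow 2).const_mul B).const_add A
  have h5 : Filter.Tendsto (fun r : ℝ => r ^ 2 * f r) Filter.atTop (nhds (A + B * 0 ^ 2)) := by
    refine h4.congr' ?_
    filter_upwards [Filter.eventually_gt_atTop R] with r hr
    have : r ≠ 0 := (hR.trans hr).ne'
    rw [hf r hr]
    field_simp
  simpa using tendsto_nhds_unique h5 h3

/-- For the Fefferman–Graham form the `dr²` coefficient is exact, so `μ₂₂ = 0`, and `(r + ν/(4r))² /
r² = 1 + ν/(2r²) + ν²/(16r⁴)` gives `μ₁₁ = ν/2`. -/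
theorem HasMassAspect.eq_of_fgMetric {g : CollarMetric} {μ ν : ℝ → ℝ} {φ R : ℝ}
    (h : HasMassAspect g μ) (hR : 0 < R) (hg : ∀ r, R < r → g r φ = fgMetric ν r φ) :
    μ φ = ν φ := by
  obtain ⟨μ₁₁, μ₁₂, μ₂₂, hμ⟩ := h
  obtain ⟨e, h22, -, h11⟩ := hμ φ
  have z22 : -μ₂₂ φ = 0 := by
    refine eq_zero_of_isBigO (B := 0) hR (fun r hr => ?_) h22
    have : r ≠ 0 := (hR.trans hr).ne'
    rw [hg r hr]
    simp only [fgMetric, Matrix.of_apply, Matrix.cons_val', Matrix.cons_val_zero]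
    field_simp
    ring
  have z11 : ν φ / 2 - μ₁₁ φ = 0 := by
    refine eq_zero_of_isBigO (B := ν φ ^ 2 / 16) hR (fun r hr => ?_) h11
    have : r ≠ 0 := (hR.trans hr).ne'
    rw [hg r hr]
    simp only [fgMetric, Matrix.of_apply, Matrix.cons_val', Matrix.cons_val_one,
      Matrix.cons_val_fin_one]
    field_simp
    ring
  linarith

theorem eq_of_fgMetric_eq {ν₁ ν₂ : ℝ → ℝ} {φ R : ℝ} (hR : 0 < R)
    (h : ∀ r, R < r → fgMetric ν₁ r φ = fgMetric ν₂ r φ) : ν₁ φ = ν₂ φ := by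
  set r := R + 1 + |ν₁ φ| + |ν₂ φ| with hr
  have a1 := abs_nonneg (ν₁ φ)
  have a2 := abs_nonneg (ν₂ φ)
  have hr1 : 1 < r := by linarith
  have h1 := congrFun (congrFun (h r (by linarith)) 1) 1
  simp only [fgMetric, Matrix.of_apply, Matrix.cons_val', Matrix.cons_val_one,
    Matrix.cons_val_fin_one] at h1
  have h2 : (ν₁ φ - ν₂ φ) * (8 * r ^ 2 + ν₁ φ + ν₂ φ) = 0 := by
    have : r ≠ 0 := by linarith
    field_simp at h1
    linarith
  have h3 : 0 < 8 * r ^ 2 + ν₁ φ + ν₂ φ := by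
    nlinarith [neg_abs_le (ν₁ φ), neg_abs_le (ν₂ φ)]
  linarith [(mul_eq_zero.1 h2).resolve_right h3.ne']

/-- The mass-aspect function of a Maskit gluing is smooth, and is given on each half-circle by the
end which is kept there. -/
theorem IsMaskitGluing.massAspect {fc fh : ℝ → ℝ} {mc mh : ℝ} {g : CollarMetric} {μ : ℝ → ℝ}
    (hfc : IsCircleDiffeoLift fc) (hfh : IsCircleDiffeoLift fh)
    (hg : IsMaskitGluing (fgMetric (transformMassAspect fc fun _ => mc))
      (fgMetric (transformMassAspect fh fun _ => mh)) g) (h : HasMassAspect g μ) :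
    ContDiff ℝ ∞ μ ∧ (∀ x, μ (x + 2 * π) = μ x) ∧
    (∀ x ∈ Set.Icc (-(π / 2)) (π / 2), μ x = transformMassAspect fh (fun _ => mh) x) ∧
    ∀ x ∈ Set.Icc (π / 2) (3 * π / 2), μ x = transformMassAspect fc (fun _ => mc) x := by
  obtain ⟨R, hR, hg⟩ := hg
  have c1 : ∀ x ∈ Set.Icc (-(π / 2)) (π / 2), transformMassAspect fc (fun _ => mc) x = -1 :=
    fun x hx => eq_of_fgMetric_eq (ν₂ := fun _ => -1) hR fun r hr => (hg r hr).2.1 x hx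
  have h1 : ∀ x ∈ Set.Icc (π / 2) (3 * π / 2), transformMassAspect fh (fun _ => mh) x = -1 :=
    fun x hx => eq_of_fgMetric_eq (ν₂ := fun _ => -1) hR fun r hr => (hg r hr).2.2.1 x hx
  have m1 : ∀ x ∈ Set.Icc (-(π / 2)) (π / 2), μ x = transformMassAspect fh (fun _ => mh) x :=
    fun x hx => h.eq_of_fgMetric hR fun r hr => (hg r hr).2.2.2.1 x hx
  have m2 : ∀ x ∈ Set.Icc (π / 2) (3 * π / 2), μ x = transformMassAspect fc (fun _ => mc) x :=
    fun x hx => h.eq_of_fgMetric hR fun r hr => (hg r hr).2.2.2.2 x hx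
  -- On each half-circle the transformed aspect of the end cut off there is `-1`, so adding `1`
  -- leaves the other one. This sum is globally smooth and periodic, and so no regularity has to be
  -- checked at the seams.
  set ν : ℝ → ℝ := fun x => transformMassAspect fc (fun _ => mc) x +
    transformMassAspect fh (fun _ => mh) x + 1 with hν
  have hνper : Function.Periodic ν (2 * π) := fun x => by
    simp only [hν, hfc.transform_add_two_pi (μ := fun _ => mc) (fun _ => rfl),
      hfh.transform_add_two_pi (μ := fun _ => mh) (fun _ => rfl)]
  have hμν : μ = ν := by
    funext x
    refine h.eq_of_fgMetric hR fun r hr => ?_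
    have hp : Function.Periodic (fun x => g r x - fgMetric ν r x) (2 * π) := fun x => by
      simp only [(hg r hr).1, fgMetric, hνper x]
    obtain ⟨y, hy, hxy⟩ := hp.exists_mem_Ico Real.two_pi_pos x (-(π / 2))
    have : g r y - fgMetric ν r y = 0 := by
      rw [sub_eq_zero]
      rcases le_total y (π / 2) with hle | hle
      · rw [(hg r hr).2.2.2.1 y ⟨hy.1, hle⟩]
        simp only [fgMetric, hν, c1 y ⟨hy.1, hle⟩]
        ring_nf
      · have hy' : y ∈ Set.Icc (π / 2) (3 * π / 2) := ⟨hle, by linarith [hy.2]⟩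
        rw [(hg r hr).2.2.2.2 y hy']
        simp only [fgMetric, hν, h1 y hy']
        ring_nf
    exact sub_eq_zero.1 (hxy.trans this)
  refine ⟨?_, fun x => ?_, m1, m2⟩
  · rw [hμν]
    exact ((hfc.contDiff_transform mc).add (hfh.contDiff_transform mh)).add contDiff_const
  · rw [hμν]
    exact hνper x

/-! ### The prescribed maps -/

theorem boostFactor_sq {β : ℝ} (hβ : β ∈ Set.Ico (0 : ℝ) 1) :
    boostFactor β ^ 2 = (1 + β) / (1 - β) :=
  Real.sq_sqrt (div_nonneg (by linarith [hβ.1]) (by linarith [hβ.2]))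

theorem one_le_boostFactor {β : ℝ} (hβ : β ∈ Set.Ico (0 : ℝ) 1) : 1 ≤ boostFactor β := by
  rw [boostFactor, Real.one_le_sqrt, le_div_iff₀ (by linarith [hβ.2])]
  linarith [hβ.1]

theorem sqrt_one_sub_sq_eq {β : ℝ} (hβ : β ∈ Set.Ico (0 : ℝ) 1) :
    √(1 - β ^ 2) = (boostFactor β)⁻¹ * (1 + β) := by
  have h0 : 0 < boostFactor β := by linarith [one_le_boostFactor hβ]
  have h1 : 0 < 1 - β := by linarith [hβ.2]
  have h2 : 0 < 1 + β := by linarith [hβ.1]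
  rw [Real.sqrt_eq_iff_mul_self_eq_of_pos (by positivity)]
  have := boostFactor_sq hβ
  field_simp
  rw [this]
  field_simp
  ring

theorem cos_half_pos {x : ℝ} (hx : x ∈ Set.Icc (-(π / 2)) (π / 2)) : 0 < Real.cos (1 / 2 * x) :=
  Real.cos_pos_of_mem_Ioo ⟨by linarith [hx.1, Real.pi_pos], by linarith [hx.2, Real.pi_pos]⟩

/-- A boost acts on the circle at infinity by scaling the half-angle tangent, here by `κ⁻¹`. -/
theorem arcsin_boost {β x : ℝ} (hβ : β ∈ Set.Ico (0 : ℝ) 1)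
    (hx : x ∈ Set.Icc (-(π / 2)) (π / 2)) :
    Real.arcsin (√(1 - β ^ 2) * Real.sin x / (1 + β * Real.cos x)) =
      2 * Real.arctan ((boostFactor β)⁻¹ * Real.tan (1 / 2 * x)) := by
  have hpi := Real.pi_pos
  have hκ1 := one_le_boostFactor hβ
  have hκ2 := boostFactor_sq hβ
  have hs := sqrt_one_sub_sq_eq hβ
  set κ := boostFactor β
  have hκ : 0 < κ := by linarith
  have hc := cos_half_pos hx
  have h1 : Real.tan (1 / 2 * x) ≤ 1 := by
    refine le_of_le_of_eq ?_ Real.tan_pi_div_four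
    exact Real.strictMonoOn_tan.monotoneOn ⟨by linarith [hx.1], by linarith [hx.2]⟩
      ⟨by linarith, by linarith⟩ (by linarith [hx.2])
  have h2 : -1 ≤ Real.tan (1 / 2 * x) := by
    refine le_of_eq_of_le (show (-1 : ℝ) = Real.tan (-(π / 4)) by
      rw [Real.tan_neg, Real.tan_pi_div_four]) ?_
    exact Real.strictMonoOn_tan.monotoneOn ⟨by linarith, by linarith⟩
      ⟨by linarith [hx.1], by linarith [hx.2]⟩ (by linarith [hx.1])
  have hinv : κ⁻¹ ≤ 1 := inv_le_one_of_one_le₀ hκ1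
  have hinv0 : 0 < κ⁻¹ := inv_pos.2 hκ
  set T := κ⁻¹ * Real.tan (1 / 2 * x) with hT
  have hT1 : T ≤ 1 := by nlinarith
  have hT2 : -1 ≤ T := by nlinarith
  -- The bound `|T| ≤ 1` keeps `2 arctan T` in the range of `arcsin`; it uses `|x| ≤ π/2` and `κ ≥
  -- 1`.
  refine Real.arcsin_eq_of_sin_eq ?_ ⟨?_, ?_⟩
  · rw [Real.sin_two_mul, Real.sin_arctan, Real.cos_arctan]
    have e1 : 2 * (T / √(1 + T ^ 2)) * (1 / √(1 + T ^ 2)) = 2 * T / (1 + T ^ 2) := by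
      have : √(1 + T ^ 2) ^ 2 = 1 + T ^ 2 := Real.sq_sqrt (by positivity)
      rw [show 2 * (T / √(1 + T ^ 2)) * (1 / √(1 + T ^ 2)) = 2 * T / √(1 + T ^ 2) ^ 2 by ring, this]
    have ex : x = 2 * (1 / 2 * x) := by ring
    rw [e1, hs, hT, Real.tan_eq_sin_div_cos]
    rw [show Real.sin x = 2 * Real.sin (1 / 2 * x) * Real.cos (1 / 2 * x) by
      rw [← Real.sin_two_mul, ← ex]]
    rw [show Real.cos x = Real.cos (1 / 2 * x) ^ 2 - Real.sin (1 / 2 * x) ^ 2 by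
      rw [← Real.cos_two_mul', ← ex]]
    have hpyth := Real.sin_sq_add_cos_sq (1 / 2 * x)
    set s := Real.sin (1 / 2 * x)
    set c := Real.cos (1 / 2 * x)
    have hb1 : 0 < 1 - β := by linarith [hβ.2]
    have hb2 : 0 < 1 + β := by linarith [hβ.1]
    have hden : 1 + β * (c ^ 2 - s ^ 2) = (1 + β) * c ^ 2 + (1 - β) * s ^ 2 := by
      linear_combination -hpyth
    have hκ3 : κ ^ 2 * (1 - β) = 1 + β := by rw [hκ2]; field_simp
    rw [hden]
    have p1 : 0 < (1 + β) * c ^ 2 + (1 - β) * s ^ 2 := by positivity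
    have p2 : 0 < κ ^ 2 * c ^ 2 + s ^ 2 := by positivity
    field_simp
    linear_combination s ^ 3 * hκ3
  · have := Real.arctan_strictMono.monotone hT2
    rw [Real.arctan_neg, Real.arctan_one] at this
    linarith
  · have := Real.arctan_strictMono.monotone hT1
    rw [Real.arctan_one] at this
    linarith

theorem negCheckMap_eq {m β x : ℝ} (hβ : β ∈ Set.Ico (0 : ℝ) 1)
    (hx : x ∈ Set.Icc (-(π / 2)) (π / 2)) :
    negCheckMap m β x = 2 / √|m| * Real.arctan ((boostFactor β)⁻¹ * Real.tan (1 / 2 * x)) := by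
  rw [negCheckMap, arcsin_boost hβ hx]
  ring

theorem cuspCheckMap_eq {β x : ℝ} (hβ : β ∈ Set.Ico (0 : ℝ) 1)
    (hx : x ∈ Set.Icc (-(π / 2)) (π / 2)) :
    cuspCheckMap β x = (boostFactor β)⁻¹ * Real.tan (1 / 2 * x) := by
  rw [cuspCheckMap, arcsin_boost hβ hx, show ∀ y : ℝ, 1 / 2 * (2 * y) = y by intro y; ring,
    Real.tan_arctan]

/-- The hat boost is the check boost seen from the opposite half-circle, so one computation with a
shift `s` (either `0` or `π`) serves both. -/
theorem negHatMap_eq (m β x : ℝ) : negHatMap m β x = negCheckMap m β (x - π) := by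
  rw [negHatMap, negCheckMap, Real.sin_sub_pi, Real.cos_sub_pi, ← mul_neg, ← Real.arcsin_neg]
  congr 2
  ring

theorem cuspHatMap_eq (β x : ℝ) : cuspHatMap β x = cuspCheckMap β (x - π) := by
  rw [cuspHatMap, cuspCheckMap, Real.sin_sub_pi, Real.cos_sub_pi, ← Real.tan_neg, ← mul_neg,
    ← Real.arcsin_neg]
  congr 3
  ring

/-! ### Standard form of the solutions over the half-circles cut off -/

theorem hasDerivAt_tan_half {s x : ℝ} (hx : Real.cos (1 / 2 * (x - s)) ≠ 0) :
    HasDerivAt (fun y => Real.tan (1 / 2 * (y - s)))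
      (1 / (2 * Real.cos (1 / 2 * (x - s)) ^ 2)) x := by
  have h1 : HasDerivAt (fun y => 1 / 2 * (y - s)) (1 / 2) x := by
    exact (((hasDerivAt_id x).sub_const s).const_mul (1 / 2)).congr_deriv (by norm_num)
  refine ((Real.hasDerivAt_tan hx).comp x h1).congr_deriv ?_
  field_simp

/-- Over a half-circle where the map is a boost, the transformed solutions are those of the
hyperbolic plane: negative mass. -/
theorem IsCircleDiffeoLift.neg_standard {f : ℝ → ℝ} (hf : IsCircleDiffeoLift f) {k κ s p q : ℝ}
    (hk : 0 < k) (hκ : 0 < κ) (hpq : p < q) (hp : -(π / 2) ≤ p - s) (hq : q - s ≤ π / 2)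
    (h : Set.EqOn f (fun x => 2 / k * Real.arctan (κ⁻¹ * Real.tan (1 / 2 * (x - s))))
      (Set.Icc p q)) {x : ℝ} (hx : x ∈ Set.Icc p q) :
    √2 * √κ / √k * Real.sin (k / 2 * f x) / √(deriv f x) = √2 * Real.sin (1 / 2 * (x - s)) ∧
    √2 / (√κ * √k) * Real.cos (k / 2 * f x) / √(deriv f x) = √2 * Real.cos (1 / 2 * (x - s)) := by
  have hc := cos_half_pos (x := x - s) ⟨by linarith [hx.1], by linarith [hx.2]⟩
  have hd := deriv_eq_of_eqOn_Icc hpq (hf.hasDerivAt x).differentiableAt h hx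
    ((((hasDerivAt_tan_half hc.ne').const_mul κ⁻¹).arctan).const_mul (2 / k))
  rw [h hx]
  simp only
  rw [show ∀ y : ℝ, k / 2 * (2 / k * y) = y by intro y; field_simp, Real.sin_arctan,
    Real.cos_arctan, hd]
  set T := κ⁻¹ * Real.tan (1 / 2 * (x - s)) with hT
  set c := Real.cos (1 / 2 * (x - s))
  have hκ2 : √κ ^ 2 = κ := Real.sq_sqrt hκ.le
  have hk2 : √k ^ 2 = k := Real.sq_sqrt hk.le
  have ht2 : √(1 + T ^ 2) ^ 2 = 1 + T ^ 2 := Real.sq_sqrt (by positivity)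
  have r1 : 0 < √κ := Real.sqrt_pos.2 hκ
  have r2 : 0 < √k := Real.sqrt_pos.2 hk
  have r3 : 0 < √(1 + T ^ 2) := Real.sqrt_pos.2 (by positivity)
  have hTc : √κ ^ 2 * T * c = Real.sin (1 / 2 * (x - s)) := by
    rw [hκ2, hT, Real.tan_eq_sin_div_cos, mul_inv_cancel_left₀ hκ.ne', div_mul_cancel₀ _ hc.ne']
  have hsq : √(2 / k * (1 / (1 + T ^ 2) * (κ⁻¹ * (1 / (2 * c ^ 2))))) =
      1 / (√κ * √k * √(1 + T ^ 2) * c) := by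
    rw [Real.sqrt_eq_iff_mul_self_eq_of_pos (by positivity),
      show 1 / (√κ * √k * √(1 + T ^ 2) * c) * (1 / (√κ * √k * √(1 + T ^ 2) * c)) =
        1 / (√κ ^ 2 * √k ^ 2 * √(1 + T ^ 2) ^ 2 * c ^ 2) by ring, hκ2, hk2, ht2]
    field_simp
  rw [hsq]
  constructor
  · rw [← hTc]
    field_simp
  · field_simp

/-- Over a half-circle where the map is a boost, the transformed solutions are those of the
hyperbolic plane: cusp. -/
theorem IsCircleDiffeoLift.cusp_standard {f : ℝ → ℝ} (hf : IsCircleDiffeoLift f) {κ s p q : ℝ}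
    (hκ : 0 < κ) (hpq : p < q) (hp : -(π / 2) ≤ p - s) (hq : q - s ≤ π / 2)
    (h : Set.EqOn f (fun x => κ⁻¹ * Real.tan (1 / 2 * (x - s))) (Set.Icc p q)) {x : ℝ}
    (hx : x ∈ Set.Icc p q) :
    √κ * f x / √(deriv f x) = √2 * Real.sin (1 / 2 * (x - s)) ∧
    1 / √κ / √(deriv f x) = √2 * Real.cos (1 / 2 * (x - s)) := by
  have hc := cos_half_pos (x := x - s) ⟨by linarith [hx.1], by linarith [hx.2]⟩
  have hd := deriv_eq_of_eqOn_Icc hpq (hf.hasDerivAt x).differentiableAt h hx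
    ((hasDerivAt_tan_half hc.ne').const_mul κ⁻¹)
  rw [h hx, hd]
  simp only [Real.tan_eq_sin_div_cos]
  set c := Real.cos (1 / 2 * (x - s))
  have hκ2 : √κ ^ 2 = κ := Real.sq_sqrt hκ.le
  have h22 : √(2 : ℝ) ^ 2 = 2 := Real.sq_sqrt (by norm_num)
  have r1 : 0 < √κ := Real.sqrt_pos.2 hκ
  have r2 : 0 < √(2 : ℝ) := Real.sqrt_pos.2 (by norm_num)
  have hsq : √(κ⁻¹ * (1 / (2 * c ^ 2))) = 1 / (√κ * √2 * c) := by
    rw [Real.sqrt_eq_iff_mul_self_eq_of_pos (by positivity),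
      show 1 / (√κ * √2 * c) * (1 / (√κ * √2 * c)) = 1 / (√κ ^ 2 * √2 ^ 2 * c ^ 2) by ring, hκ2, h22]
    field_simp
  rw [hsq]
  constructor
  · nth_rewrite 2 [← hκ2]
    field_simp
  · field_simp

/-- Over the half-circle where the map is prescribed, the transformed solutions are those of the
hyperbolic plane: positive mass. -/
theorem IsCircleDiffeoLift.pos_standard {f : ℝ → ℝ} (hf : IsCircleDiffeoLift f) {k t : ℝ}
    (hk : 0 < k) (ht : 1 < t)
    (h : Set.EqOn f (fun x => -(1 / k * Real.log (Real.cot (x / 2) + t)))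
      (Set.Icc (π / 2) (3 * π / 2))) {x : ℝ} (hx : x ∈ Set.Icc (π / 2) (3 * π / 2)) :
    1 / √k * Real.exp (k / 2 * f x) / √(deriv f x) = √2 * Real.sin (1 / 2 * x) ∧
    1 / √k * Real.exp (-k / 2 * f x) / √(deriv f x) =
      √2 * Real.cos (1 / 2 * x) + t * (√2 * Real.sin (1 / 2 * x)) := by
  have hpi := Real.pi_pos
  have hx' : x - π ∈ Set.Icc (-(π / 2)) (π / 2) := ⟨by linarith [hx.1], by linarith [hx.2]⟩
  have hs : 0 < Real.sin (x / 2) :=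
    Real.sin_pos_of_pos_of_lt_pi (by linarith [hx.1]) (by linarith [hx.2])
  -- On this half-circle `cot (x/2) ≥ -1`, so `t > 1` makes the argument of the logarithm positive.
  have hcs : -Real.sin (x / 2) ≤ Real.cos (x / 2) := by
    have h1 : Real.cos (3 * π / 4) ≤ Real.cos (x / 2) :=
      Real.cos_le_cos_of_nonneg_of_le_pi (by linarith [hx.1]) (by linarith) (by linarith [hx.2])
    have h2 : 0 ≤ Real.sin (x / 2 + π / 4) :=
      Real.sin_nonneg_of_nonneg_of_le_pi (by linarith [hx.1]) (by linarith [hx.2])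
    rw [Real.sin_add, Real.sin_pi_div_four, Real.cos_pi_div_four] at h2
    have h3 : 0 < √(2 : ℝ) := Real.sqrt_pos.2 (by norm_num)
    by_contra! hlt
    nlinarith
  have hder : HasDerivAt (fun x => Real.cot (x / 2) + t) (-(1 / (2 * Real.sin (x / 2) ^ 2))) x := by
    have h1 : HasDerivAt (fun y : ℝ => y / 2) (1 / 2) x := (hasDerivAt_id x).div_const 2
    have h2 := ((h1.cos).div (h1.sin) hs.ne').add_const t
    have e : (fun x => Real.cot (x / 2) + t) =
        fun x => ((fun y : ℝ => Real.cos (y / 2)) / fun y : ℝ => Real.sin (y / 2)) x + t := by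
      funext y
      rw [Real.cot_eq_cos_div_sin]
      rfl
    rw [e]
    refine h2.congr_deriv ?_
    field_simp
    linear_combination -(Real.sin_sq_add_cos_sq (x / 2))
  have hcot : Real.cot (x / 2) = Real.cos (x / 2) / Real.sin (x / 2) := Real.cot_eq_cos_div_sin _
  have hy : 0 < Real.cot (x / 2) + t := by
    have : -1 ≤ Real.cos (x / 2) / Real.sin (x / 2) := by
      rw [le_div_iff₀ hs]
      linarith
    rw [hcot]
    linarith
  have hd := deriv_eq_of_eqOn_Icc (by linarith) (hf.hasDerivAt x).differentiableAt h hx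
    (((hder.log hy.ne').const_mul (1 / k)).neg)
  have hfx := h hx
  simp only at hfx
  set y := Real.cot (x / 2) + t with hydef
  have e1 : Real.exp (-k / 2 * f x) = √y := by
    rw [hfx, Real.sqrt_eq_rpow, Real.rpow_def_of_pos hy]
    congr 1
    field_simp
  have e2 : Real.exp (k / 2 * f x) = 1 / √y := by
    rw [← e1, one_div, ← Real.exp_neg]
    congr 1
    ring
  have r1 : 0 < √y := Real.sqrt_pos.2 hy
  have r2 : 0 < √(2 : ℝ) := Real.sqrt_pos.2 (by norm_num)
  have r3 : 0 < √k := Real.sqrt_pos.2 hk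
  have q1 : √y ^ 2 = y := Real.sq_sqrt hy.le
  have q2 : √(2 : ℝ) ^ 2 = 2 := Real.sq_sqrt (by norm_num)
  have q3 : √k ^ 2 = k := Real.sq_sqrt hk.le
  have hsq : √(deriv f x) = 1 / (√k * √2 * Real.sin (x / 2) * √y) := by
    rw [Real.sqrt_eq_iff_mul_self_eq_of_pos (by positivity), hd]
    rw [show 1 / (√k * √2 * Real.sin (x / 2) * √y) * (1 / (√k * √2 * Real.sin (x / 2) * √y)) =
      1 / (√k ^ 2 * √2 ^ 2 * Real.sin (x / 2) ^ 2 * √y ^ 2) by field_simp, q1, q2, q3]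
    field_simp
  rw [e1, e2, hsq, show 1 / 2 * x = x / 2 by ring]
  constructor
  · field_simp
  · have : √y ^ 2 * Real.sin (x / 2) = Real.cos (x / 2) + t * Real.sin (x / 2) := by
      rw [q1, hydef, hcot]
      field_simp
    field_simp
    linear_combination this

/-! ### Bases of solutions for the ends -/

theorem HasMonodromyEntries.congr {u v : ℝ → ℝ} {a b c d a' b' c' d' : ℝ}
    (h : HasMonodromyEntries u v a b c d) (ha : a = a') (hb : b = b') (hc : c = c')
    (hd : d = d') : HasMonodromyEntries u v a' b' c' d' := by
  subst ha hb hc hd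
  exact h

/-- The shift by `π` in the hat maps turns `sin (x/2)` into `-cos (x/2)` and `cos (x/2)` into `sin
(x/2)`; passing to `(v, -u)` restores the standard pair. -/
theorem IsHillBasis.rotate {μ u v : ℝ → ℝ} (h : IsHillBasis μ u v) :
    IsHillBasis μ v (fun x => -u x) := by
  have hu : IsHillSolution μ fun x => -u x := by simpa using h.left.linear_comb h.left (-1) 0
  refine ⟨h.right, hu, fun x => ?_⟩
  rw [(h.left.hasDerivAt x).fun_neg.deriv]
  linear_combination h.wronskian x

theorem HasMonodromyEntries.rotate {u v : ℝ → ℝ} {a b c d : ℝ}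
    (h : HasMonodromyEntries u v a b c d) :
    HasMonodromyEntries v (fun x => -u x) d (-c) (-b) a := fun x =>
  ⟨by rw [(h x).2]; ring, by simp only [(h x).1]; ring⟩

/-- For positive mass the second exponential is `√2 cos (x/2) + t √2 sin (x/2)` over the half-circle
cut off; the shear removes the sine. -/
theorem IsHillBasis.shear {μ u v : ℝ → ℝ} (h : IsHillBasis μ u v) (t : ℝ) :
    IsHillBasis μ u (fun x => v x - t * u x) := by
  have hv : IsHillSolution μ fun x => v x - t * u x := by
    convert h.right.linear_comb h.left 1 (-t) using 2
    ring
  refine ⟨h.left, hv, fun x => ?_⟩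
  rw [((h.right.hasDerivAt x).fun_sub ((h.left.hasDerivAt x).const_mul t)).deriv]
  linear_combination h.wronskian x

theorem HasMonodromyEntries.shear {u v : ℝ → ℝ} {a d : ℝ}
    (h : HasMonodromyEntries u v a 0 0 d) (t : ℝ) :
    HasMonodromyEntries u (fun x => v x - t * u x) a 0 (t * (d - a)) d := fun x =>
  ⟨by rw [(h x).1]; ring, by simp only [(h x).1, (h x).2]; ring⟩

/-- First solution for an end of mass `-k²`, normalised with the boost factor `κ`. -/
def negU (f : ℝ → ℝ) (k κ x : ℝ) : ℝ := √2 * √κ / √k * Real.sin (k / 2 * f x) / √(deriv f x)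

/-- Second solution for an end of mass `-k²`, normalised with the boost factor `κ`. -/
def negV (f : ℝ → ℝ) (k κ x : ℝ) : ℝ := √2 / (√κ * √k) * Real.cos (k / 2 * f x) / √(deriv f x)

theorem IsCircleDiffeoLift.neg_end {f : ℝ → ℝ} (hf : IsCircleDiffeoLift f) {m κ : ℝ} (hm : m < 0)
    (hκ : 0 < κ) :
    IsHillBasis (transformMassAspect f fun _ => m) (negU f √|m| κ) (negV f √|m| κ) ∧
    HasMonodromyEntries (negU f √|m| κ) (negV f √|m| κ) (Real.cos (√|m| * π))
      (κ * Real.sin (√|m| * π)) (-(κ⁻¹ * Real.sin (√|m| * π))) (Real.cos (√|m| * π)) := by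
  have hk : 0 < √|m| := Real.sqrt_pos.2 (abs_pos.2 hm.ne)
  have hk2 : m = -√|m| ^ 2 := by rw [Real.sq_sqrt (abs_nonneg m), abs_of_neg hm]; ring
  set k := √|m|
  have r1 : 0 < √κ := Real.sqrt_pos.2 hκ
  have r2 : 0 < √k := Real.sqrt_pos.2 hk
  have r3 : 0 < √(2 : ℝ) := Real.sqrt_pos.2 (by norm_num)
  have q1 : √κ ^ 2 = κ := Real.sq_sqrt hκ.le
  have q2 : √k ^ 2 = k := Real.sq_sqrt hk.le
  have q3 : √(2 : ℝ) ^ 2 = 2 := Real.sq_sqrt (by norm_num)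
  have h : √2 * √κ / √k * (√2 / (√κ * √k)) * k = 2 := by
    rw [show √2 * √κ / √k * (√2 / (√κ * √k)) = √2 ^ 2 / √k ^ 2 by field_simp, q2, q3]
    field_simp
  have e1 : √2 * √κ / √k / (√2 / (√κ * √k)) = κ := by
    rw [show √2 * √κ / √k / (√2 / (√κ * √k)) = √κ ^ 2 by field_simp, q1]
  have e2 : √2 / (√κ * √k) / (√2 * √κ / √k) = κ⁻¹ := by
    rw [← inv_div, e1]
  obtain ⟨h1, h2⟩ := hf.neg_basis hk2 h
  exact ⟨h1, h2.congr rfl (by rw [e1]) (by rw [e2]) rfl⟩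

/-- First solution for a cusp, normalised with the boost factor `κ`. -/
def cuspU (f : ℝ → ℝ) (κ x : ℝ) : ℝ := √κ * f x / √(deriv f x)

/-- Second solution for a cusp, normalised with the boost factor `κ`. -/
def cuspV (f : ℝ → ℝ) (κ x : ℝ) : ℝ := 1 / √κ / √(deriv f x)

theorem IsCircleDiffeoLift.cusp_end {f : ℝ → ℝ} (hf : IsCircleDiffeoLift f) {κ : ℝ} (hκ : 0 < κ) :
    IsHillBasis (transformMassAspect f fun _ => 0) (cuspU f κ) (cuspV f κ) ∧
    HasMonodromyEntries (cuspU f κ) (cuspV f κ) 1 (2 * π * κ) 0 1 := by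
  have r1 : 0 < √κ := Real.sqrt_pos.2 hκ
  obtain ⟨h1, h2⟩ := hf.zero_basis (α := √κ) (β := 1 / √κ) (by field_simp)
  exact ⟨h1, h2.congr rfl (by rw [Real.sq_sqrt hκ.le]) rfl rfl⟩

theorem sin_half_sub_pi (x : ℝ) : Real.sin (1 / 2 * (x - π)) = -Real.cos (1 / 2 * x) := by
  rw [show 1 / 2 * (x - π) = 1 / 2 * x - π / 2 by ring, Real.sin_sub_pi_div_two]

theorem cos_half_sub_pi (x : ℝ) : Real.cos (1 / 2 * (x - π)) = Real.sin (1 / 2 * x) := by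
  rw [show 1 / 2 * (x - π) = 1 / 2 * x - π / 2 by ring, Real.cos_sub_pi_div_two]

theorem IsCircleDiffeoLift.neg_check_standard {f : ℝ → ℝ} (hf : IsCircleDiffeoLift f) {m β : ℝ}
    (hm : m < 0) (hβ : β ∈ Set.Ico (0 : ℝ) 1)
    (h : Set.EqOn f (negCheckMap m β) (Set.Icc (-(π / 2)) (π / 2))) :
    Set.EqOn (negU f √|m| (boostFactor β)) (fun x => √2 * Real.sin (1 / 2 * x))
      (Set.Icc (-(π / 2)) (π / 2)) ∧
    Set.EqOn (negV f √|m| (boostFactor β)) (fun x => √2 * Real.cos (1 / 2 * x))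
      (Set.Icc (-(π / 2)) (π / 2)) := by
  have hpi := Real.pi_pos
  have hk : 0 < √|m| := Real.sqrt_pos.2 (abs_pos.2 hm.ne)
  have hκ : 0 < boostFactor β := by linarith [one_le_boostFactor hβ]
  have key := fun (x : ℝ) (hx : x ∈ Set.Icc (-(π / 2)) (π / 2)) =>
    hf.neg_standard (s := 0) hk hκ (show -(π / 2) < π / 2 by linarith) (by linarith) (by linarith)
      (fun y hy => by rw [h hy, negCheckMap_eq hβ hy]; simp only [sub_zero]) hx
  simp only [sub_zero] at key
  exact ⟨fun x hx => (key x hx).1, fun x hx => (key x hx).2⟩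

theorem IsCircleDiffeoLift.neg_hat_standard {f : ℝ → ℝ} (hf : IsCircleDiffeoLift f) {m β : ℝ}
    (hm : m < 0) (hβ : β ∈ Set.Ico (0 : ℝ) 1)
    (h : Set.EqOn f (negHatMap m β) (Set.Icc (π / 2) (3 * π / 2))) :
    Set.EqOn (negV f √|m| (boostFactor β)) (fun x => √2 * Real.sin (1 / 2 * x))
      (Set.Icc (π / 2) (3 * π / 2)) ∧
    Set.EqOn (fun x => -negU f √|m| (boostFactor β) x) (fun x => √2 * Real.cos (1 / 2 * x))
      (Set.Icc (π / 2) (3 * π / 2)) := by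
  have hpi := Real.pi_pos
  have hk : 0 < √|m| := Real.sqrt_pos.2 (abs_pos.2 hm.ne)
  have hκ : 0 < boostFactor β := by linarith [one_le_boostFactor hβ]
  have key := fun (x : ℝ) (hx : x ∈ Set.Icc (π / 2) (3 * π / 2)) =>
    hf.neg_standard (s := π) hk hκ (show π / 2 < 3 * π / 2 by linarith) (by linarith) (by linarith)
      (fun y hy => by
        rw [h hy, negHatMap_eq, negCheckMap_eq hβ ⟨by linarith [hy.1], by linarith [hy.2]⟩]) hx
  simp only [sin_half_sub_pi, cos_half_sub_pi] at key
  refine ⟨fun x hx => (key x hx).2, fun x hx => ?_⟩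
  have := (key x hx).1
  simp only [negU]
  rw [this]
  ring

theorem IsCircleDiffeoLift.cusp_check_standard {f : ℝ → ℝ} (hf : IsCircleDiffeoLift f) {β : ℝ}
    (hβ : β ∈ Set.Ico (0 : ℝ) 1)
    (h : Set.EqOn f (cuspCheckMap β) (Set.Icc (-(π / 2)) (π / 2))) :
    Set.EqOn (cuspU f (boostFactor β)) (fun x => √2 * Real.sin (1 / 2 * x))
      (Set.Icc (-(π / 2)) (π / 2)) ∧
    Set.EqOn (cuspV f (boostFactor β)) (fun x => √2 * Real.cos (1 / 2 * x))
      (Set.Icc (-(π / 2)) (π / 2)) := by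
  have hpi := Real.pi_pos
  have hκ : 0 < boostFactor β := by linarith [one_le_boostFactor hβ]
  have key := fun (x : ℝ) (hx : x ∈ Set.Icc (-(π / 2)) (π / 2)) =>
    hf.cusp_standard (s := 0) hκ (show -(π / 2) < π / 2 by linarith) (by linarith) (by linarith)
      (fun y hy => by rw [h hy, cuspCheckMap_eq hβ hy]; simp only [sub_zero]) hx
  simp only [sub_zero] at key
  exact ⟨fun x hx => (key x hx).1, fun x hx => (key x hx).2⟩

theorem IsCircleDiffeoLift.cusp_hat_standard {f : ℝ → ℝ} (hf : IsCircleDiffeoLift f) {β : ℝ}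
    (hβ : β ∈ Set.Ico (0 : ℝ) 1)
    (h : Set.EqOn f (cuspHatMap β) (Set.Icc (π / 2) (3 * π / 2))) :
    Set.EqOn (cuspV f (boostFactor β)) (fun x => √2 * Real.sin (1 / 2 * x))
      (Set.Icc (π / 2) (3 * π / 2)) ∧
    Set.EqOn (fun x => -cuspU f (boostFactor β) x) (fun x => √2 * Real.cos (1 / 2 * x))
      (Set.Icc (π / 2) (3 * π / 2)) := by
  have hpi := Real.pi_pos
  have hκ : 0 < boostFactor β := by linarith [one_le_boostFactor hβ]
  have key := fun (x : ℝ) (hx : x ∈ Set.Icc (π / 2) (3 * π / 2)) =>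
    hf.cusp_standard (s := π) hκ (show π / 2 < 3 * π / 2 by linarith) (by linarith) (by linarith)
      (fun y hy => by
        rw [h hy, cuspHatMap_eq, cuspCheckMap_eq hβ ⟨by linarith [hy.1], by linarith [hy.2]⟩]) hx
  simp only [sin_half_sub_pi, cos_half_sub_pi] at key
  refine ⟨fun x hx => (key x hx).2, fun x hx => ?_⟩
  have := (key x hx).1
  simp only [cuspU]
  rw [this]
  ring

/-! ### Matrices of determinant one -/

theorem isSLConjugate_of_mul_eq {M N A : Matrix (Fin 2) (Fin 2) ℝ} (hA : A.det = 1)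
    (h : M * A = A * N) : IsSLConjugate M N := by
  refine ⟨A, hA, ?_⟩
  rw [Matrix.mul_assoc, h, ← Matrix.mul_assoc, Matrix.nonsing_inv_mul A (by rw [hA]; exact isUnit_one),
    Matrix.one_mul]

theorem exists_sign {c : ℝ} (hc : c ≠ 0) :
    Real.sign c ^ 2 = 1 ∧ √|c| ^ 2 * Real.sign c = c ∧ 0 < √|c| := by
  have h0 : 0 < √|c| := Real.sqrt_pos.2 (abs_pos.2 hc)
  rw [Real.sq_sqrt (abs_nonneg c)]
  rcases lt_or_gt_of_ne hc with h | h
  · rw [Real.sign_of_neg h, abs_of_neg h]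
    exact ⟨by norm_num, by ring, by rwa [abs_of_neg h] at h0⟩
  · rw [Real.sign_of_pos h, abs_of_pos h]
    exact ⟨by norm_num, by ring, by rwa [abs_of_pos h] at h0⟩

/-- By Cayley–Hamilton `(M - t)² = 0`, so the column `(a - t, c)` of `M - t` is an eigenvector. The
sign of `c` survives because a real conjugation of determinant one rescales it only by squares. -/
theorem isSLConjugate_of_lower_ne_zero {M : Matrix (Fin 2) (Fin 2) ℝ} {t : ℝ}
    (hdet : M 0 0 * M 1 1 - M 0 1 * M 1 0 = 1) (ht : M 0 0 + M 1 1 = 2 * t) (ht2 : t ^ 2 = 1)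
    (hc : M 1 0 ≠ 0) : IsSLConjugate M (t • !![1, -t * Real.sign (M 1 0); 0, 1]) := by
  obtain ⟨h1, h2, h3⟩ := exists_sign hc
  rw [Matrix.eta_fin_two M]
  simp only [Matrix.of_apply, Matrix.cons_val', Matrix.cons_val_zero, Matrix.cons_val_one,
    Matrix.cons_val_fin_one]
  set a := M 0 0
  set b := M 0 1
  set c := M 1 0
  set d := M 1 1
  set σ := Real.sign c
  set y := √|c|
  -- The columns of `A` are multiples of `(M - t) e₁` and `e₁`, scaled so that `det A = 1` and `M -
  -- t` sends the second column to `-σ` times the first.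
  refine isSLConjugate_of_mul_eq (A := !![-(σ * (a - t) / y), 1 / y; -(σ * c / y), 0]) ?_ ?_
  · rw [Matrix.det_fin_two_of]
    field_simp
    linear_combination (-σ) * h2 + y ^ 2 * h1
  · ext i j
    fin_cases i <;> fin_cases j <;> simp [Matrix.mul_apply, Fin.sum_univ_two] <;> field_simp
    · linear_combination σ * (hdet - a * ht - ht2)
    · linear_combination (-(a - t) * t ^ 2) * h1 - (a - t) * ht2
    · linear_combination (-σ) * ht
    · linear_combination (-t ^ 2) * h1 - ht2

theorem isSLConjugate_of_lower_eq_zero {M : Matrix (Fin 2) (Fin 2) ℝ} {t : ℝ}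
    (hdet : M 0 0 * M 1 1 - M 0 1 * M 1 0 = 1) (ht : M 0 0 + M 1 1 = 2 * t) (ht2 : t ^ 2 = 1)
    (hc : M 1 0 = 0) (hb : M 0 1 ≠ 0) :
    IsSLConjugate M (t • !![1, t * Real.sign (M 0 1); 0, 1]) := by
  obtain ⟨h1, h2, h3⟩ := exists_sign hb
  rw [hc] at hdet
  have ha : M 0 0 = t := by
    have : (M 0 0 - t) ^ 2 = 0 := by linear_combination M 0 0 * ht - hdet + ht2
    linarith [pow_eq_zero_iff (two_ne_zero) |>.1 this]
  have hd : M 1 1 = t := by linarith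
  rw [Matrix.eta_fin_two M]
  simp only [Matrix.of_apply, Matrix.cons_val', Matrix.cons_val_zero, Matrix.cons_val_one,
    Matrix.cons_val_fin_one]
  rw [ha, hd, hc]
  set b := M 0 1
  set σ := Real.sign b
  set y := √|b|
  refine isSLConjugate_of_mul_eq (A := !![y, 0; 0, 1 / y]) ?_ ?_
  · rw [Matrix.det_fin_two_of]
    field_simp
    ring
  · ext i j
    fin_cases i <;> fin_cases j <;> simp [Matrix.mul_apply, Fin.sum_univ_two]
    · ring
    · field_simp
      linear_combination (-t ^ 2) * h2 - b * ht2
    · ring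

theorem lower_eq_zero_imp_upper_ne_zero {M : Matrix (Fin 2) (Fin 2) ℝ} {t : ℝ}
    (hdet : M 0 0 * M 1 1 - M 0 1 * M 1 0 = 1) (ht : M 0 0 + M 1 1 = 2 * t) (ht2 : t ^ 2 = 1)
    (h1 : M ≠ 1) (h2 : M ≠ -1) (hc : M 1 0 = 0) : M 0 1 ≠ 0 := by
  intro hb
  rw [hc] at hdet
  have ha : M 0 0 = t := by
    have : (M 0 0 - t) ^ 2 = 0 := by linear_combination M 0 0 * ht - hdet + ht2
    linarith [pow_eq_zero_iff (two_ne_zero) |>.1 this]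
  have hd : M 1 1 = t := by linarith
  rcases mul_self_eq_one_iff.1 (show t * t = 1 by linarith [sq t]) with rfl | rfl
  · apply h1
    ext i j
    fin_cases i <;> fin_cases j <;> simp [ha, hb, hc, hd]
  · apply h2
    ext i j
    fin_cases i <;> fin_cases j <;> simp [ha, hb, hc, hd]

theorem isSLConjugate_of_parabolic {M : Matrix (Fin 2) (Fin 2) ℝ} {t : ℝ}
    (hdet : M 0 0 * M 1 1 - M 0 1 * M 1 0 = 1) (ht : M.trace / 2 = t) (hM : IsParabolicMatrix M) :
    (M 1 0 ≠ 0 → IsSLConjugate M (t • !![1, -t * Real.sign (M 1 0); 0, 1])) ∧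
    (M 1 0 = 0 → IsSLConjugate M (t • !![1, t * Real.sign (M 0 1); 0, 1])) := by
  obtain ⟨htr, h1, h2⟩ := hM
  have ht' : M 0 0 + M 1 1 = 2 * t := by
    rw [← ht, Matrix.trace_fin_two]
    ring
  have ht2 : t ^ 2 = 1 := by
    have : M.trace ^ 2 = 4 := by
      rw [← sq_abs, htr]
      norm_num
    rw [← ht]
    linear_combination this / 4
  exact ⟨isSLConjugate_of_lower_ne_zero hdet ht' ht2, fun hc =>
    isSLConjugate_of_lower_eq_zero hdet ht' ht2 hc
      (lower_eq_zero_imp_upper_ne_zero hdet ht' ht2 h1 h2 hc)⟩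

theorem IsHillBasis.isMonodromy_matrix {μ u v : ℝ → ℝ} (h : IsHillBasis μ u v)
    {M : Matrix (Fin 2) (Fin 2) ℝ}
    (hM : HasMonodromyEntries u v (M 0 0) (M 0 1) (M 1 0) (M 1 1)) : IsMonodromy μ M := by
  rw [Matrix.eta_fin_two M]
  exact h.isMonodromy hM

theorem IsMonodromy.det_entries {μ : ℝ → ℝ} {M : Matrix (Fin 2) (Fin 2) ℝ} (h : IsMonodromy μ M) :
    M 0 0 * M 1 1 - M 0 1 * M 1 0 = 1 := by
  obtain ⟨u, v, h1, h2⟩ := h.exists_basis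
  exact h2.det_eq_one h1

/-- A smooth mass-aspect function with elliptic monodromy has a negative mass parameter. -/
theorem IsMonodromy.massParameter_of_elliptic {μ : ℝ → ℝ} {M : Matrix (Fin 2) (Fin 2) ℝ}
    (hμ : ContDiff ℝ ∞ μ) (h : IsMonodromy μ M) (hM : IsEllipticMatrix M) :
    ∃ m : ℝ, HasMassParameter μ m ∧ IsRootByZeroCounting μ (M.trace / 2) m := by
  obtain ⟨u, v, h1, h2⟩ := h.exists_basis
  rw [Matrix.trace_fin_two]
  rcases hM with rfl | rfl | hM
  · exact HasMonodromyEntries.massParameter_of_rotation hμ h1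
      (h2.congr rfl rfl (by simp) (by simp)) (b := 0) |>.imp fun m hm => by simpa using hm
  · exact HasMonodromyEntries.massParameter_of_rotation hμ h1 (a := -1) (b := 0)
      (h2.congr (by simp) (by simp) (by simp) (by simp)) |>.imp fun m hm => by simpa using hm
  · rw [Matrix.trace_fin_two] at hM
    exact h2.massParameter_of_elliptic hμ h1 hM

/-! ### Negativity of the invariant quadratic form -/

theorem convex_quadratic_neg {A B C y y₀ y₁ : ℝ} (hA : 0 ≤ A) (h0 : y₀ ≤ y) (h1 : y ≤ y₁)
    (e0 : A * y₀ ^ 2 + B * y₀ + C < 0) (e1 : A * y₁ ^ 2 + B * y₁ + C < 0) :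
    A * y ^ 2 + B * y + C < 0 := by
  rcases h0.eq_or_lt with rfl | h0
  · exact e0
  have h2 : 0 < y₁ - y₀ := by linarith
  have e : (y₁ - y₀) * (A * y ^ 2 + B * y + C) = (y₁ - y) * (A * y₀ ^ 2 + B * y₀ + C) +
      (y - y₀) * (A * y₁ ^ 2 + B * y₁ + C) - A * ((y₁ - y₀) * ((y - y₀) * (y₁ - y))) := by ring
  have i1 : (y₁ - y) * (A * y₀ ^ 2 + B * y₀ + C) ≤ 0 :=
    mul_nonpos_of_nonneg_of_nonpos (by linarith) e0.le
  have i2 : (y - y₀) * (A * y₁ ^ 2 + B * y₁ + C) < 0 := mul_neg_of_pos_of_neg (by linarith) e1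
  have i3 : 0 ≤ A * ((y₁ - y₀) * ((y - y₀) * (y₁ - y))) :=
    mul_nonneg hA (mul_nonneg h2.le (mul_nonneg (by linarith) (by linarith)))
  by_contra! h
  have := mul_nonneg h2.le h
  linarith

theorem neg_on_Icc_of_convex {Q w y : ℝ → ℝ} {A B C p q : ℝ} (hA : 0 ≤ A) (hw : ∀ x, 0 < w x)
    (hy : Monotone y) (e : ∀ x ∈ Set.Icc p q, Q x * w x = A * y x ^ 2 + B * y x + C)
    (hp : Q p < 0) (hq : Q q < 0) {x : ℝ} (hx : x ∈ Set.Icc p q) : Q x < 0 := by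
  have hpq : p ≤ q := hx.1.trans hx.2
  have h := convex_quadratic_neg (B := B) (C := C) hA (hy hx.1) (hy hx.2)
    (by rw [← e p ⟨le_rfl, hpq⟩]; exact mul_neg_of_neg_of_pos hp (hw p))
    (by rw [← e q ⟨hpq, le_rfl⟩]; exact mul_neg_of_neg_of_pos hq (hw q))
  rw [← e x hx] at h
  by_contra! h0
  exact absurd (mul_nonneg h0 (hw x).le) (not_le.2 h)

theorem sqrt_two_mul_sin_cos_pi_div_two : √2 * Real.sin (1 / 2 * (π / 2)) = 1 ∧
    √2 * Real.cos (1 / 2 * (π / 2)) = 1 := by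
  have h : √(2 : ℝ) * (√2 / 2) = 1 := by
    rw [← mul_div_assoc, Real.mul_self_sqrt (by norm_num)]
    norm_num
  rw [show 1 / 2 * (π / 2) = π / 4 by ring, Real.sin_pi_div_four, Real.cos_pi_div_four]
  exact ⟨h, h⟩

/-- Hyperbolicity of the glued monodromy without zeros, when one of the ends is a cusp. -/
theorem HasMonodromyEntries.massParameter_of_cusp {μ u v w y f : ℝ → ℝ} {a b c d κ A B C : ℝ}
    (hμ : ContDiff ℝ ∞ μ) (h : IsHillBasis μ u v) (hM : HasMonodromyEntries u v a b c d)
    (hf : IsCircleDiffeoLift f) (hκ : 0 < κ)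
    (hc : ∀ x ∈ Set.Icc (π / 2) (3 * π / 2), u x = cuspU f κ x ∧ v x = cuspV f κ x)
    (hstd : Set.EqOn (cuspU f κ) (fun x => √2 * Real.sin (1 / 2 * x)) (Set.Icc (-(π / 2)) (π / 2)) ∧
      Set.EqOn (cuspV f κ) (fun x => √2 * Real.cos (1 / 2 * x)) (Set.Icc (-(π / 2)) (π / 2)))
    (hA : 0 ≤ A) (hw : ∀ x, 0 < w x) (hy : Monotone y)
    (e : ∀ x ∈ Set.Icc (-(π / 2)) (π / 2),
      (c * u x ^ 2 + (d - a) * (u x * v x) + (-b) * v x ^ 2) * w x = A * y x ^ 2 + B * y x + C)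
    (htr : 2 < a + d) (hc0 : 0 ≤ c) (h1 : c + (d - a) - b < 0)
    (h2 : c * (2 * π * κ - 1) ^ 2 + (d - a) * (2 * π * κ - 1) - b < 0) :
    ∃ m : ℝ, 0 < m ∧ HasMassParameter μ m ∧ Real.cosh (√m * π) = (a + d) / 2 := by
  have hpi := Real.pi_pos
  have hdet := hM.det_eq_one h
  set Q : ℝ → ℝ := fun x => c * u x ^ 2 + (d - a) * (u x * v x) + (-b) * v x ^ 2 with hQ
  have hper : Function.Periodic Q (2 * π) := fun x => by
    have := hM.form_periodic hdet 1 x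
    simpa only [one_mul] using this
  obtain ⟨s1, s2⟩ := sqrt_two_mul_sin_cos_pi_div_two
  have hq1 : Q (π / 2) < 0 := by
    have m1 : π / 2 ∈ Set.Icc (-(π / 2)) (π / 2) := ⟨by linarith, le_rfl⟩
    have m2 : π / 2 ∈ Set.Icc (π / 2) (3 * π / 2) := ⟨le_rfl, by linarith⟩
    simp only [hQ]
    rw [(hc _ m2).1, (hc _ m2).2, hstd.1 m1, hstd.2 m1]
    simp only [s1, s2]
    linarith
  -- At `-π/2` the standard pair is `(-1, 1)`; the cusp monodromy carries it to `(2πκ - 1, 1)`,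
  -- whence the hypothesis `h2`. At `π/2` the pair is `(1, 1)`.
  have hq2 : Q (3 * π / 2) < 0 := by
    have m1 : -(π / 2) ∈ Set.Icc (-(π / 2)) (π / 2) := ⟨le_rfl, by linarith⟩
    have m2 : 3 * π / 2 ∈ Set.Icc (π / 2) (3 * π / 2) := ⟨by linarith, le_rfl⟩
    have h3 := (hf.cusp_end hκ).2 (-(π / 2))
    rw [show -(π / 2) + 2 * π = 3 * π / 2 by ring, hstd.1 m1, hstd.2 m1] at h3
    simp only [mul_neg, Real.sin_neg, Real.cos_neg, s1, s2] at h3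
    simp only [hQ]
    rw [(hc _ m2).1, (hc _ m2).2, h3.1, h3.2]
    linarith
  have hq3 : Q (-(π / 2)) < 0 := by
    rw [← hper, show -(π / 2) + 2 * π = 3 * π / 2 by ring]
    exact hq2
  refine hM.massParameter_of_hyperbolic hμ h htr fun x => ?_
  obtain ⟨z, hz, hxz⟩ := hper.exists_mem_Ico Real.two_pi_pos x (-(π / 2))
  change Q x < 0
  rw [hxz]
  rcases le_total z (π / 2) with hle | hle
  · exact neg_on_Icc_of_convex hA hw hy e hq3 hq1 ⟨hz.1, hle⟩
  -- Over the cusp half, `√f' u` and `√f' v` are `√κ f` and `1/√κ`, so the form times `f'` is a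
  -- quadratic in `f`.
  · refine neg_on_Icc_of_convex (w := fun x => deriv f x) (A := c * κ) (B := d - a) (C := (-b) / κ)
      (mul_nonneg hc0 hκ.le) hf.deriv_pos hf.strictMono.monotone (fun x hx => ?_) hq1 hq2
      ⟨hle, by linarith [hz.2]⟩
    have hq : √(deriv f x) ^ 2 = deriv f x := Real.sq_sqrt (hf.deriv_pos x).le
    have hq0 : 0 < √(deriv f x) := Real.sqrt_pos.2 (hf.deriv_pos x)
    have hk : √κ ^ 2 = κ := Real.sq_sqrt hκ.le
    have hk0 : 0 < √κ := Real.sqrt_pos.2 hκ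
    simp only [hQ]
    rw [(hc _ hx).1, (hc _ hx).2, cuspU, cuspV]
    rw [← hq]
    simp only [Real.sqrt_sq hq0.le]
    rw [← hk]
    simp only [Real.sqrt_sq hk0.le]
    field_simp

/-! ### The glued ends -/

theorem negNeg_glued {mc mh βc βh : ℝ} {g : CollarMetric} {μ fc fh : ℝ → ℝ} (hmc : mc < 0)
    (hmh : mh < 0) (hβc : βc ∈ Set.Ico (0 : ℝ) 1) (hβh : βh ∈ Set.Ico (0 : ℝ) 1)
    (hfc : IsCircleDiffeoLift fc) (hc : Set.EqOn fc (negCheckMap mc βc) (Set.Icc (-(π / 2)) (π / 2)))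
    (hfh : IsCircleDiffeoLift fh) (hh : Set.EqOn fh (negHatMap mh βh) (Set.Icc (π / 2) (3 * π / 2)))
    (hg : IsMaskitGluing (fgMetric (transformMassAspect fc fun _ => mc))
      (fgMetric (transformMassAspect fh fun _ => mh)) g) (hμ : HasMassAspect g μ)
    {M : Matrix (Fin 2) (Fin 2) ℝ}
    (hM : M = negNegMatrix mc mh (boostFactor βc) (boostFactor βh)) :
    ContDiff ℝ ∞ μ ∧ ∃ u v, IsHillBasis μ u v ∧
      HasMonodromyEntries u v (M 0 0) (M 0 1) (M 1 0) (M 1 1) ∧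
      (∀ x ∈ Set.Icc (-(π / 2)) (π / 2), u x = negV fh √|mh| (boostFactor βh) x ∧
        v x = -negU fh √|mh| (boostFactor βh) x) ∧
      (∀ x ∈ Set.Icc (π / 2) (3 * π / 2), u x = negU fc √|mc| (boostFactor βc) x ∧
        v x = negV fc √|mc| (boostFactor βc) x) := by
  obtain ⟨hs, hper, a1, a2⟩ := hg.massAspect hfc hfh hμ
  have kc : 0 < boostFactor βc := by linarith [one_le_boostFactor hβc]
  have kh : 0 < boostFactor βh := by linarith [one_le_boostFactor hβh]
  obtain ⟨Bc, Mc⟩ := hfc.neg_end hmc kc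
  obtain ⟨Bh, Mh⟩ := hfh.neg_end hmh kh
  obtain ⟨sc, sc'⟩ := hfc.neg_check_standard hmc hβc hc
  obtain ⟨sh, sh'⟩ := hfh.neg_hat_standard hmh hβh hh
  obtain ⟨u, v, h1, h2, h3, h4⟩ := exists_glued_basis hs.continuous hper a1 a2 Bc Mc Bh.rotate
    Mh.rotate sc sc' sh sh'
  refine ⟨hs, u, v, h1, h2.congr ?_ ?_ ?_ ?_, h3, h4⟩
  all_goals
    rw [hM]
    simp only [negNegMatrix, Matrix.of_apply, Matrix.cons_val', Matrix.cons_val_zero,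
      Matrix.cons_val_one, Matrix.cons_val_fin_one]
    field_simp
    try ring

theorem cuspCusp_glued {βc βh : ℝ} {g : CollarMetric} {μ fc fh : ℝ → ℝ}
    (hβc : βc ∈ Set.Ico (0 : ℝ) 1) (hβh : βh ∈ Set.Ico (0 : ℝ) 1)
    (hfc : IsCircleDiffeoLift fc) (hc : Set.EqOn fc (cuspCheckMap βc) (Set.Icc (-(π / 2)) (π / 2)))
    (hfh : IsCircleDiffeoLift fh) (hh : Set.EqOn fh (cuspHatMap βh) (Set.Icc (π / 2) (3 * π / 2)))
    (hg : IsMaskitGluing (fgMetric (transformMassAspect fc fun _ => 0))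
      (fgMetric (transformMassAspect fh fun _ => 0)) g) (hμ : HasMassAspect g μ)
    {M : Matrix (Fin 2) (Fin 2) ℝ}
    (hM : M = cuspCuspMatrix (boostFactor βc) (boostFactor βh)) :
    IsMonodromy μ M ∧ 2 < M.trace ∧
      ∃ m : ℝ, 0 < m ∧ HasMassParameter μ m ∧ Real.cosh (√m * π) = M.trace / 2 := by
  obtain ⟨hs, hper, a1, a2⟩ := hg.massAspect hfc hfh hμ
  have kc1 := one_le_boostFactor hβc
  have kh1 := one_le_boostFactor hβh
  have kc : 0 < boostFactor βc := by linarith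
  have kh : 0 < boostFactor βh := by linarith
  obtain ⟨Bc, Mc⟩ := hfc.cusp_end kc
  obtain ⟨Bh, Mh⟩ := hfh.cusp_end kh
  have sc := hfc.cusp_check_standard hβc hc
  obtain ⟨sh, sh'⟩ := hfh.cusp_hat_standard hβh hh
  obtain ⟨u, v, h1, h2, h3, h4⟩ := exists_glued_basis hs.continuous hper a1 a2 Bc Mc Bh.rotate
    Mh.rotate sc.1 sc.2 sh sh'
  have hM' : HasMonodromyEntries u v (M 0 0) (M 0 1) (M 1 0) (M 1 1) := by
    refine h2.congr ?_ ?_ ?_ ?_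
    all_goals
      rw [hM]
      simp only [cuspCuspMatrix, Matrix.of_apply, Matrix.cons_val', Matrix.cons_val_zero,
        Matrix.cons_val_one, Matrix.cons_val_fin_one]
      ring
  set κ := boostFactor βc
  set κ' := boostFactor βh
  have e00 : M 0 0 = (2 * π) ^ 2 * κ * κ' - 1 := by rw [hM]; rfl
  have e01 : M 0 1 = -(2 * π * κ) := by rw [hM]; rfl
  have e10 : M 1 0 = 2 * π * κ' := by rw [hM]; rfl
  have e11 : M 1 1 = -1 := by rw [hM]; rfl
  have hp := Real.pi_gt_three
  -- With `P = 2πκ` and `H = 2πκ'` the trace is `P H - 2`, and both endpoint values of the form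
  -- equal `P + H - P H`.
  have hP : 6 < 2 * π * κ := by nlinarith
  have hH : 6 < 2 * π * κ' := by nlinarith
  have hPH : 36 < (2 * π * κ) * (2 * π * κ') := by nlinarith
  have hPH' : 0 < (2 * π * κ - 6) * (2 * π * κ' - 6) := mul_pos (by linarith) (by linarith)
  have htr : 2 < M 0 0 + M 1 1 := by
    rw [e00, e11]
    linarith
  refine ⟨h1.isMonodromy_matrix hM', by rwa [Matrix.trace_fin_two], ?_⟩
  rw [Matrix.trace_fin_two]
  refine hM'.massParameter_of_cusp hs h1 hfc kc h4 sc (w := fun x => deriv fh x) (y := fh)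
    (A := -(M 0 1) * κ') (B := -(M 1 1 - M 0 0)) (C := M 1 0 / κ') ?_ hfh.deriv_pos
    hfh.strictMono.monotone (fun x hx => ?_) htr ?_ ?_ ?_
  · rw [e01, neg_neg]
    positivity
  · have hq : √(deriv fh x) ^ 2 = deriv fh x := Real.sq_sqrt (hfh.deriv_pos x).le
    have hq0 : 0 < √(deriv fh x) := Real.sqrt_pos.2 (hfh.deriv_pos x)
    have hk : √κ' ^ 2 = κ' := Real.sq_sqrt kh.le
    have hk0 : 0 < √κ' := Real.sqrt_pos.2 kh
    rw [(h3 _ hx).1, (h3 _ hx).2, cuspU, cuspV]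
    rw [← hq]
    simp only [Real.sqrt_sq hq0.le]
    rw [← hk]
    simp only [Real.sqrt_sq hk0.le]
    field_simp
    ring
  · rw [e10]
    positivity
  · rw [e00, e01, e10, e11]
    linarith
  · rw [e00, e01, e10, e11]
    linarith

theorem cuspNeg_glued {mh βc βh : ℝ} {g : CollarMetric} {μ fc fh : ℝ → ℝ} (hmh : mh < 0)
    (hβc : βc ∈ Set.Ico (0 : ℝ) 1) (hβh : βh ∈ Set.Ico (0 : ℝ) 1)
    (hfc : IsCircleDiffeoLift fc) (hc : Set.EqOn fc (cuspCheckMap βc) (Set.Icc (-(π / 2)) (π / 2)))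
    (hfh : IsCircleDiffeoLift fh) (hh : Set.EqOn fh (negHatMap mh βh) (Set.Icc (π / 2) (3 * π / 2)))
    (hg : IsMaskitGluing (fgMetric (transformMassAspect fc fun _ => 0))
      (fgMetric (transformMassAspect fh fun _ => mh)) g) (hμ : HasMassAspect g μ)
    {M : Matrix (Fin 2) (Fin 2) ℝ}
    (hM : M = cuspNegMatrix mh (boostFactor βc) (boostFactor βh)) :
    ContDiff ℝ ∞ μ ∧ IsMonodromy μ M := by
  obtain ⟨hs, hper, a1, a2⟩ := hg.massAspect hfc hfh hμ
  have kc : 0 < boostFactor βc := by linarith [one_le_boostFactor hβc]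
  have kh : 0 < boostFactor βh := by linarith [one_le_boostFactor hβh]
  obtain ⟨Bc, Mc⟩ := hfc.cusp_end kc
  obtain ⟨Bh, Mh⟩ := hfh.neg_end hmh kh
  obtain ⟨sc, sc'⟩ := hfc.cusp_check_standard hβc hc
  obtain ⟨sh, sh'⟩ := hfh.neg_hat_standard hmh hβh hh
  obtain ⟨u, v, h1, h2, -, -⟩ := exists_glued_basis hs.continuous hper a1 a2 Bc Mc Bh.rotate
    Mh.rotate sc sc' sh sh'
  refine ⟨hs, h1.isMonodromy_matrix (h2.congr ?_ ?_ ?_ ?_)⟩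
  all_goals
    rw [hM]
    simp only [cuspNegMatrix, Matrix.of_apply, Matrix.cons_val', Matrix.cons_val_zero,
      Matrix.cons_val_one, Matrix.cons_val_fin_one]
    field_simp
    try ring

theorem cuspPos_glued {mh βc t : ℝ} {g : CollarMetric} {μ fc fh : ℝ → ℝ} (hmh : 0 < mh)
    (hβc : βc ∈ Set.Ico (0 : ℝ) 1) (ht : 1 < t)
    (hfc : IsCircleDiffeoLift fc) (hc : Set.EqOn fc (cuspCheckMap βc) (Set.Icc (-(π / 2)) (π / 2)))
    (hfh : IsCircleDiffeoLift fh) (hh : Set.EqOn fh (posHatMap mh t) (Set.Icc (π / 2) (3 * π / 2)))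
    (hg : IsMaskitGluing (fgMetric (transformMassAspect fc fun _ => 0))
      (fgMetric (transformMassAspect fh fun _ => mh)) g) (hμ : HasMassAspect g μ)
    {M : Matrix (Fin 2) (Fin 2) ℝ} (hM : M = cuspPosMatrix mh (boostFactor βc) t) :
    IsMonodromy μ M ∧ 2 < M.trace ∧
      ∃ m : ℝ, 0 < m ∧ HasMassParameter μ m ∧ Real.cosh (√m * π) = M.trace / 2 := by
  obtain ⟨hs, hper, a1, a2⟩ := hg.massAspect hfc hfh hμ
  have kc1 := one_le_boostFactor hβc
  have kc : 0 < boostFactor βc := by linarith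
  have hp := Real.pi_gt_three
  have hk : 0 < √mh := Real.sqrt_pos.2 hmh
  have hk2 : mh = √mh ^ 2 := (Real.sq_sqrt hmh.le).symm
  have hkπ : 0 < √mh * π := mul_pos hk Real.pi_pos
  have hsinh : 0 < Real.sinh (√mh * π) := Real.sinh_pos_iff.2 hkπ
  set C := Real.cosh (√mh * π) / Real.sinh (√mh * π) with hC
  have hC1 : 1 < C := by
    rw [hC, lt_div_iff₀ hsinh, one_mul]
    exact Real.sinh_lt_cosh _
  have htC : 1 < t * C := by nlinarith
  have r : 0 < √√mh := Real.sqrt_pos.2 hk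
  have r2 : √√mh ^ 2 = √mh := Real.sq_sqrt hk.le
  obtain ⟨Bh, Mh⟩ := hfh.pos_basis hk2 (α := 1 / √√mh) (β := 1 / √√mh) (by
    rw [show 1 / √√mh * (1 / √√mh) = 1 / √√mh ^ 2 by ring, r2]
    field_simp)
  obtain ⟨Bc, Mc⟩ := hfc.cusp_end kc
  have sc := hfc.cusp_check_standard hβc hc
  have sh := fun (x : ℝ) (hx : x ∈ Set.Icc (π / 2) (3 * π / 2)) =>
    hfh.pos_standard hk htC (fun y hy => by rw [hh hy, posHatMap]) hx
  obtain ⟨u, v, h1, h2, h3, h4⟩ := exists_glued_basis hs.continuous hper a1 a2 Bc Mc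
    (Bh.shear (t * C)) (Mh.shear (t * C)) sc.1 sc.2 (fun x hx => (sh x hx).1) (fun x hx => by
      simp only
      rw [(sh x hx).1, (sh x hx).2]
      ring)
  set κ := boostFactor βc
  set E := Real.exp (√mh * π) with hE
  set e := Real.exp (-(√mh * π)) with he
  have hEe : E * e = 1 := by rw [hE, he, ← Real.exp_add]; simp
  have hE1 : 1 < E := Real.one_lt_exp_iff.2 hkπ
  have he0 : 0 < e := Real.exp_pos _
  have hch : Real.cosh (√mh * π) = (E + e) / 2 := Real.cosh_eq _
  have hCe : t * C * (e - E) = -(t * (E + e)) := by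
    rw [hC, hch, Real.sinh_eq, ← hE, ← he]
    have : E - e ≠ 0 := by
      rw [Real.sinh_eq, ← hE, ← he] at hsinh
      linarith
    field_simp
    ring
  have e00 : M 0 0 = 2 * π * κ * (t * (E + e)) - E := by
    rw [hM]
    change 4 * π * κ * t * Real.cosh (√mh * π) - E = _
    rw [hch]
    ring
  have e01 : M 0 1 = -(2 * π * κ * e) := by rw [hM]; rfl
  have e10 : M 1 0 = t * (E + e) := by
    rw [hM]
    change 2 * t * Real.cosh (√mh * π) = _
    rw [hch]
    ring
  have e11 : M 1 1 = -e := by rw [hM]; rfl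
  have hM' : HasMonodromyEntries u v (M 0 0) (M 0 1) (M 1 0) (M 1 1) := by
    rw [hCe] at h2
    refine h2.congr ?_ ?_ ?_ ?_
    · rw [e00]; ring
    · rw [e01]; ring
    · rw [e10]; ring
    · rw [e11]; ring
  -- With `P = 2πκ` and `τ = t (E + e)`, the endpoint values are `τ (1 - P) + E - e + P e` and `τ (1
  -- - P) + (E - e)(P - 1) + P e`. Replacing `τ` by the smaller `E + e` bounds them by `E (2 - P)`
  -- and `e (2 - P)`.
  have hP : 6 < 2 * π * κ := by nlinarith
  have hEe2 : 2 ≤ E + e := by nlinarith [sq_nonneg (E - e)]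
  have htE : E + e < t * (E + e) := by nlinarith
  have htr : 2 < M 0 0 + M 1 1 := by
    rw [e00, e11]
    nlinarith
  refine ⟨h1.isMonodromy_matrix hM', by rwa [Matrix.trace_fin_two], ?_⟩
  rw [Matrix.trace_fin_two]
  -- The form times `fh'` is a combination of `1` and `exp (± √mh fh)`; the extra factor `exp (-√mh
  -- fh)` makes it a quadratic in that exponential. The sign in `y` makes it increasing.
  refine hM'.massParameter_of_cusp hs h1 hfc kc h4 sc
    (w := fun x => deriv fh x * Real.exp (-√mh * fh x))
    (y := fun x => -Real.exp (-√mh * fh x))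
    (A := -(M 0 1) / √mh) (B := -((M 1 1 - M 0 0) - 2 * (-(M 0 1)) * (t * C)) / √mh)
    (C := (M 1 0 - (M 1 1 - M 0 0) * (t * C) + (-(M 0 1)) * (t * C) ^ 2) / √mh)
    ?_ (fun x => mul_pos (hfh.deriv_pos x) (Real.exp_pos _)) ?_ (fun x hx => ?_) htr ?_ ?_ ?_
  · rw [e01, neg_neg]
    positivity
  · intro x z hxz
    have := hfh.strictMono.monotone hxz
    simp only [neg_le_neg_iff, Real.exp_le_exp]
    nlinarith
  · have hq : √(deriv fh x) ^ 2 = deriv fh x := Real.sq_sqrt (hfh.deriv_pos x).le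
    have hq0 : 0 < √(deriv fh x) := Real.sqrt_pos.2 (hfh.deriv_pos x)
    rw [(h3 _ hx).1, (h3 _ hx).2]
    have x1 : Real.exp (-√mh * fh x) = Real.exp (-√mh / 2 * fh x) ^ 2 := by
      rw [← Real.exp_nat_mul]
      congr 1
      push_cast
      ring
    have x2 : Real.exp (√mh / 2 * fh x) = 1 / Real.exp (-√mh / 2 * fh x) := by
      rw [one_div, ← Real.exp_neg]
      congr 1
      ring
    have x3 : 0 < Real.exp (-√mh / 2 * fh x) := Real.exp_pos _
    rw [x1, x2, ← hq]
    simp only [Real.sqrt_sq hq0.le]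
    generalize Real.exp (-√mh / 2 * fh x) = X at *
    field_simp
    rw [r2]
    ring
  · rw [e10]
    linarith
  · rw [e00, e01, e10, e11]
    nlinarith
  · rw [e00, e01, e10, e11]
    nlinarith

/-! ### The mass parameter without boosts -/

/-- Since `u² + v² = 2 / (k f')`, the integrand is the exact derivative of `k f / 2`. -/
theorem integral_deriv_of_half {f u v : ℝ → ℝ} (hf : IsCircleDiffeoLift f) {k p q : ℝ} (hk : 0 < k)
    (hpq : p ≤ q) (h : ∀ x ∈ Set.Icc p q, u x ^ 2 + v x ^ 2 =
      (√2 / √k / √(deriv f x)) ^ 2) :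
    ∫ x in p..q, 1 / (u x ^ 2 + v x ^ 2) = k / 2 * (f q - f p) := by
  have e : ∀ x ∈ Set.uIcc p q, 1 / (u x ^ 2 + v x ^ 2) = k / 2 * deriv f x := by
    intro x hx
    rw [Set.uIcc_of_le hpq] at hx
    rw [h x hx, div_pow, div_pow, Real.sq_sqrt (hf.deriv_pos x).le, Real.sq_sqrt hk.le,
      Real.sq_sqrt (by norm_num)]
    field_simp
  rw [intervalIntegral.integral_congr e, intervalIntegral.integral_const_mul,
    intervalIntegral.integral_eq_sub_of_hasDerivAt (fun x _ => hf.hasDerivAt x)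
      (hf.contDiff_deriv.continuous.intervalIntegrable _ _)]

theorem negU_sq_add_negV_sq (f : ℝ → ℝ) (k x : ℝ) :
    negU f k 1 x ^ 2 + negV f k 1 x ^ 2 = (√2 / √k / √(deriv f x)) ^ 2 := by
  simp only [negU, negV, Real.sqrt_one, mul_one, one_mul]
  linear_combination (√2 / √k / √(deriv f x)) ^ 2 * Real.sin_sq_add_cos_sq (k / 2 * f x)

theorem boostFactor_zero : boostFactor 0 = 1 := by simp [boostFactor]

theorem negCheckMap_zero_ends (m : ℝ) : negCheckMap m 0 (π / 2) = 1 / √|m| * (π / 2) ∧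
    negCheckMap m 0 (-(π / 2)) = -(1 / √|m| * (π / 2)) := by
  simp [negCheckMap]

theorem negHatMap_zero_ends (m : ℝ) : negHatMap m 0 (π / 2) = -(1 / √|m| * (π / 2)) ∧
    negHatMap m 0 (3 * π / 2) = 1 / √|m| * (π / 2) := by
  rw [negHatMap_eq, negHatMap_eq, show π / 2 - π = -(π / 2) by ring,
    show 3 * π / 2 - π = π / 2 by ring]
  exact ⟨(negCheckMap_zero_ends m).2, (negCheckMap_zero_ends m).1⟩

theorem negNegMatrix_one (mc mh : ℝ) : negNegMatrix mc mh 1 1 =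
    !![-Real.cos ((√|mc| + √|mh|) * π), -Real.sin ((√|mc| + √|mh|) * π);
      Real.sin ((√|mc| + √|mh|) * π), -Real.cos ((√|mc| + √|mh|) * π)] := by
  rw [add_mul, Real.cos_add, Real.sin_add, negNegMatrix]
  ext i j
  fin_cases i <;> fin_cases j <;> simp

theorem isEllipticMatrix_rotation (θ : ℝ) :
    IsEllipticMatrix !![-Real.cos θ, -Real.sin θ; Real.sin θ, -Real.cos θ] := by
  by_cases h : |(!![-Real.cos θ, -Real.sin θ; Real.sin θ, -Real.cos θ] :
      Matrix (Fin 2) (Fin 2) ℝ).trace| < 2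
  · exact Or.inr (Or.inr h)
  · rw [Matrix.trace_fin_two_of, not_lt, le_abs] at h
    have hp := Real.sin_sq_add_cos_sq θ
    rcases h with h | h
    · have hc : Real.cos θ = -1 := le_antisymm (by linarith) (Real.neg_one_le_cos θ)
      have hs : Real.sin θ = 0 := by
        rw [hc] at hp
        exact pow_eq_zero_iff (two_ne_zero) |>.1 (by linarith)
      left
      rw [hc, hs, Matrix.one_fin_two]
      norm_num
    · have hc : Real.cos θ = 1 := le_antisymm (Real.cos_le_one θ) (by linarith)
      have hs : Real.sin θ = 0 := by
        rw [hc] at hp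
        exact pow_eq_zero_iff (two_ne_zero) |>.1 (by linarith)
      right
      left
      rw [hc, hs, Matrix.one_fin_two]
      ext i j
      fin_cases i <;> fin_cases j <;> simp

/-- Without boosts `u² + v²` is invariant and its reciprocal integrates explicitly. Over the kept
half, a map `f` with `k = √|m|` advances by `2π - π/k`, contributing `k/2 (2π - π/k) = π (k - 1/2)`;
the two halves add up to `π (√|mc| + √|mh| - 1)`. -/
theorem canBeTransformedToConst_of_no_boost {mc mh : ℝ} {g : CollarMetric} {μ fc fh : ℝ → ℝ}
    (hmc : mc < 0) (hmh : mh < 0)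
    (hfc : IsCircleDiffeoLift fc) (hc : Set.EqOn fc (negCheckMap mc 0) (Set.Icc (-(π / 2)) (π / 2)))
    (hfh : IsCircleDiffeoLift fh) (hh : Set.EqOn fh (negHatMap mh 0) (Set.Icc (π / 2) (3 * π / 2)))
    (hg : IsMaskitGluing (fgMetric (transformMassAspect fc fun _ => mc))
      (fgMetric (transformMassAspect fh fun _ => mh)) g) (hμ : HasMassAspect g μ) :
    IsMonodromy μ (negNegMatrix mc mh 1 1) ∧
      CanBeTransformedToConst μ (-(√|mc| + √|mh| - 1) ^ 2) := by
  have hpi := Real.pi_pos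
  have hz : (0 : ℝ) ∈ Set.Ico (0 : ℝ) 1 := ⟨le_rfl, one_pos⟩
  obtain ⟨hs, u, v, h1, h2, h3, h4⟩ := negNeg_glued hmc hmh hz hz hfc hc hfh hh hg hμ rfl
  rw [boostFactor_zero] at h2 h3 h4
  have kc : 0 < √|mc| := Real.sqrt_pos.2 (abs_pos.2 hmc.ne)
  have kh : 0 < √|mh| := Real.sqrt_pos.2 (abs_pos.2 hmh.ne)
  refine ⟨h1.isMonodromy_matrix h2, ?_⟩
  have h2' := h2
  rw [negNegMatrix_one] at h2'
  obtain ⟨-, hcan⟩ := HasMonodromyEntries.canBeTransformedToConst_of_rotation hs h1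
    (a := -Real.cos ((√|mc| + √|mh|) * π)) (b := -Real.sin ((√|mc| + √|mh|) * π))
    (h2'.congr (by simp) (by simp) (by simp) (by simp)) (-(π / 2))
  have i1 := integral_deriv_of_half hfh kh (show -(π / 2) ≤ π / 2 by linarith) (u := u) (v := v)
    fun x hx => by
      rw [(h3 x hx).1, (h3 x hx).2, ← negU_sq_add_negV_sq]
      ring
  have i2 := integral_deriv_of_half hfc kc (show π / 2 ≤ 3 * π / 2 by linarith) (u := u) (v := v)
    fun x hx => by
      rw [(h4 x hx).1, (h4 x hx).2, ← negU_sq_add_negV_sq]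
  have hcont : Continuous fun x => 1 / (u x ^ 2 + v x ^ 2) := by
    refine continuous_const.div ((h1.left.1.continuous.pow 2).add (h1.right.1.continuous.pow 2))
      fun x => ?_
    rcases h1.ne_zero x with h | h <;> positivity
  have i3 := intervalIntegral.integral_add_adjacent_intervals
    (hcont.intervalIntegrable (μ := MeasureTheory.volume) (-(π / 2)) (π / 2))
    (hcont.intervalIntegrable (π / 2) (3 * π / 2))
  have f1 : fh (3 * π / 2) = fh (-(π / 2)) + 2 * π := by
    rw [← hfh.map_add_two_pi]
    congr 1
    ring
  have f2 : fc (3 * π / 2) = fc (-(π / 2)) + 2 * π := by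
    rw [← hfc.map_add_two_pi]
    congr 1
    ring
  have e1 := hc (show π / 2 ∈ Set.Icc (-(π / 2)) (π / 2) from ⟨by linarith, le_rfl⟩)
  have e2 := hc (show -(π / 2) ∈ Set.Icc (-(π / 2)) (π / 2) from ⟨le_rfl, by linarith⟩)
  have e3 := hh (show π / 2 ∈ Set.Icc (π / 2) (3 * π / 2) from ⟨le_rfl, by linarith⟩)
  have e4 := hh (show 3 * π / 2 ∈ Set.Icc (π / 2) (3 * π / 2) from ⟨by linarith, le_rfl⟩)
  rw [(negCheckMap_zero_ends mc).1] at e1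
  rw [(negCheckMap_zero_ends mc).2] at e2
  rw [(negHatMap_zero_ends mh).1] at e3
  rw [(negHatMap_zero_ends mh).2] at e4
  have e5 : fh (-(π / 2)) = 1 / √|mh| * (π / 2) - 2 * π := by linarith
  rw [i1, i2, e3, e5, f2, e1, e2, show 3 * π / 2 = -(π / 2) + 2 * π by ring] at i3
  rw [← i3] at hcan
  convert hcan using 2
  field_simp
  ring

/-! ### The main theorem -/

/-- A boost factor is the exponential of the rapidity `artanh β`; the coefficient is the hyperbolic
cosine of the total rapidity. -/
theorem boost_coefficient {βc βh : ℝ} (hc : βc ∈ Set.Ico (0 : ℝ) 1) (hh : βh ∈ Set.Ico (0 : ℝ) 1) :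
    √((1 + βc * βh) ^ 2 / ((1 - βc ^ 2) * (1 - βh ^ 2))) =
      (boostFactor βc * boostFactor βh + 1 / (boostFactor βc * boostFactor βh)) / 2 := by
  have kc : 0 < boostFactor βc := by linarith [one_le_boostFactor hc]
  have kh : 0 < boostFactor βh := by linarith [one_le_boostFactor hh]
  have a1 : 0 < 1 - βc := by linarith [hc.2]
  have a2 : 0 < 1 + βc := by linarith [hc.1]
  have b1 : 0 < 1 - βh := by linarith [hh.2]
  have b2 : 0 < 1 + βh := by linarith [hh.1]
  have e : (1 + βc * βh) ^ 2 / ((1 - βc ^ 2) * (1 - βh ^ 2)) =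
      ((boostFactor βc * boostFactor βh + 1 / (boostFactor βc * boostFactor βh)) / 2) ^ 2 := by
    rw [show ((boostFactor βc * boostFactor βh + 1 / (boostFactor βc * boostFactor βh)) / 2) ^ 2 =
      (boostFactor βc ^ 2 * boostFactor βh ^ 2 + 2 +
        1 / (boostFactor βc ^ 2 * boostFactor βh ^ 2)) / 4 by field_simp; ring,
      boostFactor_sq hc, boostFactor_sq hh, show 1 - βc ^ 2 = (1 - βc) * (1 + βc) by ring,
      show 1 - βh ^ 2 = (1 - βh) * (1 + βh) by ring]
    field_simp
    ring
  rw [e, Real.sqrt_sq (by positivity)]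

theorem cos_add_one_mul_pi (s : ℝ) : Real.cos ((s + 1) * π) = -Real.cos (s * π) := by
  rw [add_mul, one_mul, Real.cos_add_pi]

end

theorem mainTheorem10 :
    -- two negative masses, arbitrary boosts
    (∀ (mc mh βc βh : ℝ) (g : CollarMetric) (μ : ℝ → ℝ),
      mc < 0 → mh < 0 → βc ∈ Set.Ico (0 : ℝ) 1 → βh ∈ Set.Ico (0 : ℝ) 1 →
      IsMaskitGluingOfBK mc (negCheckMap mc βc) mh (negHatMap mh βh) g → HasMassAspect g μ →
      ∀ (M : Matrix (Fin 2) (Fin 2) ℝ) (t : ℝ),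
      M = negNegMatrix mc mh (boostFactor βc) (boostFactor βh) →
      t = √((1 + βc * βh) ^ 2 / ((1 - βc ^ 2) * (1 - βh ^ 2)))
            * Real.sin (√|mc| * π) * Real.sin (√|mh| * π)
          - Real.cos (√|mc| * π) * Real.cos (√|mh| * π) →
      IsMonodromy μ M ∧ M.trace / 2 = t ∧
      (IsEllipticMatrix M → ∃ m : ℝ, HasMassParameter μ m ∧ IsRootByZeroCounting μ t m) ∧
      (IsParabolicMatrix M →
        (M 1 0 ≠ 0 → IsSLConjugate M (t • !![1, -t * Real.sign (M 1 0); 0, 1])) ∧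
        (M 1 0 = 0 → IsSLConjugate M (t • !![1, t * Real.sign (M 0 1); 0, 1])))) ∧
    -- two negative masses smaller than `-1/4`, no boosts
    (∀ (mc mh : ℝ) (g : CollarMetric) (μ : ℝ → ℝ),
      mc < -(1 / 4) → mh < -(1 / 4) →
      IsMaskitGluingOfBK mc (negCheckMap mc 0) mh (negHatMap mh 0) g → HasMassAspect g μ →
      ∃ (M : Matrix (Fin 2) (Fin 2) ℝ) (m : ℝ),
        IsMonodromy μ M ∧ IsEllipticMatrix M ∧
        M = !![-Real.cos ((√|mc| + √|mh|) * π), -Real.sin ((√|mc| + √|mh|) * π);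
               Real.sin ((√|mc| + √|mh|) * π), -Real.cos ((√|mc| + √|mh|) * π)] ∧
        HasMassParameter μ m ∧
        Real.cos (√|m| * π) = M.trace / 2 ∧
        M.trace / 2 = Real.cos ((√|mc| + √|mh| + 1) * π) ∧
        IsRootByZeroCounting μ (Real.cos ((√|mc| + √|mh| + 1) * π)) m ∧
        √|m| = √|mc| + √|mh| - 1) ∧
    -- two cusps
    (∀ (βc βh : ℝ) (g : CollarMetric) (μ : ℝ → ℝ),
      βc ∈ Set.Ico (0 : ℝ) 1 → βh ∈ Set.Ico (0 : ℝ) 1 →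
      IsMaskitGluingOfBK 0 (cuspCheckMap βc) 0 (cuspHatMap βh) g → HasMassAspect g μ →
      ∃ (M : Matrix (Fin 2) (Fin 2) ℝ) (m : ℝ),
        M = cuspCuspMatrix (boostFactor βc) (boostFactor βh) ∧
        IsMonodromy μ M ∧ IsHyperbolicMatrix M ∧
        0 < m ∧ HasMassParameter μ m ∧
        Real.cosh (√m * π) = M.trace / 2 ∧
        M.trace / 2 = 2 * π ^ 2 * boostFactor βc * boostFactor βh - 1) ∧
    -- cusp with positive mass
    (∀ (mh βc w : ℝ) (g : CollarMetric) (μ : ℝ → ℝ),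
      0 < mh → βc ∈ Set.Ico (0 : ℝ) 1 → 1 < w →
      IsMaskitGluingOfBK 0 (cuspCheckMap βc) mh (posHatMap mh w) g → HasMassAspect g μ →
      ∃ (M : Matrix (Fin 2) (Fin 2) ℝ) (m : ℝ),
        M = cuspPosMatrix mh (boostFactor βc) w ∧
        IsMonodromy μ M ∧ IsHyperbolicMatrix M ∧
        0 < m ∧ HasMassParameter μ m ∧
        Real.cosh (√m * π) = M.trace / 2 ∧
        M.trace / 2 = Real.cosh (√mh * π) * (2 * π * boostFactor βc * w - 1)) ∧
    -- cusp with negative mass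
    (∀ (mh βc βh : ℝ) (g : CollarMetric) (μ : ℝ → ℝ),
      mh < 0 → βc ∈ Set.Ico (0 : ℝ) 1 → βh ∈ Set.Ico (0 : ℝ) 1 →
      IsMaskitGluingOfBK 0 (cuspCheckMap βc) mh (negHatMap mh βh) g → HasMassAspect g μ →
      ∀ (M : Matrix (Fin 2) (Fin 2) ℝ) (t : ℝ),
      M = cuspNegMatrix mh (boostFactor βc) (boostFactor βh) →
      t = π * boostFactor βc * boostFactor βh * Real.sin (√|mh| * π) - Real.cos (√|mh| * π) →
      IsMonodromy μ M ∧ M.trace / 2 = t ∧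
      (|M.trace| < 2 → ∃ m : ℝ, HasMassParameter μ m ∧ IsRootByZeroCounting μ t m) ∧
      (IsParabolicMatrix M ↔ t = 1 ∨ t = -1) ∧
      (Real.sin (√|mh| * π) = 0 → IsParabolicMatrix M ∧ IsSLConjugate M (t • !![1, 1; 0, 1])) ∧
      (Real.sin (√|mh| * π) ≠ 0 → IsParabolicMatrix M →
        IsSLConjugate M (t • !![1, -1; 0, 1]))) := by
  have hpi := Real.pi_pos
  refine ⟨?_, ?_, ?_, ?_, ?_⟩
  · intro mc mh βc βh g μ hmc hmh hβc hβh ⟨fc, fh, hfc, hc, hfh, hh, hg⟩ hμ M t hM ht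
    obtain ⟨hs, u, v, h1, h2, -, -⟩ := negNeg_glued hmc hmh hβc hβh hfc hc hfh hh hg hμ hM
    have hmon := h1.isMonodromy_matrix h2
    have htr : M.trace / 2 = t := by
      rw [ht, boost_coefficient hβc hβh, hM, negNegMatrix, Matrix.trace_fin_two_of]
      ring
    refine ⟨hmon, htr, fun he => ?_, isSLConjugate_of_parabolic hmon.det_entries htr⟩
    rw [← htr]
    exact hmon.massParameter_of_elliptic hs he
  · intro mc mh g μ hmc hmh ⟨fc, fh, hfc, hc, hfh, hh, hg⟩ hμ
    obtain ⟨h1, h2⟩ := canBeTransformedToConst_of_no_boost (by linarith) (by linarith) hfc hc hfh hh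
      hg hμ
    -- The bound `-1/4` enters here: it makes `√|mc| + √|mh| - 1` positive, hence equal to `√|m|`
    -- and not just to it up to sign.
    have half : ∀ m : ℝ, m < -(1 / 4) → 1 / 2 < √|m| := fun m hm => by
      rw [abs_of_neg (by linarith)]
      exact Real.lt_sqrt_of_sq_lt (by linarith)
    have hpos : 0 < √|mc| + √|mh| - 1 := by linarith [half mc hmc, half mh hmh]
    have hneg : -(√|mc| + √|mh| - 1) ^ 2 < 0 := neg_lt_zero.2 (pow_pos hpos 2)
    have hsqrt : √|-(√|mc| + √|mh| - 1) ^ 2| = √|mc| + √|mh| - 1 := by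
      rw [abs_neg, abs_of_pos (pow_pos hpos 2), Real.sqrt_sq hpos.le]
    obtain ⟨h3, h4⟩ := h2.hasMassParameter_of_neg hneg
    have hcos : Real.cos ((√|mc| + √|mh| - 1) * π) = Real.cos ((√|mc| + √|mh| + 1) * π) := by
      rw [cos_add_one_mul_pi, sub_mul, one_mul, Real.cos_sub_pi]
    rw [negNegMatrix_one] at h1
    rw [hsqrt, hcos] at h4
    have htr : (!![-Real.cos ((√|mc| + √|mh|) * π), -Real.sin ((√|mc| + √|mh|) * π);
        Real.sin ((√|mc| + √|mh|) * π), -Real.cos ((√|mc| + √|mh|) * π)] :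
        Matrix (Fin 2) (Fin 2) ℝ).trace / 2 = Real.cos ((√|mc| + √|mh| + 1) * π) := by
      rw [cos_add_one_mul_pi, Matrix.trace_fin_two_of]
      ring
    exact ⟨_, _, h1, isEllipticMatrix_rotation _, rfl, h3, by rw [hsqrt, htr, hcos], htr, h4, hsqrt⟩
  · intro βc βh g μ hβc hβh ⟨fc, fh, hfc, hc, hfh, hh, hg⟩ hμ
    obtain ⟨h1, h2, m, h3, h4, h5⟩ := cuspCusp_glued hβc hβh hfc hc hfh hh hg hμ rfl
    refine ⟨_, m, rfl, h1, h2.trans_le (le_abs_self _), h3, h4, h5, ?_⟩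
    rw [cuspCuspMatrix, Matrix.trace_fin_two_of]
    ring
  · intro mh βc w g μ hmh hβc hw ⟨fc, fh, hfc, hc, hfh, hh, hg⟩ hμ
    obtain ⟨h1, h2, m, h3, h4, h5⟩ := cuspPos_glued hmh hβc hw hfc hc hfh hh hg hμ rfl
    refine ⟨_, m, rfl, h1, h2.trans_le (le_abs_self _), h3, h4, h5, ?_⟩
    rw [cuspPosMatrix, Matrix.trace_fin_two_of]
    have := Real.cosh_eq (√mh * π)
    linear_combination this
  · intro mh βc βh g μ hmh hβc hβh ⟨fc, fh, hfc, hc, hfh, hh, hg⟩ hμ M t hM ht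
    obtain ⟨hs, hmon⟩ := cuspNeg_glued hmh hβc hβh hfc hc hfh hh hg hμ hM
    have kc : 0 < boostFactor βc := by linarith [one_le_boostFactor hβc]
    have kh : 0 < boostFactor βh := by linarith [one_le_boostFactor hβh]
    have htr : M.trace / 2 = t := by
      rw [ht, hM, cuspNegMatrix, Matrix.trace_fin_two_of]
      ring
    have e01 : M 0 1 = -((2 * π * boostFactor βc * boostFactor βh * Real.cos (√|mh| * π) +
        Real.sin (√|mh| * π)) / boostFactor βh) := by rw [hM]; rfl
    have e10 : M 1 0 = boostFactor βh * Real.sin (√|mh| * π) := by rw [hM]; rfl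
    have hpyth := Real.sin_sq_add_cos_sq (√|mh| * π)
    have hκ : 0 < π * boostFactor βc * boostFactor βh := by positivity
    set κ := boostFactor βc
    set κ' := boostFactor βh
    set s := Real.sin (√|mh| * π)
    set c := Real.cos (√|mh| * π)
    -- With a cusp the monodromy is never `± 1`: both off-diagonal entries would force sine and
    -- cosine to vanish together. Hence parabolicity is a condition on the trace alone.
    have hne : ¬ (M 0 1 = 0 ∧ M 1 0 = 0) := by
      rintro ⟨h01, h10⟩
      have hs0 : s = 0 := (mul_eq_zero.1 (e10.symm.trans h10)).resolve_left kh.ne'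
      rw [e01, hs0] at h01
      have hc0 : c = 0 := by
        field_simp at h01
        simpa [kc.ne', kh.ne'] using h01
      rw [hs0, hc0] at hpyth
      norm_num at hpyth
    have hpar : IsParabolicMatrix M ↔ t = 1 ∨ t = -1 := by
      have htr2 : M.trace = 2 * t := by linarith
      rw [IsParabolicMatrix, htr2, abs_eq (by norm_num)]
      constructor
      · rintro ⟨h | h, -⟩
        · left; linarith
        · right; linarith
      · intro h
        refine ⟨h.imp (fun h => by linarith) (fun h => by linarith), ?_, ?_⟩
        · rintro rfl
          exact hne (by simp)
        · rintro rfl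
          exact hne (by simp)
    refine ⟨hmon, htr, fun h => ?_, hpar, fun hs0 => ?_, fun hs0 hp => ?_⟩
    · rw [← htr]
      exact hmon.massParameter_of_elliptic hs (Or.inr (Or.inr h))
    · have htc : t = -c := by rw [ht, hs0]; ring
      have hp : IsParabolicMatrix M := by
        rw [hpar]
        apply mul_self_eq_one_iff.1
        rw [htc]
        rw [hs0] at hpyth
        linarith
      refine ⟨hp, ?_⟩
      have h10 : M 1 0 = 0 := by rw [e10, hs0, mul_zero]
      have h01 : M 0 1 = 2 * π * κ * t := by
        rw [e01, hs0, htc]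
        field_simp
        ring
      have h2πκ : 0 < 2 * π * κ := by positivity
      have := (isSLConjugate_of_parabolic hmon.det_entries htr hp).2 h10
      have hsign : t * Real.sign (M 0 1) = 1 := by
        rw [h01]
        rcases hpar.1 hp with h | h
        · rw [h, Real.sign_of_pos (by linarith)]
          norm_num
        · rw [h, Real.sign_of_neg (by linarith)]
          norm_num
      rwa [hsign] at this
    · have h10 : M 1 0 ≠ 0 := by
        rw [e10]
        exact mul_ne_zero kh.ne' hs0
      have := (isSLConjugate_of_parabolic hmon.det_entries htr hp).1 h10
      -- As `t = π κ κ' s - c` with `|c| ≤ 1`, a negative `s` gives `t < 1` and a positive one `t >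
      -- -1`; so `t` is the sign of `s`.
      have hsign : -t * Real.sign (M 1 0) = -1 := by
        rw [e10]
        have c1 : c ≤ 1 := Real.cos_le_one _
        have c2 : -1 ≤ c := Real.neg_one_le_cos _
        rcases lt_or_gt_of_ne hs0 with h | h
        · have h3 : π * κ * κ' * s < 0 := mul_neg_of_pos_of_neg hκ h
          have ht1 : t = -1 := (hpar.1 hp).resolve_left fun h1 => by linarith
          rw [ht1, Real.sign_of_neg (mul_neg_of_pos_of_neg kh h)]
          norm_num
        · have h3 : 0 < π * κ * κ' * s := mul_pos hκ h
          have ht1 : t = 1 := (hpar.1 hp).resolve_right fun h1 => by linarith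
          rw [ht1, Real.sign_of_pos (mul_pos kh h)]
          norm_num
      rwa [hsign] at this
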